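/- **Setting.** Let $\mathcal T\subset\mathbb R^2$ be a compact convex set with nonempty interior whose perimeter has length $L$ and counter-clockwise arc-length parametrization $\gamma:\mathbb R\to\partial\mathcal T$ ($L$-periodic; corners allowed), and let $0<\nu\le 1$. Two defenders $D_i,D_j$ move on the perimeter, $\dot s_i=\omega_i$, $\dot s_j=\omega_j$, $|\omega_i|,|\omega_j|\le 1$; an intruder moves in the plane, $\dot x=u$, $\|u\|\le\nu$. Write $\mathrm{arc}(a,b)=(b-a)\bmod L$. For $x\notin\operatorname{int}\mathcal T$ let $S_d(x)$ be the set of perimeter positions that a straight segment from $x$ reaches without meeting $\operatorname{int}\mathcal T$. Let the left breaching point $s_L(x)$ maximize $J_L(s;d,x)=\mathrm{arc}(d,s)-\|\gamma(s)-x\|/\nu$ over $s\in S_d(x)$, and the right breaching point $s_R(x)$ maximize $J_R(s;d,x)=\mathrm{arc}(s,d)-\|\gamma(s)-x\|/\nu$ over $s\in S_d(x)$, for $d\notin S_d(x)$ (the choice of $d$ is immaterial). For all $d$ put $J_L^*(d,x)=J_L(s_L(x);d,x)$ and $J_R^*(d,x)=J_R(s_R(x);d,x)$. The afferent surface $\Gamma_{\rm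 aff}(d)$ is the set of $x$ with $J_L^*(d,x)=J_R^*(d,x)$ for which $d$ lies on the counter-clockwise arc from $s_R(x)$ to $s_L(x)$. Positions of $D_i$ (clockwise side) and $D_j$ (counter-clockwise side) are written as real numbers $s_i\le s_j\le s_i+L$. The game space between positions $a\le b$ is $\mathcal G(a,b)=\bigcup_{a\le d\le b}\Gamma_{\rm aff}(d)$, and the intruder is in $\mathcal G(s_i,s_j)$. Let $s_{\rm mid}=(s_i+s_j)/2$ and $J_{\rm mid}=\tfrac12(s_j-s_i)-\|\gamma(s_{\rm mid})-x\|/\nu$. Then $x\in\mathcal R_i$ if $s_L\in[s_i,s_{\rm mid})$ and $x\in\mathcal G(s_i,s_L)$ (with $s_L$ taken as the representative $s_i+\mathrm{arc}(s_i,s_L)$), $x\in\mathcal R_j$ if $s_R\in(s_{\rm mid},s_j]$ and $x\in\mathcal G(s_R,s_j)$ (with representative $s_j-\mathrm{arc}(s_R,s_j)$). Define $(s_{\rm opt},V_{ij})$ as $(s_L,J_L^*(s_i,x))$ on $\mathcal R_i$, as $(s_R,J_R^*(s_j,x))$ on $\mathcal R_j$ and as $(s_{\rm mid},J_{\rm mid})$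 otherwise. The cooperative intruder-winning region is $\mathcal R_C(s_i,s_j)=\{x\in\mathcal G(s_i,s_j): V_{ij}>0\}$. The quantity $d_{\rm bar}$ is the distance from $x$ to $\mathcal R_C$ together with its barrier, i.e. to $\{x\in\mathcal G(s_i,s_j):V_{ij}\ge 0\}$. The game ends by capture when $x\in\Gamma_{\rm aff}(s_i)\cup\Gamma_{\rm aff}(s_j)$, or by a breach when $x\in\mathcal T$. The payoff is $P_2=-d_{\rm bar}(t_F)$ at the final time $t_F$; it is $0$ at a breach. The intruder maximizes it, the defenders minimize it. Controls are measurable functions of time. Defenders that pass through each other exchange the labels $i,j$, so that $s_i\le s_j\le s_i+L$ throughout. **Theorem.** Let $s_i\le s_j<s_i+L$, $x_A\in\mathcal G(s_i,s_j)$ and $x_A\notin\mathcal R_C(s_i,s_j)$, and write $V_{ij}=V_{ij}(s_i,s_j,x_A)$ for the initial configuration. Then: 1. $-d_{\rm bar}=\nu V_{ij}$; if $s_i<s_j$, then $\mathcal R_C$ is nonempty and the same holds for the distance to $\mathcal R_C$ itself. 2. Under the pincer maneuver $[\omega_i,\omega_j]=[1,-1]$, every intruder control leads to capture in finite time, and the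 game never ends in any other way. 3. The intruder strategy $u_A^*=\nu\,\frac{\gamma(s_{\rm opt})-x_A}{\|\gamma(s_{\rm opt})-x_A\|}$ and the pincer maneuver form an equilibrium with payoff $\nu V_{ij}$. They can be played against each other until capture, always with $P_2=\nu V_{ij}$; $P_2\le\nu V_{ij}$ in every finished play in which the defenders use the pincer maneuver; $P_2\ge\nu V_{ij}$ in every finished play in which the intruder uses $u_A^*$. In a play with $u_A^*$ also $-d_{\rm bar}\ge\nu V_{ij}$ at every time up to the end of the game. 4. The value of the game is $\nu V_{ij}$ (that is, $V_{ij}$ if the payoff is measured in units of time, $P_2/\nu$): for all classes of feedback strategies that contain the pincer maneuver and $u_A^*$, respectively, and in which every pair of strategies admits a finished play, $$\min_{\omega_D}\max_{u_A}P_2=\max_{u_A}\min_{\omega_D}P_2=\nu V_{ij}.$$ -/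

import Mathlib

open MeasureTheory Set

noncomputable section

/-- The Euclidean plane. -/
abbrev Plane : Type := EuclideanSpace ℝ (Fin 2)

/-- The oriented area of two plane vectors. -/
def cross (a b : Plane) : ℝ := a 0 * b 1 - a 1 * b 0

/-- A target: a convex body in the plane, together with the counter-clockwise arc-length
parametrization of its perimeter, extended periodically to the real line. Corners are allowed, so
the unit tangent vector exists almost everywhere. -/
structure Target where
  /-- the target region -/
  body : Set Plane
  convex_body : Convex ℝ body
  isCompact_body : IsCompact body
  interior_nonempty : (interior body).Nonempty
  /-- the length of the perimeter -/
  L : ℝ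
  L_pos : 0 < L
  /-- the perimeter curve -/
  γ : ℝ → Plane
  periodic : Function.Periodic γ L
  injOn : InjOn γ (Ico 0 L)
  range_eq : range γ = frontier body
  lipschitz : LipschitzWith 1 γ
  unit_tangent : ∀ᵐ s, ‖deriv γ s‖ = 1
  /-- counter-clockwise orientation: the body lies to the left of the tangent vector -/
  ccw : ∀ s, ∀ p ∈ body, 0 ≤ cross (deriv γ s) (p - γ s)

namespace Target

variable (P : Target) (ν : ℝ)

/-- The counter-clockwise arc length from position `a` to position `b`, i.e. `(b - a) mod L`. -/
def arc (a b : ℝ) : ℝ := P.L * Int.fract ((b - a) / P.L)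

/-- The perimeter positions that can be reached from `x` by a straight-line path
that does not run through the target. -/
def visible (x : Plane) : Set ℝ := {s | Disjoint (segment ℝ x (P.γ s)) (interior P.body)}

/-- `J_L(b; d, x)`: the time that a defender at `d` running counter-clockwise needs to reach `b`
minus the time that the intruder at `x` needs. -/
def JL (b d : ℝ) (x : Plane) : ℝ := P.arc d b - ‖P.γ b - x‖ / ν

/-- `J_R(b; d, x)`: the same for a defender running clockwise. -/
def JR (b d : ℝ) (x : Plane) : ℝ := P.arc b d - ‖P.γ b - x‖ / ν

/-- `s` maximizes `J_L(·; d, x)` among the visible positions, for defender positions `d` that are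
not visible. (The maximizer does not depend on `d`.) -/
def IsLeftBreach (x : Plane) (s : ℝ) : Prop :=
  s ∈ P.visible x ∧ ∀ d ∉ P.visible x, ∀ b ∈ P.visible x, P.JL ν b d x ≤ P.JL ν s d x

/-- `s` maximizes `J_R(·; d, x)` among the visible positions, for defender positions `d` that are
not visible. -/
def IsRightBreach (x : Plane) (s : ℝ) : Prop :=
  s ∈ P.visible x ∧ ∀ d ∉ P.visible x, ∀ b ∈ P.visible x, P.JR ν b d x ≤ P.JR ν s d x

/-- The left breaching point. -/
def sL (x : Plane) : ℝ := Classical.epsilon (P.IsLeftBreach ν x)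

/-- The right breaching point. -/
def sR (x : Plane) : ℝ := Classical.epsilon (P.IsRightBreach ν x)

/-- `J_L^*`. -/
def JLstar (d : ℝ) (x : Plane) : ℝ := P.JL ν (P.sL ν x) d x

/-- `J_R^*`. -/
def JRstar (d : ℝ) (x : Plane) : ℝ := P.JR ν (P.sR ν x) d x

/-- The afferent surface of a defender at `d`: the part of the singular surface
`J_L^* = J_R^*` on which the defender is between the right and the left breaching point, i.e. the
part that emanates from the defender (the rest, the dispersal surface, emanates from the point
opposite to the defender). -/
def afferent (d : ℝ) : Set Plane :=
  {x | x ∉ interior P.body ∧ P.arc (P.sR ν x) d ≤ P.arc (P.sR ν x) (P.sL ν x) ∧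
    P.JLstar ν d x = P.JRstar ν d x}

/-- The part of the game space between the afferent surfaces of the positions `a` and `b`
(counter-clockwise from `a` to `b`, for real positions `a ≤ b ≤ a + L`): it is
swept by the afferent surfaces of the positions from `a` to `b`. -/
def gameSpace (a b : ℝ) : Set Plane := {x | ∃ d ∈ Icc a b, x ∈ P.afferent ν d}

/-!
In what follows `si` and `sj` are the positions of the clockwise-side defender `D_i` and the
counter-clockwise-side defender `D_j`, as real numbers with `si ≤ sj ≤ si + L`: the arc from `D_i`
to `D_j` that faces the intruder has length `sj - si`.
-/

/-- The midpoint of the two defenders. -/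
def sMid (si sj : ℝ) : ℝ := (si + sj) / 2

/-- `J_mid`. -/
def Jmid (si sj : ℝ) (x : Plane) : ℝ := (sj - si) / 2 - ‖P.γ (sMid si sj) - x‖ / ν

/-- The region `R_i`: the left breaching point is in `[si, sMid)`, and it is to the left of
the intruder as seen from `D_i` (so that it is not a point reached only by going around past
`D_j`). -/
def regionI (si sj : ℝ) : Set Plane :=
  {x | P.arc si (P.sL ν x) < (sj - si) / 2 ∧
    x ∈ P.gameSpace ν si (si + P.arc si (P.sL ν x))}

/-- The region `R_j`: the right breaching point is in `(sMid, sj]`, and it is to the right of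
the intruder as seen from `D_j`. -/
def regionJ (si sj : ℝ) : Set Plane :=
  {x | P.arc (P.sR ν x) sj < (sj - si) / 2 ∧
    x ∈ P.gameSpace ν (sj - P.arc (P.sR ν x) sj) sj}

open Classical in
/-- The optimal breaching point. -/
def sOpt (si sj : ℝ) (x : Plane) : ℝ :=
  if x ∈ P.regionI ν si sj then P.sL ν x
  else if x ∈ P.regionJ ν si sj then P.sR ν x
  else sMid si sj

open Classical in
/-- The function `V_ij`. -/
def V (si sj : ℝ) (x : Plane) : ℝ :=
  if x ∈ P.regionI ν si sj then P.JLstar ν si x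
  else if x ∈ P.regionJ ν si sj then P.JRstar ν sj x
  else P.Jmid ν si sj x

/-- The cooperative intruder-winning region. -/
def winRegion (si sj : ℝ) : Set Plane := {x ∈ P.gameSpace ν si sj | 0 < P.V ν si sj x}

/-- The cooperative intruder-winning region together with its barrier `V_ij = 0`. When the two
defenders meet, the winning region has shrunk to the empty set and this is the point
where they meet. -/
def winRegionWithBarrier (si sj : ℝ) : Set Plane :=
  {x ∈ P.gameSpace ν si sj | 0 ≤ P.V ν si sj x}

/-- `d_bar`: the distance of the intruder to the cooperative intruder-winning region. -/
def dBar (si sj : ℝ) (x : Plane) : ℝ := Metric.infDist x (P.winRegionWithBarrier ν si sj)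

/-- Capture: the intruder is on one of the two afferent surfaces. -/
def Captured (si sj : ℝ) (x : Plane) : Prop := x ∈ P.afferent ν si ∪ P.afferent ν sj

/-- The game is over: capture, or the intruder is at the target. -/
def Terminal (si sj : ℝ) (x : Plane) : Prop := P.Captured ν si sj x ∨ x ∈ P.body

/-- A play of the two vs. one game from a given initial configuration, followed up to a time `tF`
before which the game is not over: measurable controls and the trajectory they generate. As the
labels `i` and `j` only say which defender is on the clockwise and which is on the
counter-clockwise side of the intruder, they are exchanged if the defenders pass through each
other; this is the condition `si ≤ sj ≤ si + L`. -/
structure Play (si₀ sj₀ : ℝ) (x₀ : Plane) where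
  /-- the time up to which the play is followed -/
  tF : ℝ
  tF_nonneg : 0 ≤ tF
  /-- control of `D_i` -/
  ωi : ℝ → ℝ
  /-- control of `D_j` -/
  ωj : ℝ → ℝ
  /-- control of the intruder -/
  u : ℝ → Plane
  measurable_ωi : Measurable ωi
  measurable_ωj : Measurable ωj
  measurable_u : Measurable u
  ωi_le : ∀ t, |ωi t| ≤ 1
  ωj_le : ∀ t, |ωj t| ≤ 1
  u_le : ∀ t, ‖u t‖ ≤ ν
  /-- position of `D_i` -/
  si : ℝ → ℝ
  /-- position of `D_j` -/
  sj : ℝ → ℝ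
  /-- position of the intruder -/
  x : ℝ → Plane
  si_eq : ∀ t ∈ Icc 0 tF, si t = si₀ + ∫ r in (0 : ℝ)..t, ωi r
  sj_eq : ∀ t ∈ Icc 0 tF, sj t = sj₀ + ∫ r in (0 : ℝ)..t, ωj r
  x_eq : ∀ t ∈ Icc 0 tF, x t = x₀ + ∫ r in (0 : ℝ)..t, u r
  sides : ∀ t ∈ Icc 0 tF, si t ≤ sj t ∧ sj t ≤ si t + P.L
  not_over : ∀ t ∈ Ico 0 tF, ¬ P.Terminal ν (si t) (sj t) (x t)

/-- Feedback strategies of the defender pair; they may use the time and the current state. -/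
abbrev DefenderStrategy : Type := ℝ → ℝ → ℝ → Plane → ℝ × ℝ

/-- Feedback strategies of the intruder; they may use the time and the current state. -/
abbrev IntruderStrategy : Type := ℝ → ℝ → ℝ → Plane → Plane

/-- The pincer maneuver `[1, -1]`. -/
def pincer : DefenderStrategy := fun _ _ _ _ => (1, -1)

/-- The intruder strategy `u_A^*`: move at full speed straight to the optimal breaching point. -/
def intruderStar : IntruderStrategy := fun _ si sj x =>
  (ν / ‖P.γ (P.sOpt ν si sj x) - x‖) • (P.γ (P.sOpt ν si sj x) - x)

namespace Play

variable {P ν} {si₀ sj₀ : ℝ} {x₀ : Plane} (p : Play P ν si₀ sj₀ x₀)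

/-- The play ends at `tF`. -/
def Ends : Prop := P.Terminal ν (p.si p.tF) (p.sj p.tF) (p.x p.tF)

/-- The play ends at `tF` with capture. -/
def EndsInCapture : Prop := P.Captured ν (p.si p.tF) (p.sj p.tF) (p.x p.tF)

/-- The payoff `P₂ = -d_bar(tF)`, which the intruder maximizes and the defenders minimize. -/
def payoff : ℝ := - P.dBar ν (p.si p.tF) (p.sj p.tF) (p.x p.tF)

/-- The defenders use the strategy `σ` in the play `p`. -/
def DefendersUse (σ : DefenderStrategy) : Prop :=
  ∀ᵐ t, t ∈ Icc 0 p.tF → (p.ωi t, p.ωj t) = σ t (p.si t) (p.sj t) (p.x t)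

/-- The intruder uses the strategy `τ` in the play `p`. -/
def IntruderUses (τ : IntruderStrategy) : Prop :=
  ∀ᵐ t, t ∈ Icc 0 p.tF → p.u t = τ t (p.si t) (p.sj t) (p.x t)

end Play

/-- The finished plays in which both sides use the given strategies. -/
def plays (si₀ sj₀ : ℝ) (x₀ : Plane) (σ : DefenderStrategy) (τ : IntruderStrategy) :
    Set (Play P ν si₀ sj₀ x₀) :=
  {p | p.Ends ∧ p.DefendersUse σ ∧ p.IntruderUses τ}

/-- `(σ, τ)` is an equilibrium with payoff `v`: the two strategies can be played against each other
until capture, always with payoff `v`; no deviation of the intruder (by any measurable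
control) gives more than `v`, and no deviation of the defenders gives less. -/
def IsEquilibrium (si₀ sj₀ : ℝ) (x₀ : Plane) (σ : DefenderStrategy) (τ : IntruderStrategy)
    (v : ℝ) : Prop :=
  (∃ p ∈ plays P ν si₀ sj₀ x₀ σ τ, p.EndsInCapture) ∧
  (∀ p ∈ plays P ν si₀ sj₀ x₀ σ τ, p.payoff = v) ∧
  (∀ p : Play P ν si₀ sj₀ x₀, p.Ends → p.DefendersUse σ → p.payoff ≤ v) ∧
  (∀ p : Play P ν si₀ sj₀ x₀, p.Ends → p.IntruderUses τ → v ≤ p.payoff)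

/-- The upper value `min_σ max_τ P₂` over classes `𝒟`, `𝒜` of strategies. -/
def upperValue (si₀ sj₀ : ℝ) (x₀ : Plane) (𝒟 : Set DefenderStrategy)
    (𝒜 : Set IntruderStrategy) : EReal :=
  ⨅ σ ∈ 𝒟, ⨆ τ ∈ 𝒜, ⨆ p ∈ plays P ν si₀ sj₀ x₀ σ τ, (p.payoff : EReal)

/-- The lower value `max_τ min_σ P₂` over classes `𝒟`, `𝒜` of strategies. -/
def lowerValue (si₀ sj₀ : ℝ) (x₀ : Plane) (𝒟 : Set DefenderStrategy)
    (𝒜 : Set IntruderStrategy) : EReal :=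
  ⨆ τ ∈ 𝒜, ⨅ σ ∈ 𝒟, ⨅ p ∈ plays P ν si₀ sj₀ x₀ σ τ, (p.payoff : EReal)

end Target

end

/-! Everything rests on one description of `V`: it is the maximum, over the positions b that the
intruder sees, of min (b - si) (sj - b) - ‖γ b - x‖ / ν, the delay of the earlier defender behind
the intruder at b. `le_frameV` proves this; the maximum is attained at the optimal breaching point.

To have an order on the perimeter, fix a position `e` that x does not see (a frame). By convexity
the visible positions form an arc (`not_separated`). It lies in (e, e + L), so arcs modulo L become
differences of real numbers. On this arc let A = `leftVal` be the maximum of b - ‖γ b - x‖ / ν and B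
= `rightVal` the minimum of b + ‖γ b - x‖ / ν. Then x is on the afferent surface of d exactly when d
= (A + B) / 2 modulo L (`mem_afferent_iff`).

The optimal point is the defenders' midpoint clamped to the interval between the right and the left
breaching point. If the clamp is active, the maximum property is that of A or B. If not, the
distance to x changes along the perimeter at rate at most ν, because this rate is monotone on the
visible arc; by convexity a shift of b away from the midpoint then never saves the intruder more
time than it costs (`norm_sub_le_of_mem_Icc`).

A and B change at most at unit rate in the intruder's travel time outside the target
(`exists_visible_of_segment`), hence so does `V` (`frameV_le_add`). The pincer maneuver lowers the
score of every b at unit rate, so `V` cannot increase under it. An intruder heading for the current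
optimal b loses nothing at this b whatever the defenders do, so `V` does not decrease; as `V` is
only Lipschitz in time, this is shown for its derivative almost everywhere and integrated.

For the distance, walking straight to the optimal point until the score of this point is 0 gives
d_bar ≤ -ν V. Conversely, along a segment from a point with `V` ≥ 0 the deficit -`V` grows at most
at unit rate; if the segment leaves the game space or meets the target, the half-width (B - A) / 2
takes over as the bound (`neg_V_le`).

Until capture, (A + B) / 2 stays between the defenders by continuity, and under the pincer maneuver
they meet at time (sj - si) / 2, so the game ends. The two strategies can be played together because
the intruder's initial direction stays optimal, by equality in a triangle inequality. The saddle
point then gives the value. -/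

noncomputable section

/-! ### Tools from one-variable analysis. -/

open Filter Topology

/-- A Lipschitz function whose derivative is nonnegative almost everywhere is nondecreasing. -/
theorem LipschitzOnWith.le_of_ae_deriv_nonneg {f : ℝ → ℝ} {C : NNReal} {a b : ℝ} (hab : a ≤ b)
    (hf : LipschitzOnWith C f (Icc a b))
    (h : ∀ᵐ s, s ∈ Ioo a b → ∀ m, HasDerivAt f m s → 0 ≤ m) : f a ≤ f b := by
  have hac : AbsolutelyContinuousOnInterval f a b := by
    apply LipschitzOnWith.absolutelyContinuousOnInterval (K := C)
    rwa [uIcc_of_le hab]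
  have h1 := hac.integral_deriv_eq_sub
  have h2 : 0 ≤ ∫ x in a..b, deriv f x := by
    apply intervalIntegral.integral_nonneg_of_ae_restrict hab
    have hne : ∀ᵐ s : ℝ, s ≠ a ∧ s ≠ b := by
      have := (measure_eq_zero_iff_ae_notMem (μ := (volume : Measure ℝ)) (s := {a, b})).1
        ((Set.toFinite _).measure_zero _)
      filter_upwards [this] with s hs
      simpa [not_or] using hs
    rw [EventuallyLE, ae_restrict_iff' measurableSet_Icc]
    filter_upwards [h, hne] with s hs hn hsm
    by_cases hd : DifferentiableAt ℝ f s
    · exact hs ⟨lt_of_le_of_ne hsm.1 hn.1.symm, lt_of_le_of_ne hsm.2 hn.2⟩ _ hd.hasDerivAt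
    -- At other points `deriv` has the default value 0, which is harmless here; hence the hypothesis
    -- only concerns actual derivatives.
    · simp [deriv_zero_of_not_differentiableAt hd]
  linarith

/-- A transitive relation between the points of an interval that holds locally holds between the
end points. -/
theorem rel_of_locally_rel {R : ℝ → ℝ → Prop} {a b : ℝ} (hab : a ≤ b)
    (htrans : ∀ r s t, a ≤ r → r ≤ s → s ≤ t → t ≤ b → R r s → R s t → R r t)
    (hloc : ∀ t₀ ∈ Icc a b, ∃ ε > 0, ∀ r ∈ Icc a b, ∀ s ∈ Icc a b, r ≤ s →
      |r - t₀| < ε → |s - t₀| < ε → R r s) : R a b := by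
  set S : Set ℝ := {t | t ∈ Icc a b ∧ R a t} with hS
  have ha : a ∈ S := by
    obtain ⟨ε, hε, h⟩ := hloc a (left_mem_Icc.2 hab)
    exact ⟨left_mem_Icc.2 hab, h a (left_mem_Icc.2 hab) a (left_mem_Icc.2 hab) le_rfl
      (by simpa using hε) (by simpa using hε)⟩
  have hbdd : BddAbove S := ⟨b, fun t ht => ht.1.2⟩
  set c := sSup S
  have hac : a ≤ c := le_csSup hbdd ha
  have hcb : c ≤ b := csSup_le ⟨a, ha⟩ fun t ht => ht.1.2
  obtain ⟨ε, hε, h⟩ := hloc c ⟨hac, hcb⟩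
  obtain ⟨t, htS, ht⟩ := exists_lt_of_lt_csSup ⟨a, ha⟩ (show c - ε < c by linarith)
  have htc : t ≤ c := le_csSup hbdd htS
  have key : ∀ s ∈ Icc a b, t ≤ s → |s - c| < ε → s ∈ S := fun s hs hts hsc =>
    ⟨hs, htrans a t s le_rfl htS.1.1 hts hs.2 htS.2
      (h t htS.1 s hs hts (by rw [abs_lt]; constructor <;> linarith) hsc)⟩
  have hcS : c ∈ S := key c ⟨hac, hcb⟩ htc (by simpa using hε)
  rcases eq_or_lt_of_le hcb with hcb' | hcb'
  · exact hcb' ▸ hcS.2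
  · exfalso
    set s := min b (c + ε / 2)
    have hcs : c < s := lt_min hcb' (by linarith)
    have hs2 : s ≤ c + ε / 2 := min_le_right _ _
    have : s ∈ S := key s ⟨by linarith, min_le_left _ _⟩ (by linarith)
      (by rw [abs_lt]; constructor <;> linarith)
    linarith [le_csSup hbdd this]

/-! ### Plane geometry -/

theorem Plane.inner_eq (a b : Plane) : inner ℝ a b = a 0 * b 0 + a 1 * b 1 := by
  rw [PiLp.inner_apply, Fin.sum_univ_two]
  simp [mul_comm]

theorem Plane.norm_sq_eq (a : Plane) : ‖a‖ ^ 2 = a 0 * a 0 + a 1 * a 1 := by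
  rw [← real_inner_self_eq_norm_sq, Plane.inner_eq]

theorem cross_add_left (a b c : Plane) : cross (a + b) c = cross a c + cross b c := by
  simp only [cross, PiLp.add_apply]; ring

theorem cross_sub_left (a b c : Plane) : cross (a - b) c = cross a c - cross b c := by
  simp only [cross, PiLp.sub_apply]; ring

theorem cross_add_right (a b c : Plane) : cross a (b + c) = cross a b + cross a c := by
  simp only [cross, PiLp.add_apply]; ring

theorem cross_sub_right (a b c : Plane) : cross a (b - c) = cross a b - cross a c := by
  simp only [cross, PiLp.sub_apply]; ring

theorem cross_smul_left (r : ℝ) (a b : Plane) : cross (r • a) b = r * cross a b := by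
  simp only [cross, PiLp.smul_apply, smul_eq_mul]; ring

theorem cross_smul_right (r : ℝ) (a b : Plane) : cross a (r • b) = r * cross a b := by
  simp only [cross, PiLp.smul_apply, smul_eq_mul]; ring

theorem cross_neg_left (a b : Plane) : cross (-a) b = -cross a b := by
  simp only [cross, PiLp.neg_apply]; ring

theorem cross_neg_right (a b : Plane) : cross a (-b) = -cross a b := by
  simp only [cross, PiLp.neg_apply]; ring

@[simp] theorem cross_same (a : Plane) : cross a a = 0 := by
  simp only [cross]; ring

@[simp] theorem cross_zero_left (a : Plane) : cross 0 a = 0 := by simp [cross]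

@[simp] theorem cross_zero_right (a : Plane) : cross a 0 = 0 := by simp [cross]

theorem cross_comm (a b : Plane) : cross b a = -cross a b := by
  simp only [cross]; ring

@[fun_prop] theorem continuous_cross {X : Type*} [TopologicalSpace X] {f g : X → Plane}
    (hf : Continuous f) (hg : Continuous g) : Continuous fun x => cross (f x) (g x) := by
  unfold cross; fun_prop

/-- The expansion of a vector in the basis formed by two others. -/
theorem cross_smul_eq (u e w : Plane) :
    cross u e • w = cross w e • u + cross u w • e := by
  ext i
  fin_cases i <;> simp [cross] <;> ring

theorem cross_sq_add_inner_sq (a b : Plane) :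
    cross a b ^ 2 + inner ℝ a b ^ 2 = ‖a‖ ^ 2 * ‖b‖ ^ 2 := by
  rw [Plane.inner_eq, Plane.norm_sq_eq, Plane.norm_sq_eq, cross]; ring

theorem abs_cross_le (a b : Plane) : |cross a b| ≤ ‖a‖ * ‖b‖ := by
  apply abs_le_of_sq_le_sq _ (by positivity)
  nlinarith [cross_sq_add_inner_sq a b, sq_nonneg (inner ℝ a b : ℝ)]

/-- `cross a` as a linear functional. -/
def crossL (a : Plane) : StrongDual ℝ Plane :=
  LinearMap.toContinuousLinearMap
    { toFun := fun b => cross a b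
      map_add' := fun b c => cross_add_right a b c
      map_smul' := fun r b => by simp [cross_smul_right] }

@[simp] theorem crossL_apply (a b : Plane) : crossL a b = cross a b := rfl

/-- A vector `w` between `u` and `e` makes a smaller angle with `e` than `u` does. -/
theorem inner_le_inner_of_between {u w e : Plane} (k : ℝ) (h1 : 0 ≤ k * cross u w)
    (h2 : 0 ≤ k * cross w e) (h3 : 0 < k * cross u e) :
    inner ℝ u e * ‖w‖ ≤ inner ℝ w e * ‖u‖ := by
  have hu : 0 < ‖u‖ := by
    rw [norm_pos_iff]; rintro rfl; simp at h3
  have he : 0 < ‖e‖ := by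
    rw [norm_pos_iff]; rintro rfl; simp at h3
  set D := k * cross u e
  set α := k * cross w e
  set β := k * cross u w
  -- `w` is in the cone spanned by `u` and `e`. The sign `k` lets the lemma serve both orientations.
  have hw : D • w = α • u + β • e := by
    simp only [D, α, β, mul_smul, ← smul_add, cross_smul_eq u e w]
  have hin : D * inner ℝ w e = α * inner ℝ u e + β * ‖e‖ ^ 2 := by
    have := congrArg (fun v => (inner ℝ v e : ℝ)) hw
    simpa [inner_add_left, real_inner_smul_left, real_inner_self_eq_norm_sq] using this
  have hn1 : D * ‖w‖ ≤ α * ‖u‖ + β * ‖e‖ := by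
    calc D * ‖w‖ = ‖D • w‖ := by rw [norm_smul, Real.norm_of_nonneg h3.le]
      _ ≤ ‖α • u‖ + ‖β • e‖ := by rw [hw]; exact norm_add_le _ _
      _ = _ := by rw [norm_smul, norm_smul, Real.norm_of_nonneg h2, Real.norm_of_nonneg h1]
  have hn2 : α * ‖u‖ ≤ D * ‖w‖ + β * ‖e‖ := by
    have h4 : α • u = D • w - β • e := by rw [hw]; abel
    calc α * ‖u‖ = ‖α • u‖ := by rw [norm_smul, Real.norm_of_nonneg h2]
      _ ≤ ‖D • w‖ + ‖β • e‖ := by rw [h4]; exact norm_sub_le _ _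
      _ = _ := by rw [norm_smul, norm_smul, Real.norm_of_nonneg h3.le, Real.norm_of_nonneg h1]
  have hc := abs_real_inner_le_norm u e
  rw [abs_le] at hc
  set I : ℝ := inner ℝ u e
  have key : D * (I * ‖w‖) ≤ D * (inner ℝ w e * ‖u‖) := by
    have e1 : D * (inner ℝ w e * ‖u‖) = (α * I + β * ‖e‖ ^ 2) * ‖u‖ := by rw [← hin]; ring
    rw [e1]
    have hbe : 0 ≤ β * ‖e‖ := mul_nonneg h1 he.le
    -- For `I` ≥ 0 an upper bound on ‖w‖ is needed, for `I` ≤ 0 a lower one: the two triangle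
    -- inequalities `hn1` and `hn2`.
    rcases le_total 0 I with hI | hI
    · nlinarith [mul_le_mul_of_nonneg_left hn1 hI, mul_le_mul_of_nonneg_left hc.2 hbe]
    · nlinarith [mul_le_mul_of_nonneg_left hn2 (neg_nonneg.2 hI),
        mul_le_mul_of_nonneg_left hc.1 hbe]
  exact le_of_mul_le_mul_left key h3

namespace Target

variable (P : Target)

/-! ### The target and its perimeter -/

theorem isClosed_body : IsClosed P.body := P.isCompact_body.isClosed

theorem continuous_γ : Continuous P.γ := P.lipschitz.continuous

theorem γ_mem_frontier (s : ℝ) : P.γ s ∈ frontier P.body := P.range_eq ▸ mem_range_self s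

theorem γ_mem (s : ℝ) : P.γ s ∈ P.body := P.isClosed_body.frontier_subset (P.γ_mem_frontier s)

theorem γ_notMem_interior (s : ℝ) : P.γ s ∉ interior P.body := (P.γ_mem_frontier s).2

theorem closure_interior : closure (interior P.body) = P.body := by
  rw [P.convex_body.closure_interior_eq_closure_of_nonempty_interior P.interior_nonempty,
    P.isClosed_body.closure_eq]

theorem γ_add_int_mul (s : ℝ) (k : ℤ) : P.γ (s + k * P.L) = P.γ s := by
  have := P.periodic.int_mul k s
  simpa using this

theorem exists_γ_eq {q : Plane} (hq : q ∈ P.body) (hq' : q ∉ interior P.body) (e : ℝ) :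
    ∃ s ∈ Ico e (e + P.L), P.γ s = q := by
  have : q ∈ range P.γ := by
    rw [P.range_eq]; exact ⟨subset_closure hq, hq'⟩
  obtain ⟨s, rfl⟩ := this
  obtain ⟨y, hy, hy'⟩ := P.periodic.exists_mem_Ico P.L_pos s e
  exact ⟨y, hy, hy'.symm⟩

theorem eq_of_γ_eq {e s s' : ℝ} (hs : s ∈ Ico e (e + P.L)) (hs' : s' ∈ Ico e (e + P.L))
    (h : P.γ s = P.γ s') : s = s' := by
  obtain ⟨k, hk, -⟩ := existsUnique_add_zsmul_mem_Ico P.L_pos s 0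
  obtain ⟨k', hk', -⟩ := existsUnique_add_zsmul_mem_Ico P.L_pos s' 0
  simp only [zsmul_eq_mul, zero_add] at hk hk'
  have h1 := P.injOn hk hk' (by rw [P.γ_add_int_mul, P.γ_add_int_mul, h])
  have h2 : s - s' = ((k' - k : ℤ) : ℝ) * P.L := by push_cast; linarith
  have h3 : ((k' - k : ℤ) : ℝ) = 0 := by
    have hL := P.L_pos
    have ha : ((k' - k : ℤ) : ℝ) * P.L < 1 * P.L := by rw [← h2]; linarith [hs.2, hs'.1]
    have hb : (-1) * P.L < ((k' - k : ℤ) : ℝ) * P.L := by rw [← h2]; linarith [hs.1, hs'.2]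
    have ha' : k' - k < 1 := by exact_mod_cast lt_of_mul_lt_mul_right ha hL.le
    have hb' : -1 < k' - k := by exact_mod_cast lt_of_mul_lt_mul_right hb hL.le
    have : k' - k = 0 := by omega
    exact_mod_cast this
  rw [h3] at h2; linarith

theorem norm_γ_sub_le (s s' : ℝ) : ‖P.γ s - P.γ s'‖ ≤ |s - s'| := by
  have := P.lipschitz.dist_le_mul s s'
  simpa [dist_eq_norm] using this

/-- A nonzero functional does not attain its maximum over the target in the interior. -/
theorem lt_of_mem_interior {f : StrongDual ℝ Plane} (hf : f ≠ 0) {m : ℝ}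
    (h : ∀ q ∈ P.body, f q ≤ m) {o : Plane} (ho : o ∈ interior P.body) : f o < m := by
  obtain ⟨v, hv⟩ : ∃ v, 0 < f v := by
    obtain ⟨v, hv⟩ : ∃ v, f v ≠ 0 := by
      by_contra! hcon
      exact hf (ContinuousLinearMap.ext hcon)
    rcases lt_or_gt_of_ne hv with h' | h'
    · exact ⟨-v, by simpa using h'⟩
    · exact ⟨v, h'⟩
  have hc : Tendsto (fun ε : ℝ => o + ε • v) (𝓝[>] 0) (𝓝 o) := by
    have : Continuous fun ε : ℝ => o + ε • v := by fun_prop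
    simpa using (this.tendsto 0).mono_left nhdsWithin_le_nhds
  obtain ⟨ε, hε, hε0⟩ := ((hc.eventually (isOpen_interior.mem_nhds ho)).and
    self_mem_nhdsWithin).exists
  have h1 := h _ (interior_subset hε)
  have : 0 < ε * f v := mul_pos hε0 hv
  simp at h1
  linarith

theorem le_of_interior {f : StrongDual ℝ Plane} {m : ℝ} (h : ∀ y ∈ interior P.body, f y < m)
    {q : Plane} (hq : q ∈ P.body) : f q ≤ m := by
  rw [← P.closure_interior] at hq
  exact closure_minimal (fun y hy => (h y hy).le : interior P.body ⊆ {y | f y ≤ m})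
    (isClosed_le f.continuous continuous_const) hq

theorem cross_nonneg {s : ℝ} {t : Plane} (ht : HasDerivAt P.γ t s) {q : Plane}
    (hq : q ∈ P.body) : 0 ≤ cross t (q - P.γ s) := by
  have := P.ccw s q hq
  rwa [ht.deriv] at this

theorem cross_pos {s : ℝ} {t : Plane} (ht : HasDerivAt P.γ t s) (h1 : t ≠ 0) {q : Plane}
    (hq : q ∈ interior P.body) : 0 < cross t (q - P.γ s) := by
  have hne : -crossL t ≠ 0 := by
    intro h0
    -- The test vector is `t` turned by a right angle; its cross product with `t` is ‖t‖ ^ 2.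
    have := congrArg (fun f : StrongDual ℝ Plane => f (!₂[- t 1, t 0])) h0
    simp [cross] at this
    apply h1
    ext i
    fin_cases i <;> simp <;> nlinarith [sq_nonneg (t 0), sq_nonneg (t 1)]
  have := P.lt_of_mem_interior hne (m := -cross t (P.γ s)) (fun q hq => by
    have := P.cross_nonneg ht hq
    rw [cross_sub_right] at this
    simp; linarith) hq
  simp at this
  rw [cross_sub_right]; linarith

/-- Almost every perimeter position is smooth. -/
theorem ae_hasDerivAt : ∀ᵐ s, HasDerivAt P.γ (deriv P.γ s) s ∧ ‖deriv P.γ s‖ = 1 := by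
  filter_upwards [P.unit_tangent] with s hs
  refine ⟨DifferentiableAt.hasDerivAt ?_, hs⟩
  by_contra h
  rw [deriv_zero_of_not_differentiableAt h] at hs
  simp at hs

/-! ### Visibility -/

theorem mem_visible_iff_forall {x : Plane} {s : ℝ} :
    s ∈ P.visible x ↔ ∀ θ ∈ Icc (0 : ℝ) 1, (1 - θ) • x + θ • P.γ s ∉ interior P.body := by
  simp only [visible, mem_ofPred_eq, segment_eq_image, disjoint_left, forall_mem_image]

/-- Hahn–Banach separates the open interior from the sight line. So visibility means that some
supporting line of the target at γ s has the viewer on its outer side, which is a linear condition.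
-/
theorem mem_visible_iff {x : Plane} {s : ℝ} :
    s ∈ P.visible x ↔ ∃ f : StrongDual ℝ Plane,
      (∀ y ∈ interior P.body, f y < f (P.γ s)) ∧ f (P.γ s) ≤ f x := by
  constructor
  · intro h
    obtain ⟨f, u, h1, h2⟩ := geometric_hahn_banach_open P.convex_body.interior isOpen_interior
      (convex_segment x (P.γ s)) (Disjoint.symm h)
    have h3 : u ≤ f (P.γ s) := h2 _ (right_mem_segment _ _ _)
    have h4 : f (P.γ s) ≤ u := P.le_of_interior h1 (P.γ_mem s)
    exact ⟨f, fun y hy => (h1 y hy).trans_le h3, h4.trans (h2 _ (left_mem_segment _ _ _))⟩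
  · rintro ⟨f, h1, h2⟩
    rw [mem_visible_iff_forall]
    intro θ hθ hmem
    have := h1 _ hmem
    simp only [map_add, map_smul, smul_eq_mul] at this
    nlinarith [mul_le_mul_of_nonneg_left h2 (sub_nonneg.2 hθ.2)]

theorem mem_visible_add_int_mul {x : Plane} {s : ℝ} (k : ℤ) :
    s + k * P.L ∈ P.visible x ↔ s ∈ P.visible x := by
  simp only [visible, mem_ofPred_eq, P.γ_add_int_mul]

theorem mem_visible_congr {x : Plane} {s s' : ℝ} (h : P.γ s = P.γ s') :
    s ∈ P.visible x ↔ s' ∈ P.visible x := by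
  simp only [visible, mem_ofPred_eq, h]

/-- A supporting functional at γ s is at most its value at γ s on `q` and at least that at the
intermediate point, hence also at `x`. So an unseen base position stays unseen while the intruder
heads for the target. -/
theorem visible_subset_of_mem_segment {x q : Plane} (hq : q ∈ P.body) {θ : ℝ}
    (hθ : θ ∈ Ico (0 : ℝ) 1) : P.visible ((1 - θ) • x + θ • q) ⊆ P.visible x := by
  intro s hs
  obtain ⟨f, h1, h2⟩ := P.mem_visible_iff.1 hs
  refine P.mem_visible_iff.2 ⟨f, h1, ?_⟩
  have h3 := P.le_of_interior h1 hq
  simp only [map_add, map_smul, smul_eq_mul] at h2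
  nlinarith [hθ.1, hθ.2, mul_le_mul_of_nonneg_left h3 hθ.1]

theorem isClosed_visible_graph : IsClosed {p : Plane × ℝ | p.2 ∈ P.visible p.1} := by
  have : {p : Plane × ℝ | p.2 ∈ P.visible p.1} = ⋂ θ ∈ Icc (0 : ℝ) 1,
      {p : Plane × ℝ | (1 - θ) • p.1 + θ • P.γ p.2 ∈ (interior P.body)ᶜ} := by
    ext p
    simp only [mem_ofPred_eq, mem_iInter, mem_visible_iff_forall, mem_compl_iff]
  rw [this]
  have hγ := P.continuous_γ
  exact isClosed_biInter fun θ _ => isOpen_interior.isClosed_compl.preimage (by fun_prop)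

theorem isClosed_visible (x : Plane) : IsClosed (P.visible x) :=
  P.isClosed_visible_graph.preimage (f := fun s => (x, s)) (by fun_prop)

/-- One base position thus serves as a frame for all nearby intruder positions. -/
theorem eventually_notMem_visible {x : Plane} {e : ℝ} (he : e ∉ P.visible x) :
    ∀ᶠ x' in 𝓝 x, e ∉ P.visible x' := by
  have : IsClosed {x' | e ∈ P.visible x'} :=
    P.isClosed_visible_graph.preimage (f := fun x' => (x', e)) (by fun_prop)
  exact this.isOpen_compl.mem_nhds he

/-- The first perimeter point on the way from an outer point to a point of the target is visible. -/
theorem exists_visible_mem_segment {x q : Plane} (hx : x ∉ interior P.body) (hq : q ∈ P.body)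
    (e : ℝ) : ∃ c ∈ Ico e (e + P.L), c ∈ P.visible x ∧
      ∃ θ ∈ Icc (0 : ℝ) 1, P.γ c = (1 - θ) • x + θ • q := by
  set S : Set ℝ := {θ ∈ Icc (0 : ℝ) 1 | (1 - θ) • x + θ • q ∈ P.body} with hS
  have hcont : Continuous fun θ : ℝ => (1 - θ) • x + θ • q := by fun_prop
  have hSc : IsCompact S := isCompact_Icc.inter_right (P.isClosed_body.preimage hcont)
  obtain ⟨θ, hθ, hmin⟩ := hSc.exists_isLeast ⟨1, by simp, by simpa using hq⟩
  have hlow : ∀ η ∈ Icc (0 : ℝ) 1, η ≤ θ → (1 - η) • x + η • q ∉ interior P.body := by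
    intro η hη hle hmem
    have h1 : η = θ := le_antisymm hle (hmin ⟨hη, interior_subset hmem⟩)
    rcases eq_or_lt_of_le hη.1 with h0 | h0
    · rw [← h0] at hmem; simp at hmem; exact hx hmem
    · have := hcont.continuousAt (x := η) |>.eventually (isOpen_interior.mem_nhds hmem)
      have h2 : ∀ᶠ ζ in 𝓝[<] η, (1 - ζ) • x + ζ • q ∈ interior P.body :=
        this.filter_mono nhdsWithin_le_nhds
      obtain ⟨ζ, hζ, hζ1⟩ := (h2.and (Ioo_mem_nhdsLT h0)).exists
      have := hmin ⟨⟨hζ1.1.le, hζ1.2.le.trans hη.2⟩, interior_subset hζ⟩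
      linarith [hζ1.2]
  obtain ⟨c, hc, hγ⟩ := P.exists_γ_eq hθ.2 (hlow θ hθ.1 le_rfl) e
  refine ⟨c, hc, ?_, θ, hθ.1, hγ⟩
  rw [mem_visible_iff_forall]
  intro η hη
  have h1 : (1 - η) • x + η • P.γ c = (1 - η * θ) • x + (η * θ) • q := by
    rw [hγ]; module
  rw [h1]
  have h2 : η * θ ≤ θ := mul_le_of_le_one_left hθ.1.1 hη.2
  exact hlow _ ⟨mul_nonneg hη.1 hθ.1.1, h2.trans hθ.1.2⟩ h2

/-- Not all positions are visible. -/
theorem exists_notMem_visible {x : Plane} (hx : x ∉ interior P.body) : ∃ e, e ∉ P.visible x := by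
  obtain ⟨o, ho⟩ := P.interior_nonempty
  have hox : o - x ≠ 0 := fun h => hx (by rwa [sub_eq_zero.1 h] at ho)
  have hn : 0 < ‖o - x‖ := norm_pos_iff.2 hox
  -- The last target point on the ray from `x` through the interior point `o` is on the perimeter
  -- and is hidden behind `o`.
  set S : Set ℝ := {r ∈ Ici (1 : ℝ) | x + r • (o - x) ∈ P.body} with hS
  have hcont : Continuous fun r : ℝ => x + r • (o - x) := by fun_prop
  obtain ⟨M, hM⟩ := P.isCompact_body.isBounded.exists_norm_le
  have hSc : IsCompact S := by
    refine Metric.isCompact_of_isClosed_isBounded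
      (isClosed_Ici.inter (P.isClosed_body.preimage hcont)) ?_
    rw [isBounded_iff_forall_norm_le]
    refine ⟨(M + ‖x‖) / ‖o - x‖, fun r hr => ?_⟩
    rw [le_div_iff₀ hn, ← norm_smul]
    calc ‖r • (o - x)‖ = ‖(x + r • (o - x)) - x‖ := by congr 1; abel
      _ ≤ ‖x + r • (o - x)‖ + ‖x‖ := norm_sub_le _ _
      _ ≤ M + ‖x‖ := by gcongr; exact hM _ hr.2
  obtain ⟨r, hr, hmax⟩ := hSc.exists_isGreatest
    ⟨1, mem_Ici.2 le_rfl, by simpa using interior_subset ho⟩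
  have hnot : x + r • (o - x) ∉ interior P.body := by
    intro hmem
    have h2 : ∀ᶠ ζ in 𝓝[>] r, x + ζ • (o - x) ∈ interior P.body :=
      (hcont.continuousAt (x := r) |>.eventually (isOpen_interior.mem_nhds hmem)).filter_mono
        nhdsWithin_le_nhds
    obtain ⟨ζ, hζ, hζ1⟩ := (h2.and self_mem_nhdsWithin).exists
    have hζ2 : r < ζ := hζ1
    have := hmax ⟨(mem_Ici.1 hr.1).trans hζ2.le, interior_subset hζ⟩
    linarith
  obtain ⟨s, -, hs⟩ := P.exists_γ_eq hr.2 hnot 0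
  have hr1 : 1 ≤ r := hr.1
  have hr0 : r ≠ 0 := by positivity
  refine ⟨s, fun hv => (P.mem_visible_iff_forall.1 hv) (1 / r) ⟨by positivity, ?_⟩ ?_⟩
  · rw [div_le_one (by linarith)]; exact hr1
  · rw [hs]
    convert ho using 1
    rw [smul_add, smul_smul, one_div, inv_mul_cancel₀ hr0, one_smul, sub_smul, one_smul]
    abel

/-- Two visible positions are not separated by two positions that are not visible. -/
theorem not_separated {x : Plane} {d₁ d₂ a b : ℝ}
    (h₁ : d₁ ∉ P.visible x) (h₂ : d₂ ∉ P.visible x) (ha : a ∈ P.visible x) (hb : b ∈ P.visible x)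
    (h₁a : d₁ < a) (ha₂ : a < d₂) (h₂b : d₂ < b) (hb₁ : b < d₁ + P.L) : False := by
  -- A visible position is the same as a maximizer over the target of some functional in the convex
  -- set `N`. Connectedness is used twice: first for `N`, then for the set of maximizers of one
  -- functional.
  set N : Set (StrongDual ℝ Plane) := {f | ∀ y ∈ interior P.body, f y < f x} with hN
  have hNconv : Convex ℝ N := by
    intro f hf g hg p q hp hq hpq y hy
    have h3 := hf y hy
    have h4 := hg y hy
    simp only [add_apply, smul_apply, smul_eq_mul]
    rcases eq_or_lt_of_le hp with h0 | h0
    · rw [← h0] at hpq ⊢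
      have : q = 1 := by linarith
      rw [this]; linarith
    · nlinarith
  have hne : ∀ f ∈ N, f ≠ 0 := by
    rintro f hf rfl
    obtain ⟨y, hy⟩ := P.interior_nonempty
    simpa using hf y hy
  -- a maximizer of a functional of `N` is visible
  have hvis : ∀ f ∈ N, ∀ s, (∀ y ∈ P.body, f y ≤ f (P.γ s)) → s ∈ P.visible x := by
    intro f hf s hs
    exact P.mem_visible_iff.2 ⟨f, fun y hy => P.lt_of_mem_interior (hne f hf) hs hy,
      P.le_of_interior hf (P.γ_mem s)⟩
  have hmemN : ∀ s ∈ P.visible x, ∃ f ∈ N, ∀ y ∈ P.body, f y ≤ f (P.γ s) := by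
    intro s hs
    obtain ⟨f, hf1, hf2⟩ := P.mem_visible_iff.1 hs
    exact ⟨f, fun y hy => (hf1 y hy).trans_le hf2, fun y hy => P.le_of_interior hf1 hy⟩
  set C₁ := P.γ '' Icc d₁ d₂ with hC₁
  set C₂ := P.γ '' Icc d₂ (d₁ + P.L) with hC₂
  have hC₁c : IsCompact C₁ := isCompact_Icc.image P.continuous_γ
  have hC₂c : IsCompact C₂ := isCompact_Icc.image P.continuous_γ
  have hclosed : ∀ C : Set Plane, IsCompact C →
      IsClosed {f : StrongDual ℝ Plane | ∃ q ∈ C, ∀ y ∈ P.body, f y ≤ f q} := by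
    intro C hC
    have hcl : IsClosed {p : StrongDual ℝ Plane × C | ∀ y ∈ P.body, p.1 y ≤ p.1 p.2} := by
      have : {p : StrongDual ℝ Plane × C | ∀ y ∈ P.body, p.1 y ≤ p.1 p.2} =
          ⋂ y ∈ P.body, {p : StrongDual ℝ Plane × C | p.1 y ≤ p.1 p.2} := by
        ext p; simp
      rw [this]
      refine isClosed_biInter fun y _ => isClosed_le ?_ ?_
      · fun_prop
      · exact isBoundedBilinearMap_apply.continuous.comp
          (continuous_fst.prodMk (continuous_subtype_val.comp continuous_snd))
    have : CompactSpace C := isCompact_iff_compactSpace.1 hC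
    convert isClosedMap_fst_of_compactSpace _ hcl using 1
    ext f
    simp
  have hcover : ∀ q ∈ frontier P.body, q ∈ C₁ ∪ C₂ := by
    intro q hq
    obtain ⟨s, hs, rfl⟩ := P.exists_γ_eq (P.isClosed_body.frontier_subset hq) hq.2 d₁
    rcases le_total s d₂ with h | h
    · exact Or.inl ⟨s, ⟨hs.1, h⟩, rfl⟩
    · exact Or.inr ⟨s, ⟨h, hs.2.le⟩, rfl⟩
  have hfr : ∀ f ∈ N, ∀ q ∈ P.body, (∀ y ∈ P.body, f y ≤ f q) → q ∈ frontier P.body :=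
    fun f hf q hq hmax =>
      ⟨subset_closure hq, fun hi => lt_irrefl _ (P.lt_of_mem_interior (hne f hf) hmax hi)⟩
  obtain ⟨fa, hfa, hfa'⟩ := hmemN a ha
  obtain ⟨fb, hfb, hfb'⟩ := hmemN b hb
  -- `N` is covered by two closed sets, according to the arc that contains a maximizer; by
  -- connectedness one functional has maximizers on both arcs.
  obtain ⟨f, hfN, ⟨q₁, hq₁, hm₁⟩, ⟨q₂, hq₂, hm₂⟩⟩ :=
    isPreconnected_closed_iff.1 hNconv.isPreconnected _ _ (hclosed C₁ hC₁c) (hclosed C₂ hC₂c)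
      (fun f hf => by
        obtain ⟨q, hq, hmax⟩ := P.isCompact_body.exists_isMaxOn
          (P.interior_nonempty.mono interior_subset) f.continuous.continuousOn
        rcases hcover q (hfr f hf q hq hmax) with h | h
        · exact Or.inl ⟨q, h, hmax⟩
        · exact Or.inr ⟨q, h, hmax⟩)
      ⟨fa, hfa, P.γ a, ⟨a, ⟨h₁a.le, ha₂.le⟩, rfl⟩, hfa'⟩
      ⟨fb, hfb, P.γ b, ⟨b, ⟨h₂b.le, hb₁.le⟩, rfl⟩, hfb'⟩
  have hsub : ∀ C, C = C₁ ∨ C = C₂ → C ⊆ P.body := by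
    rintro C (rfl | rfl) _ ⟨s, -, rfl⟩ <;> exact P.γ_mem s
  have hq₁K := hsub _ (Or.inl rfl) hq₁
  have hq₂K := hsub _ (Or.inr rfl) hq₂
  have heq : f q₁ = f q₂ := le_antisymm (hm₂ _ hq₁K) (hm₁ _ hq₂K)
  have hseg : ∀ q ∈ segment ℝ q₁ q₂, q ∈ P.body ∧ ∀ y ∈ P.body, f y ≤ f q := by
    intro q hq
    refine ⟨P.convex_body.segment_subset hq₁K hq₂K hq, fun y hy => ?_⟩
    obtain ⟨α, β, hα, hβ, hαβ, rfl⟩ := hq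
    have := hm₁ y hy
    simp only [map_add, map_smul, smul_eq_mul, ← heq, ← add_mul, hαβ, one_mul]
    exact this
  -- The segment between these maximizers consists of maximizers on the perimeter, so it contains a
  -- common point of the two arcs. Such a point is at `d₁` or `d₂`, which would then be visible.
  obtain ⟨q, hqs, ⟨s₁, hs₁, rfl⟩, s₂, hs₂, hs₁₂⟩ :=
    isPreconnected_closed_iff.1 (convex_segment q₁ q₂).isPreconnected _ _ hC₁c.isClosed
      hC₂c.isClosed (fun q hq => hcover q (hfr f hfN q (hseg q hq).1 (hseg q hq).2))
      ⟨q₁, left_mem_segment _ _ _, hq₁⟩ ⟨q₂, right_mem_segment _ _ _, hq₂⟩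
  have hvs : s₁ ∈ P.visible x := hvis f hfN s₁ (hseg _ hqs).2
  have hL := P.L_pos
  have hs₁m : s₁ ∈ Ico d₁ (d₁ + P.L) := ⟨hs₁.1, by linarith [hs₁.2]⟩
  rcases eq_or_lt_of_le hs₂.2 with h | h
  · have h3 : P.γ d₁ = P.γ s₁ := by
      rw [← hs₁₂, h]; exact (P.periodic d₁).symm
    exact h₁ ((P.mem_visible_congr h3).2 hvs)
  · have h3 := P.eq_of_γ_eq hs₁m ⟨by linarith [hs₂.1], h⟩ hs₁₂.symm
    have h4 : s₁ = d₂ := le_antisymm hs₁.2 (h3 ▸ hs₂.1)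
    exact h₂ (h4 ▸ hvs)

/-- The visible positions form an arc. -/
theorem mem_visible_of_between {x : Plane} {e a b c : ℝ}
    (he : e ∉ P.visible x) (ha : a ∈ P.visible x) (hb : b ∈ P.visible x)
    (hea : e ≤ a) (hac : a ≤ c) (hcb : c ≤ b) (hbe : b ≤ e + P.L) : c ∈ P.visible x := by
  have heL : e + P.L ∉ P.visible x := fun h => he (by
    have := P.mem_visible_add_int_mul (x := x) (s := e) 1
    simp only [Int.cast_one, one_mul] at this
    exact this.1 h)
  by_contra hc
  have hne : ∀ {u v : ℝ}, u ∈ P.visible x → v ∉ P.visible x → u ≠ v := by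
    rintro u v hu hv rfl; exact hv hu
  exact P.not_separated he hc ha hb (lt_of_le_of_ne hea (hne ha he).symm)
    (lt_of_le_of_ne hac (hne ha hc)) (lt_of_le_of_ne hcb (hne hb hc).symm)
    (lt_of_le_of_ne hbe (hne hb heL))

/-- At a visible smooth position, the viewer is to the right of the tangent. -/
theorem cross_nonpos_of_visible {x : Plane} {s : ℝ} (hs : s ∈ P.visible x) {t : Plane}
    (ht : HasDerivAt P.γ t s) (h1 : t ≠ 0) : cross t (x - P.γ s) ≤ 0 := by
  obtain ⟨f, hf1, hf2⟩ := P.mem_visible_iff.1 hs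
  obtain ⟨o, ho⟩ := P.interior_nonempty
  -- `f ∘ γ` is maximal at `s`, so the supporting functional vanishes on the tangent; it can then be
  -- compared with `cross t` through an interior point.
  have hft : f t = 0 := by
    have h2 : HasDerivAt (fun r => f (P.γ r)) (f t) s := f.hasFDerivAt.comp_hasDerivAt s ht
    have h3 : IsLocalMax (fun r => f (P.γ r)) s :=
      Eventually.of_forall fun r => P.le_of_interior hf1 (P.γ_mem r)
    exact h3.hasDerivAt_eq_zero h2
  have h4 := P.cross_pos ht h1 ho
  have h5 := congrArg f (cross_smul_eq t (o - P.γ s) (x - P.γ s))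
  simp only [map_add, map_smul, smul_eq_mul, hft, mul_zero, zero_add, map_sub] at h5
  have h6 := hf1 o ho
  by_contra! hcon
  nlinarith [mul_nonneg h4.le (sub_nonneg.2 hf2), mul_pos hcon (sub_pos.2 h6)]

theorem cross_sub_nonpos_of_visible {x : Plane} {s : ℝ} (hs : s ∈ P.visible x) {t : Plane}
    (ht : HasDerivAt P.γ t s) (h1 : t ≠ 0) : 0 ≤ cross t (P.γ s - x) := by
  have := P.cross_nonpos_of_visible hs ht h1
  rw [cross_sub_right] at this ⊢
  linarith

end Target

/-! ### Lengths of visible arcs and detours along the perimeter. -/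

namespace Target

variable (P : Target)

/-- A lower bound on the derivative of a linear functional along the perimeter. -/
theorem mul_sub_le_of_ae (φ : StrongDual ℝ Plane) (c : ℝ) {a b : ℝ} (hab : a ≤ b)
    (h : ∀ s ∈ Ioo a b, ∀ t, HasDerivAt P.γ t s → ‖t‖ = 1 → c ≤ φ t) :
    c * (b - a) ≤ φ (P.γ b) - φ (P.γ a) := by
  have hl : LipschitzWith (‖φ‖₊ * 1 + ‖c‖₊ * 1) fun s => φ (P.γ s) - c * s :=
    (φ.lipschitz.comp P.lipschitz).sub ((lipschitzWith_smul c).comp LipschitzWith.id)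
  have := (hl.lipschitzOnWith (s := Icc a b)).le_of_ae_deriv_nonneg hab (by
    filter_upwards [P.ae_hasDerivAt] with s hs hsm m hm
    have h1 : HasDerivAt (fun r => φ (P.γ r)) (φ (deriv P.γ s)) s :=
      φ.hasFDerivAt.comp_hasDerivAt s hs.1
    have h2 := h1.sub ((hasDerivAt_id s).const_mul c)
    have h3 := hm.unique h2
    have h4 := h s hsm _ hs.1 hs.2
    simp at h3
    linarith)
  linarith

/-- An arc that is visible from a point is not longer than the path through that point. -/
theorem sub_le_of_forall_visible {x : Plane} {a b : ℝ} (hab : a ≤ b) (hb : b < a + P.L)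
    (h : ∀ s ∈ Icc a b, s ∈ P.visible x) : b - a ≤ ‖P.γ a - x‖ + ‖P.γ b - x‖ := by
  set u := x - P.γ a with hu
  set v := P.γ b - x with hv
  have huv : P.γ b - P.γ a = u + v := by rw [hu, hv]; abel
  have hu' : ‖P.γ a - x‖ = ‖u‖ := norm_sub_rev _ _
  rw [hu']
  -- Visibility puts `x` to the right of every tangent, while the arc's end points are to the left.
  -- So the tangents have the orientation of vectors between `u` and `v`.
  have h1 : ∀ s ∈ Ioo a b, ∀ t, HasDerivAt P.γ t s → ‖t‖ = 1 →
      0 ≤ cross u t ∧ 0 ≤ cross t v := by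
    intro s hs t ht h1
    have h0 : t ≠ 0 := by rintro rfl; simp at h1
    have h2 := P.cross_sub_nonpos_of_visible (h s ⟨hs.1.le, hs.2.le⟩) ht h0
    have h3 := P.cross_nonneg ht (P.γ_mem a)
    have h4 := P.cross_nonneg ht (P.γ_mem b)
    rw [cross_comm t u, hu, hv]
    simp only [cross_sub_right] at h2 h3 h4 ⊢
    constructor <;> linarith
  set D := cross u v with hD
  have hG : ∀ r s, a ≤ r → r ≤ s → s ≤ b → cross u (P.γ r) ≤ cross u (P.γ s) ∧
      cross v (P.γ s) ≤ cross v (P.γ r) := by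
    intro r s har hrs hsb
    have h2 := P.mul_sub_le_of_ae (crossL u) 0 hrs fun q hq t ht ht1 =>
      (h1 q ⟨by linarith [hq.1], by linarith [hq.2]⟩ t ht ht1).1
    have h3 := P.mul_sub_le_of_ae (-crossL v) 0 hrs fun q hq t ht ht1 => by
      have := (h1 q ⟨by linarith [hq.1], by linarith [hq.2]⟩ t ht ht1).2
      rw [cross_comm v t] at this
      simpa using this
    simp at h2 h3
    exact ⟨h2, h3⟩
  rcases lt_or_ge 0 D with hDpos | hDneg
  -- Each unit tangent is a nonnegative combination of `u` and `v`. This functional is at least `D`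
  -- on it by the triangle inequality, and is `D * (‖u‖ + ‖v‖)` on the chord `u + v`.
  · have h2 := P.mul_sub_le_of_ae (‖v‖ • crossL u - ‖u‖ • crossL v) D hab (by
      intro s hs t ht ht1
      obtain ⟨h3, h4⟩ := h1 s hs t ht ht1
      have h5 : D • t = cross t v • u + cross u t • v := cross_smul_eq u v t
      have h6 : D ≤ cross t v * ‖u‖ + cross u t * ‖v‖ := by
        calc D = ‖D • t‖ := by rw [norm_smul, ht1, Real.norm_of_nonneg hDpos.le, mul_one]
          _ ≤ ‖cross t v • u‖ + ‖cross u t • v‖ := by rw [h5]; exact norm_add_le _ _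
          _ = _ := by
            rw [norm_smul, norm_smul, Real.norm_of_nonneg h3, Real.norm_of_nonneg h4]
      simp only [sub_apply, smul_apply, crossL_apply, smul_eq_mul]
      rw [cross_comm t v]; linarith)
    rw [← map_sub, huv] at h2
    simp only [sub_apply, smul_apply, crossL_apply, smul_eq_mul, cross_add_right, cross_same,
      cross_comm u v, ← hD] at h2
    have h3 : D * (b - a) ≤ D * (‖u‖ + ‖v‖) := by linarith
    exact le_of_mul_le_mul_left h3 hDpos
  -- In the degenerate case the arc lies on a line. The interior stays on one side, so the arc
  -- cannot turn back and its length is that of the chord.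
  · have hGab := (hG a b le_rfl hab le_rfl).1
    have hD0 : D = 0 := by
      have : cross u (P.γ b - P.γ a) = D := by rw [huv, cross_add_right, cross_same, zero_add]
      rw [cross_sub_right] at this
      linarith
    have hconst : ∀ s ∈ Icc a b, cross u (P.γ s) = cross u (P.γ a) ∧
        cross v (P.γ s) = cross v (P.γ a) := by
      intro s hs
      have h2 := hG a s le_rfl hs.1 hs.2
      have h3 := hG s b hs.1 hs.2 le_rfl
      have h4 : cross u (P.γ b - P.γ a) = 0 := by
        rw [huv, cross_add_right, cross_same, zero_add, ← hD, hD0]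
      have h5 : cross v (P.γ b - P.γ a) = 0 := by
        rw [huv, cross_add_right, cross_same, add_zero, cross_comm, ← hD, hD0, neg_zero]
      rw [cross_sub_right] at h4 h5
      constructor <;> linarith [h2.1, h2.2, h3.1, h3.2]
    by_cases h0 : u = 0 ∧ v = 0
    · have h2 : P.γ b = P.γ a := by
        rw [← sub_eq_zero, huv, h0.1, h0.2, add_zero]
      have := P.eq_of_γ_eq (e := a) ⟨hab, hb⟩ ⟨le_rfl, by linarith [P.L_pos]⟩ h2
      rw [this, sub_self]; positivity
    · obtain ⟨o, ho⟩ := P.interior_nonempty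
      obtain ⟨w, hw0, hwc, hwo⟩ : ∃ w : Plane, w ≠ 0 ∧
          (∀ s ∈ Icc a b, cross w (P.γ s) = cross w (P.γ a)) ∧ 0 ≤ cross w (o - P.γ a) := by
        obtain ⟨w, hw0, hwc⟩ : ∃ w : Plane, w ≠ 0 ∧
            ∀ s ∈ Icc a b, cross w (P.γ s) = cross w (P.γ a) := by
          by_cases hu0 : u = 0
          · exact ⟨v, fun hv0 => h0 ⟨hu0, hv0⟩, fun s hs => (hconst s hs).2⟩
          · exact ⟨u, hu0, fun s hs => (hconst s hs).1⟩
        rcases le_total 0 (cross w (o - P.γ a)) with h2 | h2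
        · exact ⟨w, hw0, hwc, h2⟩
        · exact ⟨-w, neg_ne_zero.2 hw0, fun s hs => by
            rw [cross_neg_left, cross_neg_left, hwc s hs], by rw [cross_neg_left]; linarith⟩
      have hwn : 0 < ‖w‖ := norm_pos_iff.2 hw0
      have h2 := P.mul_sub_le_of_ae (innerSL ℝ w) ‖w‖ hab (by
        intro s hs t ht ht1
        have ht0 : t ≠ 0 := by rintro rfl; simp at ht1
        have hwt : cross w t = 0 := by
          have h3 : HasDerivAt (fun r => crossL w (P.γ r)) (crossL w t) s :=
            (crossL w).hasFDerivAt.comp_hasDerivAt s ht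
          have h4 : (fun r => crossL w (P.γ r)) =ᶠ[𝓝 s] fun _ => cross w (P.γ a) := by
            filter_upwards [Ioo_mem_nhds hs.1 hs.2] with r hr
            exact hwc r ⟨hr.1.le, hr.2.le⟩
          exact h3.unique ((hasDerivAt_const s _).congr_of_eventuallyEq h4)
        have h5 := cross_sq_add_inner_sq w t
        rw [hwt, ht1] at h5
        have h6 : 0 < inner ℝ w t * cross w (o - P.γ a) := by
          have h7 := P.cross_pos ht ht0 ho
          have h8 : ‖w‖ ^ 2 * cross t (o - P.γ s) = inner ℝ w t * cross w (o - P.γ s) := by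
            rw [Plane.inner_eq, Plane.norm_sq_eq]
            generalize o - P.γ s = z
            simp only [cross] at hwt ⊢
            linear_combination (-w 0 * z 0 - w 1 * z 1) * hwt
          have h9 : cross w (o - P.γ s) = cross w (o - P.γ a) := by
            rw [cross_sub_right, cross_sub_right, hwc s ⟨hs.1.le, hs.2.le⟩]
          rw [← h9, ← h8]; positivity
        have h7 : 0 < (inner ℝ w t : ℝ) := pos_of_mul_pos_left h6 hwo
        rw [innerSL_apply_apply]
        nlinarith)
      rw [← map_sub, huv, innerSL_apply_apply] at h2
      have h3 := (real_inner_le_norm w (u + v)).trans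
        (mul_le_mul_of_nonneg_left (norm_add_le u v) hwn.le)
      exact le_of_mul_le_mul_left (h2.trans h3) hwn

theorem abs_sub_le_of_visible {x : Plane} {e a b : ℝ} (he : e ∉ P.visible x)
    (ha : a ∈ P.visible x) (hb : b ∈ P.visible x) (ha' : a ∈ Icc e (e + P.L))
    (hb' : b ∈ Icc e (e + P.L)) : |a - b| ≤ ‖P.γ a - x‖ + ‖P.γ b - x‖ := by
  have heL : e + P.L ∉ P.visible x := fun h => he (by
    have := P.mem_visible_add_int_mul (x := x) (s := e) 1
    simp only [Int.cast_one, one_mul] at this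
    exact this.1 h)
  have key : ∀ a b, a ∈ P.visible x → b ∈ P.visible x → a ∈ Icc e (e + P.L) →
      b ∈ Icc e (e + P.L) → a ≤ b → b - a ≤ ‖P.γ a - x‖ + ‖P.γ b - x‖ := by
    intro a b ha hb ha' hb' hab
    have h1 : e ≠ a := by rintro rfl; exact he ha
    refine P.sub_le_of_forall_visible hab ?_ fun s hs =>
      P.mem_visible_of_between he ha hb ha'.1 hs.1 hs.2 hb'.2
    linarith [lt_of_le_of_ne ha'.1 h1, hb'.2]
  rcases le_total a b with h | h
  · rw [abs_sub_comm, abs_of_nonneg (sub_nonneg.2 h)]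
    exact key a b ha hb ha' hb' h
  · rw [abs_of_nonneg (sub_nonneg.2 h), add_comm]
    exact key b a hb ha hb' ha' h

/-- If a point `x` sees the position `s`, then from any point `x'` that sees `x` one can go to `s`
straight to a visible position and then along the perimeter, without loss in length. -/
theorem exists_visible_of_segment {x x' : Plane} {e s : ℝ}
    (hseg : ∀ θ ∈ Icc (0 : ℝ) 1, (1 - θ) • x' + θ • x ∉ interior P.body)
    (he : e ∉ P.visible x) (he' : e ∉ P.visible x') (hs : s ∈ P.visible x)
    (hse : s ∈ Ioo e (e + P.L)) :
    ∃ c ∈ Ioo e (e + P.L), c ∈ P.visible x' ∧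
      ‖P.γ c - x'‖ + |s - c| ≤ ‖P.γ s - x‖ + ‖x - x'‖ := by
  by_cases hsx' : s ∈ P.visible x'
  · refine ⟨s, hse, hsx', ?_⟩
    rw [sub_self, abs_zero, add_zero]
    exact norm_sub_le_norm_sub_add_norm_sub _ _ _
  -- Turn the sight line from `x'` by moving its far end from `x` towards γ s, until it is about to
  -- enter the interior. At the last admissible parameter it touches the perimeter, at `c`.
  set z : ℝ → Plane := fun l => (1 - l) • x + l • P.γ s with hz
  have hzc : Continuous z := by fun_prop
  set g : ℝ → ℝ → Plane := fun l θ => (1 - θ) • x' + θ • z l with hg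
  have hgc : Continuous fun p : ℝ × ℝ => g p.1 p.2 := by fun_prop
  set Λ : Set ℝ := {l ∈ Icc (0 : ℝ) 1 | ∀ θ ∈ Icc (0 : ℝ) 1, g l θ ∉ interior P.body} with hΛ
  have hΛc : IsCompact Λ := by
    have h1 : Λ = Icc (0 : ℝ) 1 ∩ ⋂ θ ∈ Icc (0 : ℝ) 1, {l | g l θ ∈ (interior P.body)ᶜ} := by
      ext l; simp [hΛ]
    rw [h1]
    refine isCompact_Icc.inter_right (isClosed_biInter fun θ _ =>
      isOpen_interior.isClosed_compl.preimage ?_)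
    fun_prop
  obtain ⟨l, hl, hmax⟩ := hΛc.exists_isGreatest ⟨0, by simp, by simpa [hg, hz] using hseg⟩
  have hl1 : l < 1 := by
    refine lt_of_le_of_ne hl.1.2 fun h => hsx' (P.mem_visible_iff_forall.2 ?_)
    have := hl.2
    simpa [hg, hz, h] using this
  -- Without contact, compactness of the sight line would allow a larger `l`.
  obtain ⟨θ, hθ, hθK⟩ : ∃ θ ∈ Icc (0 : ℝ) 1, g l θ ∈ P.body := by
    by_contra! hcon
    have h1 : ∀ᶠ l' in 𝓝 l, ∀ θ ∈ Icc (0 : ℝ) 1, g l' θ ∈ P.bodyᶜ := by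
      refine isCompact_Icc.eventually_forall_of_forall_eventually fun θ hθ => ?_
      exact hgc.continuousAt (x := (l, θ)) |>.eventually
        (P.isClosed_body.isOpen_compl.mem_nhds (hcon θ hθ))
    obtain ⟨l', hl', hl'1⟩ := ((h1.filter_mono nhdsWithin_le_nhds).and
      (Ioo_mem_nhdsGT hl1)).exists
    have : l' ∈ Λ := ⟨⟨hl.1.1.trans hl'1.1.le, hl'1.2.le⟩,
      fun θ hθ h => hl' θ hθ (interior_subset h)⟩
    linarith [hmax this, hl'1.1]
  obtain ⟨c, hc, hγc⟩ := P.exists_γ_eq hθK (hl.2 θ hθ) e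
  have hcx' : c ∈ P.visible x' := by
    rw [P.mem_visible_iff_forall]
    intro η hη
    have h1 : (1 - η) • x' + η • P.γ c = g l (η * θ) := by
      rw [hγc]; simp only [hg]; module
    rw [h1]
    exact hl.2 _ ⟨mul_nonneg hη.1 hθ.1, mul_le_one₀ hη.2 hθ.1 hθ.2⟩
  have hcz : c ∈ P.visible (z l) := by
    rw [P.mem_visible_iff_forall]
    intro η hη
    have h1 : (1 - η) • z l + η • P.γ c = g l (1 - η * (1 - θ)) := by
      rw [hγc]; simp only [hg]; module
    rw [h1]
    have h2 : η * (1 - θ) ≤ 1 := mul_le_one₀ hη.2 (sub_nonneg.2 hθ.2) (by linarith [hθ.1])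
    have h3 : 0 ≤ η * (1 - θ) := mul_nonneg hη.1 (sub_nonneg.2 hθ.2)
    exact hl.2 _ ⟨by linarith, by linarith⟩
  have hsz : s ∈ P.visible (z l) := by
    rw [P.mem_visible_iff_forall]
    intro η hη
    have h1 : (1 - η) • z l + η • P.γ s
        = (1 - (l + η * (1 - l))) • x + (l + η * (1 - l)) • P.γ s := by
      simp only [hz]; module
    rw [h1]
    refine P.mem_visible_iff_forall.1 hs _ ⟨?_, ?_⟩
    · have := mul_nonneg hη.1 (sub_nonneg.2 hl1.le)
      linarith [hl.1.1]
    · nlinarith [hη.2]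
  have hez : e ∉ P.visible (z l) := fun h =>
    he (P.visible_subset_of_mem_segment (P.γ_mem s) ⟨hl.1.1, hl1⟩ h)
  have hce : c ≠ e := by rintro rfl; exact he' hcx'
  refine ⟨c, ⟨lt_of_le_of_ne hc.1 hce.symm, hc.2⟩, hcx', ?_⟩
  -- The turning end `z l` sees both `c` and `s`, so the arc between them is no longer than the path
  -- through `z l`; adding the straight pieces gives the claim.
  have hT := P.abs_sub_le_of_visible hez hsz hcz ⟨hse.1.le, hse.2.le⟩ ⟨hc.1, hc.2.le⟩
  have e1 : P.γ c - x' = θ • (z l - x') := by rw [hγc]; simp only [hg]; module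
  have e2 : P.γ c - z l = (1 - θ) • (x' - z l) := by rw [hγc]; simp only [hg]; module
  have e3 : z l - x = l • (P.γ s - x) := by simp only [hz]; module
  have e4 : P.γ s - z l = (1 - l) • (P.γ s - x) := by simp only [hz]; module
  have n1 : ‖P.γ c - x'‖ = θ * ‖z l - x'‖ := by
    rw [e1, norm_smul, Real.norm_of_nonneg hθ.1]
  have n2 : ‖P.γ c - z l‖ = (1 - θ) * ‖z l - x'‖ := by
    rw [e2, norm_smul, Real.norm_of_nonneg (sub_nonneg.2 hθ.2), norm_sub_rev]
  have n3 : ‖z l - x‖ = l * ‖P.γ s - x‖ := by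
    rw [e3, norm_smul, Real.norm_of_nonneg hl.1.1]
  have n4 : ‖P.γ s - z l‖ = (1 - l) * ‖P.γ s - x‖ := by
    rw [e4, norm_smul, Real.norm_of_nonneg (sub_nonneg.2 hl1.le)]
  have n5 : ‖z l - x'‖ ≤ ‖z l - x‖ + ‖x - x'‖ := norm_sub_le_norm_sub_add_norm_sub _ _ _
  linarith

end Target

namespace Target

variable (P : Target) (ν : ℝ)

/-! ### Breaching points in coordinates -/

theorem arc_mem (a b : ℝ) : P.arc a b ∈ Ico 0 P.L := by
  have hL := P.L_pos
  refine ⟨mul_nonneg hL.le (Int.fract_nonneg _), ?_⟩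
  calc P.L * Int.fract ((b - a) / P.L) < P.L * 1 :=
        mul_lt_mul_of_pos_left (Int.fract_lt_one _) hL
    _ = P.L := mul_one _

theorem exists_add_arc_eq (a b : ℝ) : ∃ k : ℤ, a + P.arc a b = b + k * P.L := by
  have hL := P.L_pos.ne'
  refine ⟨-⌊(b - a) / P.L⌋, ?_⟩
  have h1 : P.L * ((b - a) / P.L) = b - a := by field_simp
  rw [arc, Int.fract, mul_sub, h1]
  push_cast
  ring

theorem arc_eq_of_add_eq {a b r : ℝ} (k : ℤ) (h : a + r = b + k * P.L) (hr : r ∈ Ico 0 P.L) :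
    P.arc a b = r := by
  have hL := P.L_pos
  have h1 : (b - a) / P.L = r / P.L + ((-k : ℤ) : ℝ) := by
    push_cast
    field_simp
    linarith
  rw [arc, h1, Int.fract_add_intCast, Int.fract_eq_self.2 ⟨div_nonneg hr.1 hL.le,
    (div_lt_one hL).2 hr.2⟩]
  field_simp

theorem γ_add_arc (a b : ℝ) : P.γ (a + P.arc a b) = P.γ b := by
  obtain ⟨k, hk⟩ := P.exists_add_arc_eq a b
  rw [hk, P.γ_add_int_mul]

theorem add_int_mul_notMem_visible {x : Plane} {e : ℝ} (he : e ∉ P.visible x) (k : ℤ) :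
    e + k * P.L ∉ P.visible x := fun h => he ((P.mem_visible_add_int_mul k).1 h)

theorem add_arc_mem {x : Plane} {e s : ℝ} (he : e ∉ P.visible x) (hs : s ∈ P.visible x) :
    e + P.arc e s ∈ P.visible x ∧ e + P.arc e s ∈ Ioo e (e + P.L) := by
  have h1 : e + P.arc e s ∈ P.visible x := (P.mem_visible_congr (P.γ_add_arc e s)).2 hs
  have h2 := P.arc_mem e s
  refine ⟨h1, lt_of_le_of_ne (by linarith [h2.1]) ?_, by linarith [h2.2]⟩
  intro h
  rw [← h] at h1
  exact he h1

/-- The coordinates of the visible positions in two frames differ by a constant. -/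
theorem exists_arc_eq {x : Plane} {e d : ℝ} (he : e ∉ P.visible x) (hd : d ∉ P.visible x) :
    ∃ k : ℤ, ∀ b ∈ P.visible x, b ∈ Ioo e (e + P.L) → P.arc d b = b - d + k * P.L := by
  obtain ⟨k, hk⟩ := P.exists_add_arc_eq e d
  have hm := P.arc_mem e d
  set d' := e + P.arc e d
  have hd' : d' ∉ P.visible x := by rw [hk]; exact P.add_int_mul_notMem_visible hd k
  have hne : ∀ b ∈ P.visible x, b ≠ d' := by rintro b hb rfl; exact hd' hb
  -- The visible arc does not contain `d'`, so it lies entirely after or entirely before it; this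
  -- decides the constant.
  by_cases h : ∃ b ∈ P.visible x, b ∈ Ioo e (e + P.L) ∧ d' < b
  · obtain ⟨b₀, hb₀, hb₀', hdb⟩ := h
    refine ⟨-k, fun b hb hb' => P.arc_eq_of_add_eq (-k) (by ring) ?_⟩
    have h1 : d' ≤ b := by
      by_contra! hcon
      exact hd' (P.mem_visible_of_between he hb hb₀ hb'.1.le hcon.le hdb.le hb₀'.2.le)
    push_cast
    constructor <;> linarith [hm.1, hb'.2]
  · push Not at h
    refine ⟨-k + 1, fun b hb hb' => P.arc_eq_of_add_eq (-k + 1) (by ring) ?_⟩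
    have h1 : b < d' := lt_of_le_of_ne (h b hb hb') (hne b hb)
    push_cast
    constructor <;> linarith [hm.2, hb'.1]

theorem arc_add_arc {d b : ℝ} (h : P.arc d b ≠ 0) : P.arc b d = P.L - P.arc d b := by
  obtain ⟨k, hk⟩ := P.exists_add_arc_eq d b
  have hm := P.arc_mem d b
  refine P.arc_eq_of_add_eq (1 - k) (by push_cast; linarith) ⟨by linarith [hm.2], ?_⟩
  have : 0 < P.arc d b := lt_of_le_of_ne hm.1 h.symm
  linarith

theorem arc_ne_zero {x : Plane} {d b : ℝ} (hd : d ∉ P.visible x) (hb : b ∈ P.visible x) :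
    P.arc d b ≠ 0 := by
  intro h
  have := P.γ_add_arc d b
  rw [h, add_zero] at this
  exact hd ((P.mem_visible_congr this).2 hb)

theorem arc_congr_right {d b b' : ℝ} (k : ℤ) (h : b = b' + k * P.L) : P.arc d b = P.arc d b' := by
  obtain ⟨m, hm⟩ := P.exists_add_arc_eq d b'
  exact P.arc_eq_of_add_eq (m - k) (by push_cast; rw [hm, h]; ring) (P.arc_mem d b')

theorem arc_congr_left {d d' b : ℝ} (k : ℤ) (h : d = d' + k * P.L) : P.arc d b = P.arc d' b := by
  obtain ⟨m, hm⟩ := P.exists_add_arc_eq d' b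
  exact P.arc_eq_of_add_eq (m + k) (by push_cast; rw [h]; linarith) (P.arc_mem d' b)

theorem exists_max_visible {x : Plane} (hx : x ∉ interior P.body) {e : ℝ}
    {g : ℝ → ℝ} (hg : Continuous g) :
    ∃ s ∈ P.visible x, s ∈ Icc e (e + P.L) ∧
      ∀ b ∈ P.visible x, b ∈ Icc e (e + P.L) → g b ≤ g s := by
  have hc : IsCompact (Icc e (e + P.L) ∩ P.visible x) :=
    isCompact_Icc.inter_right (P.isClosed_visible x)
  obtain ⟨c, hc1, hc2, -⟩ := P.exists_visible_mem_segment hx (P.γ_mem 0) e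
  obtain ⟨s, hs, hmax⟩ := hc.exists_isMaxOn ⟨c, ⟨hc1.1, hc1.2.le⟩, hc2⟩ hg.continuousOn
  exact ⟨s, hs.2, hs.1, fun b hb hb' => hmax ⟨hb', hb⟩⟩

theorem mem_Ioo_of_visible {x : Plane} {e s : ℝ} (he : e ∉ P.visible x) (hs : s ∈ P.visible x)
    (hse : s ∈ Icc e (e + P.L)) : s ∈ Ioo e (e + P.L) := by
  refine ⟨lt_of_le_of_ne hse.1 ?_, lt_of_le_of_ne hse.2 ?_⟩
  · rintro rfl; exact he hs
  · rintro rfl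
    have := P.add_int_mul_notMem_visible he 1
    simp only [Int.cast_one, one_mul] at this
    exact this hs

/-- Replacing one unseen defender position by another changes the objective only by a constant on
the visible arc, so a maximizer for one is a maximizer for all. -/
theorem exists_isLeftBreach {x : Plane} (hx : x ∉ interior P.body) :
    ∃ s, P.IsLeftBreach ν x s := by
  obtain ⟨e, he⟩ := P.exists_notMem_visible hx
  have hγ := P.continuous_γ
  obtain ⟨s, hs, hse, hmax⟩ := P.exists_max_visible hx (e := e)
    (g := fun b => b - ‖P.γ b - x‖ / ν) (by fun_prop)
  refine ⟨s, hs, fun d hd b hb => ?_⟩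
  obtain ⟨k, hk⟩ := P.exists_arc_eq he hd
  have h1 := P.add_arc_mem he hb
  obtain ⟨m, hm⟩ := P.exists_add_arc_eq e b
  have h2 := hmax _ h1.1 ⟨h1.2.1.le, h1.2.2.le⟩
  have h3 := hk _ h1.1 h1.2
  rw [P.arc_congr_right m hm] at h3
  rw [JL, JL, h3, hk s hs (P.mem_Ioo_of_visible he hs hse)]
  rw [P.γ_add_arc] at h2
  linarith

theorem exists_isRightBreach {x : Plane} (hx : x ∉ interior P.body) :
    ∃ s, P.IsRightBreach ν x s := by
  obtain ⟨e, he⟩ := P.exists_notMem_visible hx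
  have hγ := P.continuous_γ
  obtain ⟨s, hs, hse, hmax⟩ := P.exists_max_visible hx (e := e)
    (g := fun b => -b - ‖P.γ b - x‖ / ν) (by fun_prop)
  refine ⟨s, hs, fun d hd b hb => ?_⟩
  obtain ⟨k, hk⟩ := P.exists_arc_eq he hd
  have h1 := P.add_arc_mem he hb
  obtain ⟨m, hm⟩ := P.exists_add_arc_eq e b
  have h2 := hmax _ h1.1 ⟨h1.2.1.le, h1.2.2.le⟩
  have h3 := hk _ h1.1 h1.2
  rw [P.arc_congr_right m hm] at h3
  rw [JR, JR, P.arc_add_arc (P.arc_ne_zero hd hb), P.arc_add_arc (P.arc_ne_zero hd hs), h3,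
    hk s hs (P.mem_Ioo_of_visible he hs hse)]
  rw [P.γ_add_arc] at h2
  linarith

theorem isLeftBreach_sL {x : Plane} (hx : x ∉ interior P.body) : P.IsLeftBreach ν x (P.sL ν x) :=
  Classical.epsilon_spec (P.exists_isLeftBreach ν hx)

theorem isRightBreach_sR {x : Plane} (hx : x ∉ interior P.body) :
    P.IsRightBreach ν x (P.sR ν x) :=
  Classical.epsilon_spec (P.exists_isRightBreach ν hx)

/-- The left breaching point as a number in `[e, e + L)`. -/
def leftPos (e : ℝ) (x : Plane) : ℝ := e + P.arc e (P.sL ν x)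

/-- The right breaching point as a number in `[e, e + L)`. -/
def rightPos (e : ℝ) (x : Plane) : ℝ := e + P.arc e (P.sR ν x)

/-- The maximum of `s - ‖γ s - x‖ / ν` over the visible positions in `[e, e + L)`. -/
def leftVal (e : ℝ) (x : Plane) : ℝ := P.leftPos ν e x - ‖P.γ (P.leftPos ν e x) - x‖ / ν

/-- The minimum of `s + ‖γ s - x‖ / ν` over the visible positions in `[e, e + L)`. -/
def rightVal (e : ℝ) (x : Plane) : ℝ := P.rightPos ν e x + ‖P.γ (P.rightPos ν e x) - x‖ / ν

/-- The position in `[e, e + L)` whose afferent surface contains `x`. -/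
def affPos (e : ℝ) (x : Plane) : ℝ := (P.leftVal ν e x + P.rightVal ν e x) / 2

theorem γ_leftPos (e : ℝ) (x : Plane) : P.γ (P.leftPos ν e x) = P.γ (P.sL ν x) :=
  P.γ_add_arc _ _

theorem γ_rightPos (e : ℝ) (x : Plane) : P.γ (P.rightPos ν e x) = P.γ (P.sR ν x) :=
  P.γ_add_arc _ _

section frame

variable {x : Plane} {e : ℝ}

theorem leftPos_mem (hx : x ∉ interior P.body) (he : e ∉ P.visible x) :
    P.leftPos ν e x ∈ P.visible x ∧ P.leftPos ν e x ∈ Ioo e (e + P.L) :=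
  P.add_arc_mem he (P.isLeftBreach_sL ν hx).1

theorem rightPos_mem (hx : x ∉ interior P.body) (he : e ∉ P.visible x) :
    P.rightPos ν e x ∈ P.visible x ∧ P.rightPos ν e x ∈ Ioo e (e + P.L) :=
  P.add_arc_mem he (P.isRightBreach_sR ν hx).1

theorem arc_eq_sub {b : ℝ} (hb : b ∈ Ico e (e + P.L)) : P.arc e b = b - e :=
  P.arc_eq_of_add_eq 0 (by push_cast; ring) ⟨by linarith [hb.1], by linarith [hb.2]⟩

theorem le_leftVal (hx : x ∉ interior P.body) (he : e ∉ P.visible x) {b : ℝ}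
    (hb : b ∈ P.visible x) (hbe : b ∈ Icc e (e + P.L)) :
    b - ‖P.γ b - x‖ / ν ≤ P.leftVal ν e x := by
  have h := (P.isLeftBreach_sL ν hx).2 e he b hb
  have h1 := P.mem_Ioo_of_visible he hb hbe
  rw [JL, JL, P.arc_eq_sub ⟨h1.1.le, h1.2⟩] at h
  rw [leftVal, γ_leftPos, leftPos]
  linarith

theorem rightVal_le (hx : x ∉ interior P.body) (he : e ∉ P.visible x) {b : ℝ}
    (hb : b ∈ P.visible x) (hbe : b ∈ Icc e (e + P.L)) :
    P.rightVal ν e x ≤ b + ‖P.γ b - x‖ / ν := by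
  have hs := P.isRightBreach_sR ν hx
  have h := hs.2 e he b hb
  have h1 := P.mem_Ioo_of_visible he hb hbe
  rw [JR, JR, P.arc_add_arc (P.arc_ne_zero he hb), P.arc_add_arc (P.arc_ne_zero he hs.1),
    P.arc_eq_sub ⟨h1.1.le, h1.2⟩] at h
  rw [rightVal, γ_rightPos, rightPos]
  linarith

/-- Compare each breaching point with the other in its own objective and add: the distances cancel.
-/
theorem rightPos_le_leftPos (hx : x ∉ interior P.body) (he : e ∉ P.visible x) :
    P.rightPos ν e x ≤ P.leftPos ν e x := by
  have h1 := P.leftPos_mem ν hx he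
  have h2 := P.rightPos_mem ν hx he
  have h3 := P.le_leftVal ν hx he h2.1 (Ioo_subset_Icc_self h2.2)
  have h4 := P.rightVal_le ν hx he h1.1 (Ioo_subset_Icc_self h1.2)
  rw [leftVal] at h3
  rw [rightVal] at h4
  linarith

theorem affPos_le_leftPos (hx : x ∉ interior P.body) (he : e ∉ P.visible x) :
    P.affPos ν e x ≤ P.leftPos ν e x := by
  have h1 := P.leftPos_mem ν hx he
  have h4 := P.rightVal_le ν hx he h1.1 (Ioo_subset_Icc_self h1.2)
  rw [affPos, leftVal]
  linarith

theorem rightPos_le_affPos (hx : x ∉ interior P.body) (he : e ∉ P.visible x) :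
    P.rightPos ν e x ≤ P.affPos ν e x := by
  have h1 := P.rightPos_mem ν hx he
  have h4 := P.le_leftVal ν hx he h1.1 (Ioo_subset_Icc_self h1.2)
  rw [affPos, rightVal]
  linarith

/-- The arc between the breaching points is no longer than the path through the intruder, who is not
faster than a defender. -/
theorem leftVal_le_rightVal (hν : 0 < ν) (hν1 : ν ≤ 1) (hx : x ∉ interior P.body)
    (he : e ∉ P.visible x) : P.leftVal ν e x ≤ P.rightVal ν e x := by
  have h1 := P.leftPos_mem ν hx he
  have h2 := P.rightPos_mem ν hx he
  have h := (le_abs_self _).trans (P.abs_sub_le_of_visible he h1.1 h2.1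
    (Ioo_subset_Icc_self h1.2) (Ioo_subset_Icc_self h2.2))
  have h3 : ∀ r : ℝ, 0 ≤ r → r ≤ r / ν := fun r hr => by
    rw [le_div_iff₀ hν]; exact mul_le_of_le_one_right hr hν1
  have h4 := h3 _ (norm_nonneg (P.γ (P.leftPos ν e x) - x))
  have h5 := h3 _ (norm_nonneg (P.γ (P.rightPos ν e x) - x))
  rw [leftVal, rightVal]
  linarith

/-- Frames differ by a multiple of `L`. -/
theorem exists_frame_eq (hx : x ∉ interior P.body) (he : e ∉ P.visible x) {e' : ℝ}
    (he' : e' ∉ P.visible x) : ∃ k : ℤ, P.leftPos ν e' x = P.leftPos ν e x + k * P.L ∧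
      P.rightPos ν e' x = P.rightPos ν e x + k * P.L := by
  obtain ⟨k, hk⟩ := P.exists_arc_eq he he'
  have key : ∀ b ∈ P.visible x, e' + P.arc e' b = e + P.arc e b + k * P.L := by
    intro b hb
    have h1 := P.add_arc_mem he hb
    have h2 := hk _ h1.1 h1.2
    obtain ⟨m, hm⟩ := P.exists_add_arc_eq e b
    rw [P.arc_congr_right m hm] at h2
    linarith
  exact ⟨k, key _ (P.isLeftBreach_sL ν hx).1, key _ (P.isRightBreach_sR ν hx).1⟩

theorem leftVal_congr {e' : ℝ} (k : ℤ) (h : P.leftPos ν e' x = P.leftPos ν e x + k * P.L) :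
    P.leftVal ν e' x = P.leftVal ν e x + k * P.L := by
  rw [leftVal, leftVal, h, P.γ_add_int_mul]; ring

theorem rightVal_congr {e' : ℝ} (k : ℤ) (h : P.rightPos ν e' x = P.rightPos ν e x + k * P.L) :
    P.rightVal ν e' x = P.rightVal ν e x + k * P.L := by
  rw [rightVal, rightVal, h, P.γ_add_int_mul]; ring

theorem leftPos_add_int_mul (k : ℤ) :
    P.leftPos ν (e + k * P.L) x = P.leftPos ν e x + k * P.L := by
  rw [leftPos, leftPos, P.arc_congr_left k rfl]; ring

theorem rightPos_add_int_mul (k : ℤ) :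
    P.rightPos ν (e + k * P.L) x = P.rightPos ν e x + k * P.L := by
  rw [rightPos, rightPos, P.arc_congr_left k rfl]; ring

theorem leftVal_add_int_mul (k : ℤ) :
    P.leftVal ν (e + k * P.L) x = P.leftVal ν e x + k * P.L :=
  P.leftVal_congr ν k (P.leftPos_add_int_mul ν k)

theorem rightVal_add_int_mul (k : ℤ) :
    P.rightVal ν (e + k * P.L) x = P.rightVal ν e x + k * P.L :=
  P.rightVal_congr ν k (P.rightPos_add_int_mul ν k)

theorem affPos_add_int_mul (k : ℤ) :
    P.affPos ν (e + k * P.L) x = P.affPos ν e x + k * P.L := by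
  rw [affPos, affPos, leftVal_add_int_mul, rightVal_add_int_mul]; ring

/-- The frame of a nearby base point is the translate of a given one. -/
theorem exists_frame_translate (hx : x ∉ interior P.body) (he : e ∉ P.visible x) {e' : ℝ}
    (he' : e' ∉ P.visible x) : ∃ k : ℤ,
      P.leftPos ν e' x = P.leftPos ν (e + k * P.L) x ∧
      P.rightPos ν e' x = P.rightPos ν (e + k * P.L) x ∧
      P.leftVal ν e' x = P.leftVal ν (e + k * P.L) x ∧
      P.rightVal ν e' x = P.rightVal ν (e + k * P.L) x ∧
      P.affPos ν e' x = P.affPos ν (e + k * P.L) x := by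
  obtain ⟨k, h1, h2⟩ := P.exists_frame_eq ν hx he he'
  have h3 := P.leftVal_congr ν k h1
  have h4 := P.rightVal_congr ν k h2
  refine ⟨k, ?_, ?_, ?_, ?_, ?_⟩
  · rw [h1, leftPos_add_int_mul]
  · rw [h2, rightPos_add_int_mul]
  · rw [h3, leftVal_add_int_mul]
  · rw [h4, rightVal_add_int_mul]
  · rw [affPos, h3, h4, affPos_add_int_mul, affPos]; ring

/-- For d between the breaching points both arcs are plain differences, and `J_L^* = J_R^*` reads
`leftVal` - d = d - `rightVal`. The solution does lie between the breaching points. -/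
theorem mem_afferent_iff (hx : x ∉ interior P.body) (he : e ∉ P.visible x) {d : ℝ} :
    x ∈ P.afferent ν d ↔ ∃ k : ℤ, d = P.affPos ν e x + k * P.L := by
  have hl := P.leftPos_mem ν hx he
  have hr := P.rightPos_mem ν hx he
  have hrl := P.rightPos_le_leftPos ν hx he
  have hra := P.rightPos_le_affPos ν hx he
  have hal := P.affPos_le_leftPos ν hx he
  obtain ⟨kl, hkl⟩ := P.exists_add_arc_eq e (P.sL ν x)
  obtain ⟨kr, hkr⟩ := P.exists_add_arc_eq e (P.sR ν x)
  have hkl' : P.leftPos ν e x = P.sL ν x + kl * P.L := hkl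
  have hkr' : P.rightPos ν e x = P.sR ν x + kr * P.L := hkr
  have hA : P.leftVal ν e x = P.leftPos ν e x - ‖P.γ (P.sL ν x) - x‖ / ν := by
    rw [leftVal, γ_leftPos]
  have hB : P.rightVal ν e x = P.rightPos ν e x + ‖P.γ (P.sR ν x) - x‖ / ν := by
    rw [rightVal, γ_rightPos]
  have hδ : P.affPos ν e x = (P.leftVal ν e x + P.rightVal ν e x) / 2 := rfl
  have hRL : P.arc (P.sR ν x) (P.sL ν x) = P.leftPos ν e x - P.rightPos ν e x := by
    rw [← P.arc_congr_left kr hkr', ← P.arc_congr_right kl hkl']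
    exact P.arc_eq_of_add_eq 0 (by push_cast; ring)
      ⟨by linarith, by linarith [hl.2.2, hr.2.1]⟩
  -- the two arcs of a position `d'` between the breaching points
  have hRd : ∀ d', P.rightPos ν e x ≤ d' → d' ≤ P.leftPos ν e x →
      P.arc (P.sR ν x) d' = d' - P.rightPos ν e x ∧
      P.arc d' (P.sL ν x) = P.leftPos ν e x - d' := by
    intro d' h1 h2
    rw [← P.arc_congr_left kr hkr', ← P.arc_congr_right kl hkl']
    exact ⟨P.arc_eq_of_add_eq 0 (by push_cast; ring) ⟨by linarith, by linarith [hl.2.2, hr.2.1]⟩,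
      P.arc_eq_of_add_eq 0 (by push_cast; ring) ⟨by linarith, by linarith [hl.2.2, hr.2.1]⟩⟩
  constructor
  · rintro ⟨-, h1, h2⟩
    obtain ⟨m, hm⟩ := P.exists_add_arc_eq (P.sR ν x) d
    have hm0 := P.arc_mem (P.sR ν x) d
    set d' := P.rightPos ν e x + P.arc (P.sR ν x) d with hd'
    have hdd' : d' = d + ((m + kr : ℤ) : ℝ) * P.L := by
      rw [hd', hkr']; push_cast; linarith
    have h3 : P.rightPos ν e x ≤ d' := by linarith [hm0.1]
    have h4 : d' ≤ P.leftPos ν e x := by rw [hRL] at h1; linarith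
    obtain ⟨h5, h6⟩ := hRd d' h3 h4
    rw [JLstar, JRstar, JL, JR, ← P.arc_congr_left _ hdd', ← P.arc_congr_right _ hdd', h5, h6] at h2
    refine ⟨-(m + kr), ?_⟩
    push_cast at hdd' ⊢
    linarith
  · rintro ⟨k, rfl⟩
    obtain ⟨h5, h6⟩ := hRd _ hra hal
    refine ⟨hx, ?_, ?_⟩
    · rw [P.arc_congr_right k rfl, h5, hRL]; linarith
    · rw [JLstar, JRstar, JL, JR, P.arc_congr_left k rfl, P.arc_congr_right k rfl, h5, h6]
      linarith

theorem notMem_interior_of_mem_gameSpace {a b : ℝ} (h : x ∈ P.gameSpace ν a b) :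
    x ∉ interior P.body := by
  obtain ⟨d, -, hd⟩ := h
  exact hd.1

theorem mem_gameSpace_iff (hx : x ∉ interior P.body) (he : e ∉ P.visible x) {a b : ℝ} :
    x ∈ P.gameSpace ν a b ↔ ∃ k : ℤ, P.affPos ν (e + k * P.L) x ∈ Icc a b := by
  simp only [affPos_add_int_mul]
  constructor
  · rintro ⟨d, hd, hxd⟩
    obtain ⟨k, rfl⟩ := (P.mem_afferent_iff ν hx he).1 hxd
    exact ⟨k, hd⟩
  · rintro ⟨k, hk⟩
    exact ⟨_, hk, (P.mem_afferent_iff ν hx he).2 ⟨k, rfl⟩⟩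

theorem exists_frame_of_mem_gameSpace {a b : ℝ} (h : x ∈ P.gameSpace ν a b) :
    ∃ e, e ∉ P.visible x ∧ P.affPos ν e x ∈ Icc a b := by
  have hx := P.notMem_interior_of_mem_gameSpace ν h
  obtain ⟨e, he⟩ := P.exists_notMem_visible hx
  obtain ⟨k, hk⟩ := (P.mem_gameSpace_iff ν hx he).1 h
  exact ⟨_, P.add_int_mul_notMem_visible he k, hk⟩

theorem mem_gameSpace_of_frame (hx : x ∉ interior P.body) (he : e ∉ P.visible x) {a b : ℝ}
    (h : P.affPos ν e x ∈ Icc a b) : x ∈ P.gameSpace ν a b :=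
  (P.mem_gameSpace_iff ν hx he).2 ⟨0, by simpa using h⟩

end frame

end Target

namespace Target

variable (P : Target) (ν : ℝ)

/-! ### Continuity of the breaching values -/

/-- The left breaching point of `x` may be hidden from `x'`. The substitute `c` from
`exists_visible_of_segment` changes the position term by at most |s - c| ≤ |s - c| / ν, which the
saving in distance pays for. -/
theorem leftVal_le_add (hν : 0 < ν) (hν1 : ν ≤ 1) {x x' : Plane} {e : ℝ}
    (hx : x ∉ interior P.body) (hx' : x' ∉ interior P.body)
    (he : e ∉ P.visible x) (he' : e ∉ P.visible x')
    (hseg : ∀ θ ∈ Icc (0 : ℝ) 1, (1 - θ) • x' + θ • x ∉ interior P.body) :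
    P.leftVal ν e x ≤ P.leftVal ν e x' + ‖x - x'‖ / ν := by
  have hl := P.leftPos_mem ν hx he
  obtain ⟨c, hc, hcv, hle⟩ := P.exists_visible_of_segment hseg he he' hl.1 hl.2
  have h1 := P.le_leftVal ν hx' he' hcv (Ioo_subset_Icc_self hc)
  have h2 : P.leftPos ν e x - c ≤ |P.leftPos ν e x - c| / ν := by
    refine (le_abs_self _).trans ?_
    rw [le_div_iff₀ hν]; exact mul_le_of_le_one_right (abs_nonneg _) hν1
  have h3 := (div_le_div_iff_of_pos_right hν).2 hle
  rw [add_div, add_div] at h3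
  rw [leftVal]
  linarith

theorem rightVal_le_add (hν : 0 < ν) (hν1 : ν ≤ 1) {x x' : Plane} {e : ℝ}
    (hx : x ∉ interior P.body) (hx' : x' ∉ interior P.body)
    (he : e ∉ P.visible x) (he' : e ∉ P.visible x')
    (hseg : ∀ θ ∈ Icc (0 : ℝ) 1, (1 - θ) • x' + θ • x ∉ interior P.body) :
    P.rightVal ν e x' ≤ P.rightVal ν e x + ‖x - x'‖ / ν := by
  have hl := P.rightPos_mem ν hx he
  obtain ⟨c, hc, hcv, hle⟩ := P.exists_visible_of_segment hseg he he' hl.1 hl.2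
  have h1 := P.rightVal_le ν hx' he' hcv (Ioo_subset_Icc_self hc)
  have h2 : -(P.rightPos ν e x - c) ≤ |P.rightPos ν e x - c| / ν := by
    refine (neg_le_abs _).trans ?_
    rw [le_div_iff₀ hν]; exact mul_le_of_le_one_right (abs_nonneg _) hν1
  have h3 := (div_le_div_iff_of_pos_right hν).2 hle
  rw [add_div, add_div] at h3
  have h4 : P.rightVal ν e x =
      P.rightPos ν e x + ‖P.γ (P.rightPos ν e x) - x‖ / ν := rfl
  linarith

/-- `leftVal` and `rightVal` are Lipschitz along segments outside the target. -/
theorem abs_val_sub_le (hν : 0 < ν) (hν1 : ν ≤ 1) {x x' : Plane} {e : ℝ}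
    (he : e ∉ P.visible x) (he' : e ∉ P.visible x')
    (hseg : ∀ z ∈ segment ℝ x x', z ∉ interior P.body) :
    |P.leftVal ν e x - P.leftVal ν e x'| ≤ ‖x - x'‖ / ν ∧
      |P.rightVal ν e x - P.rightVal ν e x'| ≤ ‖x - x'‖ / ν := by
  have hx := hseg x (left_mem_segment _ _ _)
  have hx' := hseg x' (right_mem_segment _ _ _)
  have h1 : ∀ θ ∈ Icc (0 : ℝ) 1, (1 - θ) • x + θ • x' ∉ interior P.body := fun θ hθ =>
    hseg _ ⟨1 - θ, θ, sub_nonneg.2 hθ.2, hθ.1, by ring, rfl⟩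
  have h2 : ∀ θ ∈ Icc (0 : ℝ) 1, (1 - θ) • x' + θ • x ∉ interior P.body := fun θ hθ =>
    hseg _ ⟨θ, 1 - θ, hθ.1, sub_nonneg.2 hθ.2, by ring, by abel⟩
  have a1 := P.leftVal_le_add ν hν hν1 hx hx' he he' h2
  have a2 := P.leftVal_le_add ν hν hν1 hx' hx he' he h1
  have b1 := P.rightVal_le_add ν hν hν1 hx hx' he he' h2
  have b2 := P.rightVal_le_add ν hν hν1 hx' hx he' he h1
  rw [norm_sub_rev x' x] at a2 b2
  constructor <;> rw [abs_le] <;> constructor <;> linarith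

/-- The breaching values are close to a visible position that is close to the intruder. -/
theorem abs_val_sub_visible_le (hν : 0 < ν) (hν1 : ν ≤ 1) {x : Plane} {e c : ℝ}
    (hx : x ∉ interior P.body) (he : e ∉ P.visible x) (hc : c ∈ P.visible x)
    (hce : c ∈ Icc e (e + P.L)) :
    |P.leftVal ν e x - c| ≤ ‖P.γ c - x‖ / ν ∧ |P.rightVal ν e x - c| ≤ ‖P.γ c - x‖ / ν := by
  have h1 := P.le_leftVal ν hx he hc hce
  have h2 := P.rightVal_le ν hx he hc hce
  have h3 := P.leftVal_le_rightVal ν hν hν1 hx he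
  constructor <;> rw [abs_le] <;> constructor <;> linarith

theorem self_mem_visible (p : ℝ) : p ∈ P.visible (P.γ p) := by
  rw [mem_visible_iff_forall]
  intro θ _
  rw [← add_smul, sub_add_cancel, one_smul]
  exact P.γ_notMem_interior p

theorem val_γ (hν : 0 < ν) (hν1 : ν ≤ 1) {e p : ℝ} (he : e ∉ P.visible (P.γ p))
    (hp : p ∈ Icc e (e + P.L)) :
    P.leftVal ν e (P.γ p) = p ∧ P.rightVal ν e (P.γ p) = p := by
  have := P.abs_val_sub_visible_le ν hν hν1 (P.γ_notMem_interior p) he (P.self_mem_visible p) hp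
  rw [sub_self, norm_zero, zero_div, abs_nonpos_iff, abs_nonpos_iff, sub_eq_zero,
    sub_eq_zero] at this
  exact this

theorem exists_Ioo_γ_eq {x : Plane} (hx : x ∉ interior P.body) (hxK : x ∈ P.body) {e : ℝ}
    (he : e ∉ P.visible x) : ∃ p ∈ Ioo e (e + P.L), P.γ p = x := by
  obtain ⟨p, hp, rfl⟩ := P.exists_γ_eq hxK hx e
  exact ⟨p, P.mem_Ioo_of_visible he (P.self_mem_visible p) ⟨hp.1, hp.2.le⟩, rfl⟩

/-- The Lipschitz bound needs a segment outside the target, which may fail at a perimeter point.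
There both values are instead pinned by a visible position close to the intruder. -/
theorem eventually_abs_val_sub_lt (hν : 0 < ν) (hν1 : ν ≤ 1) {x : Plane} {e : ℝ}
    (hx : x ∉ interior P.body) (he : e ∉ P.visible x) {ε : ℝ} (hε : 0 < ε) :
    ∀ᶠ x' in 𝓝 x, x' ∉ interior P.body → |P.leftVal ν e x' - P.leftVal ν e x| < ε ∧
      |P.rightVal ν e x' - P.rightVal ν e x| < ε := by
  have hb : ∀ δ > (0 : ℝ), ∀ᶠ x' in 𝓝 x, ‖x' - x‖ < δ := fun δ hδ => by
    filter_upwards [Metric.ball_mem_nhds x hδ] with x' h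
    rwa [Metric.mem_ball, dist_eq_norm] at h
  by_cases hxK : x ∈ P.body
  · obtain ⟨p, hp, rfl⟩ := P.exists_Ioo_γ_eq hx hxK he
    obtain ⟨h1, h2⟩ := P.val_γ ν hν hν1 he (Ioo_subset_Icc_self hp)
    rw [h1, h2]
    -- By compactness and injectivity, perimeter points close to γ p have parameters close to `p` in
    -- this frame.
    set C : Set ℝ := Icc e (e + P.L) \ Ioo (p - ε / 2) (p + ε / 2) with hC
    have hCc : IsCompact C := isCompact_Icc.diff isOpen_Ioo
    have hnot : P.γ p ∉ P.γ '' C := by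
      rintro ⟨c, hc, hcp⟩
      have hc' := P.mem_Ioo_of_visible he
        ((P.mem_visible_congr hcp).2 (P.self_mem_visible p)) hc.1
      have := P.eq_of_γ_eq (Ioo_subset_Ico_self hc') (Ioo_subset_Ico_self hp) hcp
      rw [this] at hc
      exact hc.2 ⟨by linarith, by linarith⟩
    obtain ⟨η, hη, hball⟩ := Metric.mem_nhds_iff.1
      ((hCc.image P.continuous_γ).isClosed.isOpen_compl.mem_nhds hnot)
    filter_upwards [hb η hη, hb (ν * (ε / 2)) (by positivity),
      P.eventually_notMem_visible he] with x' h3 h4 he' hx'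
    obtain ⟨c, hc, hcv, θ, hθ, hcθ⟩ := P.exists_visible_mem_segment hx' (P.γ_mem p) e
    have n1 : ‖P.γ c - x'‖ ≤ ‖x' - P.γ p‖ := by
      have : P.γ c - x' = (-θ) • (x' - P.γ p) := by rw [hcθ]; module
      rw [this, norm_smul, norm_neg, Real.norm_of_nonneg hθ.1]
      exact mul_le_of_le_one_left (norm_nonneg _) hθ.2
    have n2 : ‖P.γ c - P.γ p‖ ≤ ‖x' - P.γ p‖ := by
      have : P.γ c - P.γ p = (1 - θ) • (x' - P.γ p) := by rw [hcθ]; module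
      rw [this, norm_smul, Real.norm_of_nonneg (sub_nonneg.2 hθ.2)]
      exact mul_le_of_le_one_left (norm_nonneg _) (by linarith [hθ.1])
    have hcp : c ∈ Ioo (p - ε / 2) (p + ε / 2) := by
      by_contra hcon
      refine hball (show P.γ c ∈ Metric.ball (P.γ p) η from ?_)
        ⟨c, ⟨⟨hc.1, hc.2.le⟩, hcon⟩, rfl⟩
      rw [Metric.mem_ball, dist_eq_norm]
      exact n2.trans_lt h3
    obtain ⟨h5, h6⟩ := P.abs_val_sub_visible_le ν hν hν1 hx' he' hcv ⟨hc.1, hc.2.le⟩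
    have h7 : ‖P.γ c - x'‖ / ν < ε / 2 := by
      rw [div_lt_iff₀ hν]; linarith
    rw [abs_le] at h5 h6
    constructor <;> rw [abs_lt] <;> constructor <;> linarith [hcp.1, hcp.2]
  · obtain ⟨η, hη, hball⟩ := Metric.mem_nhds_iff.1 (P.isClosed_body.isOpen_compl.mem_nhds hxK)
    filter_upwards [hb η hη, hb (ν * ε) (by positivity),
      P.eventually_notMem_visible he] with x' h3 h4 he' hx'
    have h5 := P.abs_val_sub_le ν hν hν1 he' he fun z hz hzi => by
      refine hball ((convex_ball x η).segment_subset ?_ (Metric.mem_ball_self hη) hz)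
        (interior_subset hzi)
      rwa [Metric.mem_ball, dist_eq_norm]
    have h6 : ‖x' - x‖ / ν < ε := by rw [div_lt_iff₀ hν]; linarith
    exact ⟨h5.1.trans_lt h6, h5.2.trans_lt h6⟩

/-! ### Monotonicity along the visible arc -/

/-- A functional that is positive on the target as seen from an outer point. -/
theorem exists_pos_functional {x : Plane} (hx : x ∉ P.body) :
    ∃ f : StrongDual ℝ Plane, ∃ m > 0, ∀ q ∈ P.body, m ≤ f (q - x) := by
  obtain ⟨f, u, hu, hf⟩ := geometric_hahn_banach_point_closed P.convex_body P.isClosed_body hx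
  exact ⟨f, u - f x, by linarith, fun q hq => by rw [map_sub]; linarith [hf q hq]⟩

/-- The ray from the intruder turns clockwise along the visible arc. -/
theorem cross_div_le {x : Plane} {f : StrongDual ℝ Plane} {m : ℝ} (hm : 0 < m)
    (hf : ∀ q ∈ P.body, m ≤ f (q - x)) {w : Plane} (hw : 0 ≤ f w) {a b : ℝ} (hab : a ≤ b)
    (h : ∀ s ∈ Ioo a b, s ∈ P.visible x) :
    cross w (P.γ b - x) / f (P.γ b - x) ≤ cross w (P.γ a - x) / f (P.γ a - x) := by
  obtain ⟨M, hM⟩ := P.isCompact_body.isBounded.exists_norm_le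
  set N : ℝ → ℝ := fun s => cross w (P.γ s - x) with hN
  set g : ℝ → ℝ := fun s => f (P.γ s - x) with hg
  have hgm : ∀ s, m ≤ g s := fun s => hf _ (P.γ_mem s)
  have hNl : ∀ r s, |N r - N s| ≤ ‖w‖ * |r - s| := fun r s => by
    have : N r - N s = cross w (P.γ r - P.γ s) := by simp only [hN, cross_sub_right]; ring
    rw [this]
    exact (abs_cross_le _ _).trans
      (mul_le_mul_of_nonneg_left (P.norm_γ_sub_le r s) (norm_nonneg _))
  have hgl : ∀ r s, |g r - g s| ≤ ‖f‖ * |r - s| := fun r s => by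
    have : g r - g s = f (P.γ r - P.γ s) := by simp only [hg, map_sub]; ring
    rw [this, ← Real.norm_eq_abs]
    exact (f.le_opNorm _).trans
      (mul_le_mul_of_nonneg_left (P.norm_γ_sub_le r s) (norm_nonneg _))
  have hNb : ∀ s, |N s| ≤ ‖w‖ * (M + ‖x‖) := fun s =>
    (abs_cross_le _ _).trans (mul_le_mul_of_nonneg_left
      ((norm_sub_le _ _).trans (by linarith [hM _ (P.γ_mem s)])) (norm_nonneg _))
  -- The quotient-rule constant: the denominator is at least `m`, and the numerator is at most `‖w‖
  -- * (M + ‖x‖)`.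
  set C : ℝ := ‖w‖ / m + ‖w‖ * (M + ‖x‖) * ‖f‖ / m ^ 2 with hC
  have hlip : LipschitzOnWith C.toNNReal (fun s => -(N s / g s)) (Icc a b) := by
    refine LipschitzOnWith.of_dist_le' fun r _ s _ => ?_
    rw [dist_eq_norm, dist_eq_norm, Real.norm_eq_abs, Real.norm_eq_abs]
    have hr := hm.trans_le (hgm r)
    have hs := hm.trans_le (hgm s)
    have h1 : -(N r / g r) - -(N s / g s) = (N s - N r) / g s + N r * (g r - g s) / (g r * g s) := by
      field_simp; ring
    rw [h1, hC, add_mul]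
    refine (abs_add_le _ _).trans (add_le_add ?_ ?_)
    · rw [abs_div, abs_of_pos hs, abs_sub_comm, div_mul_eq_mul_div]
      exact div_le_div₀ (by positivity) (hNl r s) hm (hgm s)
    · rw [abs_div, abs_mul, abs_of_pos (mul_pos hr hs), div_mul_eq_mul_div, mul_assoc _ ‖f‖]
      have hMx : 0 ≤ ‖w‖ * (M + ‖x‖) := (abs_nonneg _).trans (hNb 0)
      exact div_le_div₀ (by positivity)
        (mul_le_mul (hNb r) (hgl r s) (abs_nonneg _) hMx) (by positivity)
        (by rw [sq]; exact mul_le_mul (hgm r) (hgm s) hm.le hr.le)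
  have := hlip.le_of_ae_deriv_nonneg hab (by
    filter_upwards [P.ae_hasDerivAt] with s hs hsm k hk
    have ht := hs.1
    set t := deriv P.γ s
    have ht0 : t ≠ 0 := by intro h0; rw [h0] at hs; simp at hs
    have d1 : HasDerivAt (fun r => P.γ r - x) t s := ht.sub_const x
    have d2 : HasDerivAt N (cross w t) s := (crossL w).hasFDerivAt.comp_hasDerivAt s d1
    have d3 : HasDerivAt g (f t) s := f.hasFDerivAt.comp_hasDerivAt s d1
    have hgs := hm.trans_le (hgm s)
    have d4 := (d2.div d3 hgs.ne').neg
    have h1 := hk.unique d4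
    have h2 := P.cross_sub_nonpos_of_visible (h s hsm) ht ht0
    -- The numerator in the quotient rule collapses to `-(cross t (P.γ s - x) * f w)`, whose sign is
    -- known by visibility.
    have h3 := congrArg f (cross_smul_eq (P.γ s - x) t w)
    simp only [map_add, map_smul, smul_eq_mul] at h3
    rw [cross_comm t (P.γ s - x), cross_comm w (P.γ s - x)] at h3
    rw [h1, ← neg_div]
    refine div_nonneg ?_ (by positivity)
    simp only [hN, hg] at h3 ⊢
    nlinarith [mul_nonneg h2 hw])
  linarith

theorem cross_visible_nonpos {x : Plane} (hx : x ∉ P.body) {a b : ℝ} (hab : a ≤ b)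
    (h : ∀ s ∈ Ioo a b, s ∈ P.visible x) : cross (P.γ a - x) (P.γ b - x) ≤ 0 := by
  obtain ⟨f, m, hm, hf⟩ := P.exists_pos_functional hx
  have := P.cross_div_le hm hf (hm.le.trans (hf _ (P.γ_mem a))) hab h
  rw [cross_same, zero_div] at this
  by_contra! hcon
  have : 0 < cross (P.γ a - x) (P.γ b - x) / f (P.γ b - x) :=
    div_pos hcon (hm.trans_le (hf _ (P.γ_mem b)))
  linarith

/-- A tangent transverse to the ray makes the ray turn strictly right after `a`; by monotonicity it
never turns back. -/
theorem cross_visible_neg {x : Plane} (hx : x ∉ P.body) {a b : ℝ} (hab : a < b)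
    (h : ∀ s ∈ Ioo a b, s ∈ P.visible x) {t : Plane} (ht : HasDerivAt P.γ t a)
    (hpos : 0 < cross t (P.γ a - x)) : cross (P.γ a - x) (P.γ b - x) < 0 := by
  obtain ⟨f, m, hm, hf⟩ := P.exists_pos_functional hx
  set w := P.γ a - x with hw
  have d1 : HasDerivAt (fun r => cross w (P.γ r - x)) (cross w t) a :=
    (crossL w).hasFDerivAt.comp_hasDerivAt a (ht.sub_const x)
  have hneg : cross w t < 0 := by rw [cross_comm]; linarith
  have h1 : ∀ᶠ r in 𝓝[>] a, cross w (P.γ r - x) < 0 := by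
    have := (hasDerivAt_iff_tendsto_slope.1 d1).mono_left
      (nhdsWithin_mono a (fun r hr => (ne_of_gt hr : r ≠ a)))
    filter_upwards [this.eventually (gt_mem_nhds hneg), self_mem_nhdsWithin] with r hr hra
    have hra' : 0 < r - a := sub_pos.2 hra
    rw [slope_def_field, ← hw, cross_same, sub_zero, div_lt_iff₀ hra', zero_mul] at hr
    exact hr
  obtain ⟨r, hr, hr'⟩ := (h1.and (Ioo_mem_nhdsGT hab)).exists
  have h2 := P.cross_div_le hm hf (hm.le.trans (hf _ (P.γ_mem a))) hr'.2.le
    fun s hs => h s ⟨hr'.1.trans hs.1, hs.2⟩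
  have h3 : cross w (P.γ r - x) / f (P.γ r - x) < 0 :=
    div_neg_of_neg_of_pos hr (hm.trans_le (hf _ (P.γ_mem r)))
  by_contra! hcon
  have : 0 ≤ cross w (P.γ b - x) / f (P.γ b - x) :=
    div_nonneg hcon (hm.le.trans (hf _ (P.γ_mem b)))
  linarith

/-- The derivative of the distance to the intruder is nondecreasing along the visible arc. -/
theorem inner_div_norm_mono {x : Plane} (hx : x ∉ P.body) {a b : ℝ} (hab : a < b)
    (h : ∀ s ∈ Icc a b, s ∈ P.visible x) {t₁ t₂ : Plane} (ht₁ : HasDerivAt P.γ t₁ a)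
    (ht₂ : HasDerivAt P.γ t₂ b) (h₁ : ‖t₁‖ = 1) (h₂ : ‖t₂‖ = 1) :
    inner ℝ t₁ (P.γ a - x) / ‖P.γ a - x‖ ≤ inner ℝ t₂ (P.γ b - x) / ‖P.γ b - x‖ := by
  have hIoo : ∀ s ∈ Ioo a b, s ∈ P.visible x := fun s hs => h s (Ioo_subset_Icc_self hs)
  have h₁0 : t₁ ≠ 0 := by rintro rfl; simp at h₁
  have h₂0 : t₂ ≠ 0 := by rintro rfl; simp at h₂
  set v₁ := P.γ a - x with hv₁
  set v₂ := P.γ b - x with hv₂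
  have hv₁0 : 0 < ‖v₁‖ := by
    rw [norm_pos_iff, hv₁, sub_ne_zero]; rintro h0; exact hx (h0 ▸ P.γ_mem a)
  have hv₂0 : 0 < ‖v₂‖ := by
    rw [norm_pos_iff, hv₂, sub_ne_zero]; rintro h0; exact hx (h0 ▸ P.γ_mem b)
  have f₁ : 0 ≤ cross t₁ v₁ :=
    P.cross_sub_nonpos_of_visible (h a ⟨le_rfl, hab.le⟩) ht₁ h₁0
  have f₂ : 0 ≤ cross t₂ v₂ :=
    P.cross_sub_nonpos_of_visible (h b ⟨hab.le, le_rfl⟩) ht₂ h₂0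
  have hvv : P.γ b - P.γ a = v₂ - v₁ := by rw [hv₁, hv₂]; abel
  have g₁ : 0 ≤ cross t₁ (v₂ - v₁) := hvv ▸ P.cross_nonneg ht₁ (P.γ_mem b)
  have g₂ : 0 ≤ cross (v₂ - v₁) t₂ := by
    have := P.cross_nonneg ht₂ (P.γ_mem a)
    rw [← neg_sub (P.γ b), hvv, cross_neg_right, ← cross_comm] at this
    exact this
  rcases lt_or_eq_of_le f₁ with hpos | hzero
  · have hneg := P.cross_visible_neg hx hab hIoo ht₁ hpos
    rw [← hv₁, ← hv₂] at hneg
    have c1 : 0 < cross (v₂ - v₁) v₁ := by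
      rw [cross_sub_left, cross_same, sub_zero, cross_comm]; linarith
    have c2 : 0 < cross (v₂ - v₁) v₂ := by
      rw [cross_sub_left, cross_same, zero_sub]; linarith
    -- The chord direction is the intermediary: compare the tangent at `a` with it as seen along
    -- `v₁`, pass from `v₁` to `v₂` by Cauchy–Schwarz, and compare it with the tangent at `b`.
    have i1 := inner_le_inner_of_between (u := t₁) (w := v₂ - v₁) (e := v₁) 1
      (by linarith) (by linarith) (by linarith)
    have i2 := inner_le_inner_of_between (u := v₂ - v₁) (w := t₂) (e := v₂) 1
      (by linarith) (by linarith) (by linarith)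
    rw [h₁, mul_one] at i1
    rw [h₂, mul_one] at i2
    have hn : 0 < ‖v₂ - v₁‖ := by
      rw [norm_pos_iff]; intro h0; rw [h0] at c1; simp at c1
    have i3 : inner ℝ (v₂ - v₁) v₁ / ‖v₁‖ ≤ inner ℝ (v₂ - v₁) v₂ / ‖v₂‖ := by
      rw [div_le_div_iff₀ hv₁0 hv₂0, inner_sub_left v₂ v₁ v₁, inner_sub_left v₂ v₁ v₂,
        real_inner_self_eq_norm_sq, real_inner_self_eq_norm_sq, real_inner_comm v₂ v₁]
      have := real_inner_le_norm v₁ v₂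
      rw [real_inner_comm v₂ v₁] at this
      nlinarith
    have j1 := (div_le_div_iff_of_pos_right hv₁0).2 i1
    have j2 := (div_le_div_iff_of_pos_right hv₂0).2 i2
    have j3 : inner ℝ t₁ v₁ / ‖v₁‖ * ‖v₂ - v₁‖ ≤ inner ℝ t₂ v₂ / ‖v₂‖ * ‖v₂ - v₁‖ := by
      rw [div_mul_eq_mul_div, div_mul_eq_mul_div]; linarith
    exact le_of_mul_le_mul_right j3 hn
  -- Now the tangent at `a` is on the line of sight and the rate there is -1 or 1. The value -1 is
  -- minimal anyway; for 1 the rate at `b` has to be 1 too.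
  · have hsq := cross_sq_add_inner_sq t₁ v₁
    rw [← hzero, h₁] at hsq
    have hcs : -1 ≤ inner ℝ t₂ v₂ / ‖v₂‖ := by
      rw [le_div_iff₀ hv₂0]
      have := (abs_le.1 (abs_real_inner_le_norm t₂ v₂)).1
      rw [h₂] at this
      linarith
    rcases le_or_gt (inner ℝ t₁ v₁ : ℝ) 0 with hneg | hpos
    · have : inner ℝ t₁ v₁ / ‖v₁‖ ≤ -1 := by
        rw [div_le_iff₀ hv₁0]; nlinarith
      linarith
    · have hin : inner ℝ t₁ v₁ = ‖v₁‖ := by nlinarith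
      -- the tangent at `a` points away from the intruder, so the rest of the arc is on its ray
      have htv : ∀ z, cross v₁ z = ‖v₁‖ * cross t₁ z := by
        intro z
        have e1 : inner ℝ t₁ v₁ * cross v₁ z = ‖v₁‖ ^ 2 * cross t₁ z := by
          rw [Plane.inner_eq, Plane.norm_sq_eq]
          simp only [cross] at hzero ⊢
          linear_combination (v₁ 0 * z 0 + v₁ 1 * z 1) * hzero
        rw [hin] at e1
        have : ‖v₁‖ * cross v₁ z = ‖v₁‖ * (‖v₁‖ * cross t₁ z) := by rw [e1]; ring
        exact mul_left_cancel₀ hv₁0.ne' this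
      have hconst : ∀ r ∈ Icc a b, cross v₁ (P.γ r - x) = 0 := by
        intro r hr
        refine le_antisymm (P.cross_visible_nonpos hx hr.1 fun s hs =>
          hIoo s ⟨hs.1, hs.2.trans_le hr.2⟩) ?_
        have h3 : P.γ r - x = (P.γ r - P.γ a) + v₁ := by rw [hv₁]; abel
        rw [h3, cross_add_right, cross_same, add_zero, htv]
        exact mul_nonneg hv₁0.le (P.cross_nonneg ht₁ (P.γ_mem r))
      have hcr2 : cross v₁ v₂ = 0 := hconst b ⟨hab.le, le_rfl⟩
      have hct2 : cross v₁ t₂ = 0 := by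
        have d1 : HasDerivAt (fun r => cross v₁ (P.γ r - x)) (cross v₁ t₂) b :=
          (crossL v₁).hasFDerivAt.comp_hasDerivAt b (ht₂.sub_const x)
        have d2 : HasDerivWithinAt (fun r => cross v₁ (P.γ r - x)) 0 (Icc a b) b :=
          (hasDerivWithinAt_const b _ (0 : ℝ)).congr hconst (hconst b ⟨hab.le, le_rfl⟩)
        exact (uniqueDiffOn_Icc hab b ⟨hab.le, le_rfl⟩).eq_deriv _ d1.hasDerivWithinAt d2
      obtain ⟨o, ho⟩ := P.interior_nonempty
      obtain ⟨f, m, hm, hf⟩ := P.exists_pos_functional hx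
      have k1 : 0 < (inner ℝ t₂ v₁ : ℝ) := by
        have e1 : ‖v₁‖ ^ 2 * cross t₂ (o - P.γ b) = inner ℝ t₂ v₁ * cross v₁ (o - P.γ b) := by
          rw [Plane.inner_eq, Plane.norm_sq_eq]
          generalize o - P.γ b = z
          simp only [cross] at hct2 ⊢
          linear_combination (-v₁ 0 * z 0 - v₁ 1 * z 1) * hct2
        have e2 : o - P.γ b = (o - P.γ a) + v₁ - v₂ := by rw [hv₁, hv₂]; abel
        have e3 : 0 < cross v₁ (o - P.γ b) := by
          rw [e2, cross_sub_right, cross_add_right, cross_same, hcr2, htv]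
          have := mul_pos hv₁0 (P.cross_pos ht₁ h₁0 ho)
          linarith
        have e4 : 0 < inner ℝ t₂ v₁ * cross v₁ (o - P.γ b) := by
          rw [← e1]
          exact mul_pos (by positivity) (P.cross_pos ht₂ h₂0 ho)
        exact pos_of_mul_pos_left e4 e3.le
      have k2 : 0 < (inner ℝ v₁ v₂ : ℝ) := by
        have e1 : ‖v₁‖ ^ 2 • v₂ = (inner ℝ v₁ v₂ : ℝ) • v₁ := by
          rw [Plane.inner_eq, Plane.norm_sq_eq]
          simp only [cross] at hcr2
          ext i
          fin_cases i
          · simp; linear_combination (-v₁ 1) * hcr2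
          · simp; linear_combination (v₁ 0) * hcr2
        have e2 := congrArg f e1
        simp only [map_smul, smul_eq_mul] at e2
        have e3 := hm.trans_le (hf _ (P.γ_mem a))
        have e4 := hm.trans_le (hf _ (P.γ_mem b))
        rw [← hv₁] at e3
        rw [← hv₂] at e4
        have e5 : 0 < (inner ℝ v₁ v₂ : ℝ) * f v₁ := by rw [← e2]; positivity
        exact pos_of_mul_pos_left e5 e3.le
      have k3 : ‖v₁‖ ^ 2 * inner ℝ t₂ v₂ = inner ℝ t₂ v₁ * inner ℝ v₁ v₂ := by
        rw [Plane.inner_eq, Plane.inner_eq, Plane.inner_eq, Plane.norm_sq_eq]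
        simp only [cross] at hct2 hcr2
        linear_combination (v₁ 0 * v₂ 1 - v₁ 1 * v₂ 0) * hct2
      have k4 : cross t₂ v₂ = 0 := by
        have : ‖v₁‖ ^ 2 * cross t₂ v₂ = 0 := by
          rw [Plane.norm_sq_eq]
          simp only [cross] at hct2 hcr2 ⊢
          linear_combination (t₂ 0 * v₁ 0 + t₂ 1 * v₁ 1) * hcr2
            + (-v₂ 0 * v₁ 0 - v₂ 1 * v₁ 1) * hct2
        exact (mul_eq_zero.1 this).resolve_left (by positivity)
      have k5 : 0 < (inner ℝ t₂ v₂ : ℝ) := by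
        have : 0 < ‖v₁‖ ^ 2 * (inner ℝ t₂ v₂ : ℝ) := by rw [k3]; positivity
        exact pos_of_mul_pos_right this (by positivity)
      have k6 := cross_sq_add_inner_sq t₂ v₂
      rw [k4, h₂] at k6
      have k7 : inner ℝ t₂ v₂ = ‖v₂‖ := by nlinarith
      rw [hin, k7, div_self hv₁0.ne', div_self hv₂0.ne']

end Target

namespace Target

variable (P : Target) (ν : ℝ)

/-! ### Positions between the two breaching points -/

/-- A bound on the derivative of a multiple of the distance to the intruder along the perimeter. -/
theorem mul_sub_le_norm_sub {x : Plane} (hx : x ∉ P.body) (k : ℝ) {c a b : ℝ} (hab : a ≤ b)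
    (h : ∀ s ∈ Ioo a b, ∀ t, HasDerivAt P.γ t s → ‖t‖ = 1 →
      c ≤ k * (inner ℝ t (P.γ s - x) / ‖P.γ s - x‖)) :
    c * (b - a) ≤ k * (‖P.γ b - x‖ - ‖P.γ a - x‖) := by
  have hl : LipschitzWith (‖k‖₊ * 1 + ‖c‖₊ * 1) fun s => k * ‖P.γ s - x‖ - c * s := by
    refine LipschitzWith.sub ((lipschitzWith_smul k).comp
      (LipschitzWith.of_dist_le_mul fun r s => ?_)) ((lipschitzWith_smul c).comp LipschitzWith.id)
    rw [NNReal.coe_one, one_mul, dist_eq_norm, dist_eq_norm]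
    refine (abs_norm_sub_norm_le _ _).trans ?_
    rw [sub_sub_sub_cancel_right]
    exact P.norm_γ_sub_le r s
  have := (hl.lipschitzOnWith (s := Icc a b)).le_of_ae_deriv_nonneg hab (by
    filter_upwards [P.ae_hasDerivAt] with s hs hsm m hm
    have hne : P.γ s - x ≠ 0 := by
      rw [sub_ne_zero]; rintro h0; exact hx (h0 ▸ P.γ_mem s)
    have h1 : HasDerivAt (fun r => ‖P.γ r - x‖)
        (inner ℝ (deriv P.γ s) (P.γ s - x) / ‖P.γ s - x‖) s := by
      have d1 := (hs.1.sub_const x).norm_sq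
      have d2 := d1.sqrt (by positivity)
      simp only [Real.sqrt_sq (norm_nonneg _)] at d2
      convert d2 using 1
      rw [real_inner_comm]
      field_simp
    have h2 := (h1.const_mul k).sub ((hasDerivAt_id s).const_mul c)
    have h3 := hm.unique h2
    have h4 := h s hsm _ hs.1 hs.2
    simp at h3
    linarith)
  linarith

/-- If the distance grew faster than ν at `s`, it would do so all the way to the left breaching
point, since the rate is monotone; then `s` would be the better breaching point. The next lemma is
the mirror image. -/
theorem inner_le_of_lt_leftPos (hν : 0 < ν) {x : Plane} (hx : x ∉ P.body) {e : ℝ}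
    (he : e ∉ P.visible x) {s : ℝ} (hs : s ∈ P.visible x) (hse : s ∈ Ioo e (e + P.L))
    (hsl : s < P.leftPos ν e x) {t : Plane} (ht : HasDerivAt P.γ t s) (h1 : ‖t‖ = 1) :
    inner ℝ t (P.γ s - x) ≤ ν * ‖P.γ s - x‖ := by
  have hxi : x ∉ interior P.body := fun h => hx (interior_subset h)
  have hn : 0 < ‖P.γ s - x‖ := by
    rw [norm_pos_iff, sub_ne_zero]; rintro h0; exact hx (h0 ▸ P.γ_mem s)
  rw [← div_le_iff₀ hn]
  by_contra! hcon
  obtain ⟨hl, hle⟩ := P.leftPos_mem ν hxi he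
  have h2 := P.le_leftVal ν hxi he hs (Ioo_subset_Icc_self hse)
  have h3 := P.mul_sub_le_norm_sub hx 1 hsl.le fun r hr t' ht' h1' => by
    rw [one_mul]
    exact P.inner_div_norm_mono hx hr.1 (fun q hq => P.mem_visible_of_between he hs hl hse.1.le
      hq.1 (hq.2.trans hr.2.le) hle.2.le) ht ht' h1 h1'
  rw [leftVal] at h2
  have h4 : ‖P.γ (P.leftPos ν e x) - x‖ - ‖P.γ s - x‖ ≤ ν * (P.leftPos ν e x - s) := by
    rw [← div_le_iff₀' hν, sub_div]; linarith
  nlinarith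

theorem le_inner_of_rightPos_lt (hν : 0 < ν) {x : Plane} (hx : x ∉ P.body) {e : ℝ}
    (he : e ∉ P.visible x) {s : ℝ} (hs : s ∈ P.visible x) (hse : s ∈ Ioo e (e + P.L))
    (hsr : P.rightPos ν e x < s) {t : Plane} (ht : HasDerivAt P.γ t s) (h1 : ‖t‖ = 1) :
    -(ν * ‖P.γ s - x‖) ≤ inner ℝ t (P.γ s - x) := by
  have hxi : x ∉ interior P.body := fun h => hx (interior_subset h)
  have hn : 0 < ‖P.γ s - x‖ := by
    rw [norm_pos_iff, sub_ne_zero]; rintro h0; exact hx (h0 ▸ P.γ_mem s)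
  rw [← neg_mul, ← le_div_iff₀ hn]
  by_contra! hcon
  obtain ⟨hr, hre⟩ := P.rightPos_mem ν hxi he
  have h2 := P.rightVal_le ν hxi he hs (Ioo_subset_Icc_self hse)
  have h5 : ∀ q ∈ Icc (P.rightPos ν e x) s, q ∈ P.visible x := fun q hq =>
    P.mem_visible_of_between he hr hs hre.1.le hq.1 hq.2 hse.2.le
  set κ := inner ℝ t (P.γ s - x) / ‖P.γ s - x‖ with hκ
  -- the distance decreases at least at the rate `-κ` before `s`
  have h3 : ‖P.γ s - x‖ - ‖P.γ (P.rightPos ν e x) - x‖ ≤ κ * (s - P.rightPos ν e x) := by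
    have h6 := P.mul_sub_le_norm_sub hx (-1) (c := -κ) hsr.le fun r hr t' ht' h1' => by
      have := P.inner_div_norm_mono hx hr.2
        (fun q hq => h5 q ⟨hr.1.le.trans hq.1, hq.2⟩) ht' ht h1' h1
      linarith
    linarith
  rw [rightVal] at h2
  have h4 : ‖P.γ (P.rightPos ν e x) - x‖ - ‖P.γ s - x‖ ≤ ν * (s - P.rightPos ν e x) := by
    rw [← div_le_iff₀' hν, sub_div]; linarith
  nlinarith

theorem frequently_hasDerivAt_lt (s : ℝ) :
    ∃ᶠ r in 𝓝[<] s, HasDerivAt P.γ (deriv P.γ r) r ∧ ‖deriv P.γ r‖ = 1 := by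
  have hd := Measure.dense_of_ae P.ae_hasDerivAt
  intro h
  obtain ⟨a, ha, hsub⟩ := mem_nhdsLT_iff_exists_Ioo_subset.1 h
  obtain ⟨r, hr, hr'⟩ := hd.exists_mem_open isOpen_Ioo (nonempty_Ioo.2 ha)
  exact hsub hr' hr

theorem frequently_hasDerivAt_gt (s : ℝ) :
    ∃ᶠ r in 𝓝[>] s, HasDerivAt P.γ (deriv P.γ r) r ∧ ‖deriv P.γ r‖ = 1 := by
  have hd := Measure.dense_of_ae P.ae_hasDerivAt
  intro h
  obtain ⟨a, ha, hsub⟩ := mem_nhdsGT_iff_exists_Ioo_subset.1 h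
  obtain ⟨r, hr, hr'⟩ := hd.exists_mem_open isOpen_Ioo (nonempty_Ioo.2 ha)
  exact hsub hr' hr

/-- The derivative of the distance along the perimeter bounds the difference of distances. -/
theorem norm_le_of_inner_le {x q t v : Plane} {k : ℝ} (hk : k = 1 ∨ k = -1) (hv : v ≠ 0)
    (h1 : ‖t‖ = 1) (hin : k * inner ℝ t v ≤ ν * ‖v‖)
    (hq : 0 ≤ cross t (q - x - v)) (htv : 0 ≤ cross t v) (hqv : k * cross (q - x) v < 0) :
    ‖v‖ ≤ ‖q - x‖ + ν * ‖v + x - q‖ := by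
  set w := v + x - q with hw
  have hqw : q - x - v = -w := by rw [hw]; abel
  have hqx : q - x = v - w := by rw [hw]; abel
  rw [hqw, cross_neg_right] at hq
  rw [hqx, cross_sub_left, cross_same] at hqv
  have hk2 : k * k = 1 := by rcases hk with rfl | rfl <;> norm_num
  -- By convexity the tangent lies between the chord from `q` and the line of sight. Hence the
  -- chord's component along `v` is at most `ν * ‖w‖`, and projecting `v = (q - x) + w` on `v` gives
  -- the claim.
  have h2 := inner_le_inner_of_between (u := w) (w := k • t) (e := v) k
    (by rw [cross_smul_right, ← mul_assoc, hk2, cross_comm t w]; linarith)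
    (by rw [cross_smul_left, ← mul_assoc, hk2]; linarith) (by linarith)
  rw [norm_smul, h1, real_inner_smul_left, mul_one, Real.norm_eq_abs] at h2
  have hka : |k| = 1 := by rcases hk with rfl | rfl <;> norm_num
  rw [hka, mul_one] at h2
  have h3 := real_inner_le_norm (q - x) v
  rw [hqx, inner_sub_left, real_inner_self_eq_norm_sq] at h3
  rw [← hqx] at h3
  have hv' : 0 < ‖v‖ := norm_pos_iff.2 hv
  have h4 := h2.trans (mul_le_mul_of_nonneg_right hin (norm_nonneg w))
  have h5 : ‖v‖ * ‖v‖ ≤ ‖v‖ * (‖q - x‖ + ν * ‖w‖) := by nlinarith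
  exact le_of_mul_le_mul_left h5 hv'

/-- Seen from an outer intruder, going to a position between the two breaching points by way of
a point of the target takes at least as long as going there directly, even if the
second part of the way is covered at unit speed. -/
theorem norm_sub_le_of_mem_Icc_of_notMem (hν : 0 < ν) {x : Plane} (hx : x ∉ P.body) {e : ℝ}
    (he : e ∉ P.visible x) {s : ℝ} (hs : s ∈ Icc (P.rightPos ν e x) (P.leftPos ν e x))
    {q : Plane} (hq : q ∈ P.body) : ‖P.γ s - x‖ ≤ ‖q - x‖ + ν * ‖P.γ s - q‖ := by
  have hxi : x ∉ interior P.body := fun h => hx (interior_subset h)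
  obtain ⟨hl, hle⟩ := P.leftPos_mem ν hxi he
  obtain ⟨hr, hre⟩ := P.rightPos_mem ν hxi he
  have hse : s ∈ Ioo e (e + P.L) := ⟨hre.1.trans_le hs.1, hs.2.trans_lt hle.2⟩
  have hsv : s ∈ P.visible x :=
    P.mem_visible_of_between he hr hl hre.1.le hs.1 hs.2 hle.2.le
  have hγc := P.continuous_γ
  have hne : ∀ r, P.γ r - x ≠ 0 := fun r => by
    rw [sub_ne_zero]; rintro h0; exact hx (h0 ▸ P.γ_mem r)
  set v := P.γ s - x with hv
  -- points of the interior that are not on the ray through `γ s`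
  have key : ∀ q ∈ interior P.body, cross (q - x) v ≠ 0 →
      ‖v‖ ≤ ‖q - x‖ + ν * ‖P.γ s - q‖ := by
    intro q hqi hc
    have hqK := interior_subset hqi
    obtain ⟨c, hce, hcv, θ, hθ, hcθ⟩ := P.exists_visible_mem_segment hxi hqK e
    have hce' := P.mem_Ioo_of_visible he hcv ⟨hce.1, hce.2.le⟩
    have hcq : P.γ c - x = θ • (q - x) := by rw [hcθ]; module
    have hθ0 : 0 < θ := by
      refine lt_of_le_of_ne hθ.1 fun h0 => hne c ?_
      rw [hcq, ← h0, zero_smul]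
    have hclosed : IsClosed {r | ‖P.γ r - x‖ ≤ ‖q - x‖ + ν * ‖P.γ r - q‖} :=
      isClosed_le (by fun_prop) (by fun_prop)
    have hcont : Continuous fun r => cross (q - x) (P.γ r - x) := by fun_prop
    have main : ∀ k : ℝ, (k = 1 ∨ k = -1) → ∀ r t, HasDerivAt P.γ t r → ‖t‖ = 1 →
        r ∈ P.visible x → k * inner ℝ t (P.γ r - x) ≤ ν * ‖P.γ r - x‖ →
        k * cross (q - x) (P.γ r - x) < 0 → ‖P.γ r - x‖ ≤ ‖q - x‖ + ν * ‖P.γ r - q‖ := by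
      intro k hk r t ht h1 hrv hin hcr
      have ht0 : t ≠ 0 := by rintro rfl; simp at h1
      have h2 := norm_le_of_inner_le ν (q := q) (x := x) hk (hne r) h1 hin
        (by
          have := P.cross_nonneg ht hqK
          rwa [sub_sub_sub_cancel_right])
        (P.cross_sub_nonpos_of_visible hrv ht ht0) hcr
      rwa [sub_add_cancel] at h2
    rcases lt_or_gt_of_ne hc with hneg | hpos
    · -- the point is to the left; use smooth positions before `s`
      -- The first perimeter point on the way to `q` is such a position, because rays turn clockwise
      -- along the arc. So positions just before `s` are visible, which allows approximating a
      -- corner at `s` by smooth positions.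
      have hex : ∃ c₀ ∈ P.visible x, c₀ ∈ Ioo e s := by
        refine ⟨c, hcv, hce'.1, ?_⟩
        by_contra! hcon
        have h2 := P.cross_visible_nonpos hx hcon fun r hr =>
          P.mem_visible_of_between he hsv hcv hse.1.le hr.1.le hr.2.le hce'.2.le
        rw [hcq, cross_smul_right, ← hv, cross_comm (q - x) v] at h2
        nlinarith
      obtain ⟨c₀, hc₀, hc₀'⟩ := hex
      refine hclosed.mem_of_frequently_of_tendsto (f := fun r => r) (b := 𝓝[<] s) (x := s) ?_
        (tendsto_id.mono_left nhdsWithin_le_nhds)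
      refine ((P.frequently_hasDerivAt_lt s).and_eventually
        ((show ∀ᶠ r in 𝓝[<] s, r ∈ Ioo c₀ s from Ioo_mem_nhdsLT hc₀'.2).and
        ((hcont.continuousAt.eventually (gt_mem_nhds hneg)).filter_mono
          nhdsWithin_le_nhds))).mono ?_
      rintro r ⟨⟨ht, h1⟩, hr, hcr⟩
      have hrv : r ∈ P.visible x :=
        P.mem_visible_of_between he hc₀ hsv hc₀'.1.le hr.1.le hr.2.le hse.2.le
      exact main 1 (Or.inl rfl) r _ ht h1 hrv (by
        rw [one_mul]
        exact P.inner_le_of_lt_leftPos ν hν hx he hrv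
          ⟨hc₀'.1.trans hr.1, hr.2.trans hse.2⟩ (hr.2.trans_le hs.2) ht h1) (by rwa [one_mul])
    · have hex : ∃ c₀ ∈ P.visible x, c₀ ∈ Ioo s (e + P.L) := by
        refine ⟨c, hcv, ?_, hce'.2⟩
        by_contra! hcon
        have h2 := P.cross_visible_nonpos hx hcon fun r hr =>
          P.mem_visible_of_between he hcv hsv hce'.1.le hr.1.le hr.2.le hse.2.le
        rw [hcq, cross_smul_left, ← hv] at h2
        nlinarith
      obtain ⟨c₀, hc₀, hc₀'⟩ := hex
      refine hclosed.mem_of_frequently_of_tendsto (f := fun r => r) (b := 𝓝[>] s) (x := s) ?_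
        (tendsto_id.mono_left nhdsWithin_le_nhds)
      refine ((P.frequently_hasDerivAt_gt s).and_eventually
        ((show ∀ᶠ r in 𝓝[>] s, r ∈ Ioo s c₀ from Ioo_mem_nhdsGT hc₀'.1).and
        ((hcont.continuousAt.eventually (lt_mem_nhds hpos)).filter_mono
          nhdsWithin_le_nhds))).mono ?_
      rintro r ⟨⟨ht, h1⟩, hr, hcr⟩
      have hrv : r ∈ P.visible x :=
        P.mem_visible_of_between he hsv hc₀ hse.1.le hr.1.le hr.2.le hc₀'.2.le
      refine main (-1) (Or.inr rfl) r _ ht h1 hrv ?_ (by linarith)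
      have := P.le_inner_of_rightPos_lt ν hν hx he hrv
        ⟨hse.1.trans hr.1, hr.2.trans hc₀'.2⟩ (hs.1.trans_lt hr.1) ht h1
      linarith
  -- the general case by density
  have hclosed : IsClosed {q | ‖v‖ ≤ ‖q - x‖ + ν * ‖P.γ s - q‖} :=
    isClosed_le (by fun_prop) (by fun_prop)
  have hint : interior P.body ⊆ {q | ‖v‖ ≤ ‖q - x‖ + ν * ‖P.γ s - q‖} := by
    intro q hqi
    by_cases hc : cross (q - x) v = 0
    -- A perpendicular perturbation moves `q` off the ray.
    · set w : Plane := !₂[v 1, -v 0] with hw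
      have hwv : cross w v = ‖v‖ ^ 2 := by
        rw [Plane.norm_sq_eq]; simp [cross, hw]; ring
      have hcont : Continuous fun ε : ℝ => q + ε • w := by fun_prop
      have htend : Tendsto (fun ε : ℝ => q + ε • w) (𝓝[>] 0) (𝓝 q) := by
        simpa using (hcont.tendsto 0).mono_left nhdsWithin_le_nhds
      refine hclosed.mem_of_tendsto htend ?_
      filter_upwards [htend.eventually (isOpen_interior.mem_nhds hqi), self_mem_nhdsWithin]
        with ε hε hε0
      refine key _ hε ?_
      have h2 : q + ε • w - x = (q - x) + ε • w := by abel
      have h3 : 0 < ‖v‖ := norm_pos_iff.2 (hne s)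
      have h4 : (0 : ℝ) < ε := hε0
      rw [h2, cross_add_left, hc, cross_smul_left, hwv, zero_add]
      positivity
    · exact key q hqi hc
  rw [← P.closure_interior] at hq
  exact closure_minimal hint hclosed hq

/-- What is left is an intruder on the perimeter. For ν = 1 this is the triangle inequality; for ν <
1 both breaching points are the intruder's own position. -/
theorem norm_sub_le_of_mem_Icc (hν : 0 < ν) (hν1 : ν ≤ 1) {x : Plane} (hx : x ∉ interior P.body)
    {e : ℝ} (he : e ∉ P.visible x) {s : ℝ}
    (hs : s ∈ Icc (P.rightPos ν e x) (P.leftPos ν e x))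
    {q : Plane} (hq : q ∈ P.body) : ‖P.γ s - x‖ ≤ ‖q - x‖ + ν * ‖P.γ s - q‖ := by
  by_cases hxK : x ∈ P.body
  · rcases eq_or_lt_of_le hν1 with h1 | h1
    · rw [h1, one_mul, add_comm]
      exact norm_sub_le_norm_sub_add_norm_sub _ _ _
    · obtain ⟨p, hp, rfl⟩ := P.exists_Ioo_γ_eq hx hxK he
      obtain ⟨h2, h3⟩ := P.val_γ ν hν hν1 he (Ioo_subset_Icc_self hp)
      have key : ∀ b ∈ P.visible (P.γ p), b ∈ Ioo e (e + P.L) →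
          |b - p| = ‖P.γ b - P.γ p‖ / ν → b = p := by
        intro b hb hbe hbp
        have h4 := P.abs_sub_le_of_visible he hb (P.self_mem_visible p) (Ioo_subset_Icc_self hbe)
          (Ioo_subset_Icc_self hp)
        rw [sub_self, norm_zero, add_zero] at h4
        rw [eq_div_iff hν.ne'] at hbp
        have h5 : |b - p| = 0 := by nlinarith [abs_nonneg (b - p)]
        rwa [abs_eq_zero, sub_eq_zero] at h5
      obtain ⟨hl, hle⟩ := P.leftPos_mem ν hx he
      obtain ⟨hr, hre⟩ := P.rightPos_mem ν hx he
      rw [leftVal] at h2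
      rw [rightVal] at h3
      have hl' := key _ hl hle (by
        rw [abs_of_nonneg] <;> linarith [div_nonneg (norm_nonneg
          (P.γ (P.leftPos ν e (P.γ p)) - P.γ p)) hν.le])
      have hr' := key _ hr hre (by
        rw [abs_of_nonpos] <;> linarith [div_nonneg (norm_nonneg
          (P.γ (P.rightPos ν e (P.γ p)) - P.γ p)) hν.le])
      have hsp : s = p := le_antisymm (hl' ▸ hs.2) (hr' ▸ hs.1)
      rw [hsp, sub_self, norm_zero]
      positivity
  · exact P.norm_sub_le_of_mem_Icc_of_notMem ν hν hxK he hs hq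

end Target

namespace Target

variable (P : Target) (ν : ℝ)

/-! ### The optimal breaching point and the function `V` in a frame -/

variable {x : Plane} {e : ℝ}

/-- The optimal breaching point as a number in the frame `[e, e + L)`. -/
def optPos (e si sj : ℝ) (x : Plane) : ℝ :=
  if P.leftPos ν e x < sMid si sj then P.leftPos ν e x
  else if sMid si sj < P.rightPos ν e x then P.rightPos ν e x else sMid si sj

/-- The function `V` in the frame `[e, e + L)`. -/
def frameV (e si sj : ℝ) (x : Plane) : ℝ :=
  min (P.optPos ν e si sj x - si) (sj - P.optPos ν e si sj x) -
    ‖P.γ (P.optPos ν e si sj x) - x‖ / ν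

theorem min_sub_sub (a b c : ℝ) : min (b - a) (c - b) = (c - a) / 2 - |b - sMid a c| := by
  rw [sMid]
  rcases le_total b ((a + c) / 2) with h | h
  · rw [min_eq_left (by linarith), abs_of_nonpos (by linarith)]; ring
  · rw [min_eq_right (by linarith), abs_of_nonneg (by linarith)]; ring

variable {si sj : ℝ}

theorem optPos_of_left (h : P.leftPos ν e x < sMid si sj) :
    P.optPos ν e si sj x = P.leftPos ν e x := if_pos h

theorem optPos_of_right (hx : x ∉ interior P.body) (he : e ∉ P.visible x)
    (h : sMid si sj < P.rightPos ν e x) : P.optPos ν e si sj x = P.rightPos ν e x := by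
  rw [optPos, if_neg (h.trans_le (P.rightPos_le_leftPos ν hx he)).not_gt, if_pos h]

theorem optPos_of_mid (h : sMid si sj ≤ P.leftPos ν e x) (h' : P.rightPos ν e x ≤ sMid si sj) :
    P.optPos ν e si sj x = sMid si sj := by
  rw [optPos, if_neg h.not_gt, if_neg h'.not_gt]

theorem frameV_of_left (h : P.leftPos ν e x < sMid si sj) :
    P.frameV ν e si sj x = P.leftVal ν e x - si := by
  have h' := h
  rw [sMid] at h'
  rw [frameV, P.optPos_of_left ν h, min_eq_left (by linarith), leftVal]
  ring

theorem frameV_of_right (hx : x ∉ interior P.body) (he : e ∉ P.visible x)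
    (h : sMid si sj < P.rightPos ν e x) : P.frameV ν e si sj x = sj - P.rightVal ν e x := by
  have h' := h
  rw [sMid] at h'
  rw [frameV, P.optPos_of_right ν hx he h, min_eq_right (by linarith), rightVal]
  ring

theorem frameV_of_mid (h : sMid si sj ≤ P.leftPos ν e x) (h' : P.rightPos ν e x ≤ sMid si sj) :
    P.frameV ν e si sj x = P.Jmid ν si sj x := by
  rw [frameV, P.optPos_of_mid ν h h', min_sub_sub, sub_self, abs_zero, sub_zero, Jmid]

theorem optPos_mem_Icc (hx : x ∉ interior P.body) (he : e ∉ P.visible x) :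
    P.optPos ν e si sj x ∈ Icc (P.rightPos ν e x) (P.leftPos ν e x) := by
  have h := P.rightPos_le_leftPos ν hx he
  rw [optPos]
  split_ifs with h1 h2
  · exact ⟨h, le_rfl⟩
  · exact ⟨le_rfl, h⟩
  · exact ⟨not_lt.1 h2, not_lt.1 h1⟩

theorem optPos_mem_visible (hx : x ∉ interior P.body) (he : e ∉ P.visible x) :
    P.optPos ν e si sj x ∈ P.visible x ∧ P.optPos ν e si sj x ∈ Ioo e (e + P.L) := by
  obtain ⟨hl, hle⟩ := P.leftPos_mem ν hx he
  obtain ⟨hr, hre⟩ := P.rightPos_mem ν hx he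
  obtain ⟨h1, h2⟩ := P.optPos_mem_Icc ν (si := si) (sj := sj) hx he
  exact ⟨P.mem_visible_of_between he hr hl hre.1.le h1 h2 hle.2.le,
    hre.1.trans_le h1, h2.trans_lt hle.2⟩

theorem optPos_mem_Icc_of_affPos (hx : x ∉ interior P.body) (he : e ∉ P.visible x)
    (hd : P.affPos ν e x ∈ Icc si sj) : P.optPos ν e si sj x ∈ Icc si sj := by
  have h1 := P.affPos_le_leftPos ν hx he
  have h2 := P.rightPos_le_affPos ν hx he
  obtain ⟨h3, h4⟩ := hd
  rw [optPos, sMid]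
  split_ifs with h5 h6 <;> constructor <;> linarith

theorem frameV_le_left (hx : x ∉ interior P.body) (he : e ∉ P.visible x) :
    P.frameV ν e si sj x ≤ P.leftVal ν e x - si := by
  obtain ⟨h1, h2⟩ := P.optPos_mem_visible ν (si := si) (sj := sj) hx he
  have h3 := P.le_leftVal ν hx he h1 (Ioo_subset_Icc_self h2)
  rw [frameV]
  linarith [min_le_left (P.optPos ν e si sj x - si) (sj - P.optPos ν e si sj x)]

theorem frameV_le_right (hx : x ∉ interior P.body) (he : e ∉ P.visible x) :
    P.frameV ν e si sj x ≤ sj - P.rightVal ν e x := by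
  obtain ⟨h1, h2⟩ := P.optPos_mem_visible ν (si := si) (sj := sj) hx he
  have h3 := P.rightVal_le ν hx he h1 (Ioo_subset_Icc_self h2)
  rw [frameV]
  linarith [min_le_right (P.optPos ν e si sj x - si) (sj - P.optPos ν e si sj x)]

/-- A shift from the midpoint to `b` costs |b - mid| in the defenders' time and saves at most `ν *
|b - mid|` in distance. Visibility of `b` is not needed, which matters when two intruder positions
are compared. -/
theorem le_Jmid_of_mid (hν : 0 < ν) (hν1 : ν ≤ 1) (hx : x ∉ interior P.body)
    (he : e ∉ P.visible x) (h : sMid si sj ≤ P.leftPos ν e x)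
    (h' : P.rightPos ν e x ≤ sMid si sj) (b : ℝ) :
    min (b - si) (sj - b) - ‖P.γ b - x‖ / ν ≤ P.Jmid ν si sj x := by
  have h1 := P.norm_sub_le_of_mem_Icc ν hν hν1 hx he ⟨h', h⟩ (P.γ_mem b)
  have h2 := P.norm_γ_sub_le (sMid si sj) b
  rw [abs_sub_comm] at h2
  have h3 : ‖P.γ (sMid si sj) - x‖ ≤ ‖P.γ b - x‖ + ν * |b - sMid si sj| := by nlinarith
  rw [min_sub_sub, Jmid]
  have h4 : ‖P.γ (sMid si sj) - x‖ / ν ≤ ‖P.γ b - x‖ / ν + |b - sMid si sj| := by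
    rw [div_add' _ _ _ hν.ne']
    gcongr
    linarith
  linarith

/-- The maximum characterization: each clamped case is the extremality of a breaching point, the
middle case is `le_Jmid_of_mid`. -/
theorem le_frameV (hν : 0 < ν) (hν1 : ν ≤ 1) (hx : x ∉ interior P.body)
    (he : e ∉ P.visible x) {b : ℝ} (hb : b ∈ P.visible x) (hbe : b ∈ Icc e (e + P.L)) :
    min (b - si) (sj - b) - ‖P.γ b - x‖ / ν ≤ P.frameV ν e si sj x := by
  rcases lt_or_ge (P.leftPos ν e x) (sMid si sj) with h | h
  · rw [P.frameV_of_left ν h]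
    linarith [P.le_leftVal ν hx he hb hbe, min_le_left (b - si) (sj - b)]
  · rcases lt_or_ge (sMid si sj) (P.rightPos ν e x) with h' | h'
    · rw [P.frameV_of_right ν hx he h']
      linarith [P.rightVal_le ν hx he hb hbe, min_le_right (b - si) (sj - b)]
    · rw [P.frameV_of_mid ν h h']
      exact P.le_Jmid_of_mid ν hν hν1 hx he h h' b

/-- Comparison of the values of `frameV` at two configurations. -/
theorem frameV_le_add (hν : 0 < ν) (hν1 : ν ≤ 1) (hx : x ∉ interior P.body)
    (he : e ∉ P.visible x) {x' : Plane} (hx' : x' ∉ interior P.body) (he' : e ∉ P.visible x')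
    {si' sj' r η : ℝ} (hl : P.leftVal ν e x' ≤ P.leftVal ν e x + r)
    (hr : P.rightVal ν e x ≤ P.rightVal ν e x' + r) (hd : ‖x - x'‖ / ν ≤ r)
    (hi : si ≤ si' + η) (hj : sj' ≤ sj + η) :
    P.frameV ν e si' sj' x' ≤ P.frameV ν e si sj x + r + η := by
  rcases lt_or_ge (P.leftPos ν e x) (sMid si sj) with h | h
  · rw [P.frameV_of_left ν h]
    linarith [P.frameV_le_left ν (si := si') (sj := sj') hx' he']
  · rcases lt_or_ge (sMid si sj) (P.rightPos ν e x) with h' | h'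
    · rw [P.frameV_of_right ν hx he h']
      linarith [P.frameV_le_right ν (si := si') (sj := sj') hx' he']
    -- The optimal point `b` of `x'` may be hidden from `x`, but in the middle case this does not
    -- matter.
    · rw [P.frameV_of_mid ν h h', frameV]
      set b := P.optPos ν e si' sj' x'
      have h1 := P.le_Jmid_of_mid ν hν hν1 hx he h h' b
      have h2 : min (b - si') (sj' - b) ≤ min (b - si) (sj - b) + η := by
        rw [← min_add_add_right]
        exact min_le_min (by linarith) (by linarith)
      have h3 : ‖P.γ b - x‖ ≤ ‖P.γ b - x'‖ + ‖x - x'‖ := by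
        rw [norm_sub_rev x x']
        exact norm_sub_le_norm_sub_add_norm_sub _ _ _
      have h4 : ‖P.γ b - x‖ / ν ≤ ‖P.γ b - x'‖ / ν + ‖x - x'‖ / ν := by
        rw [← add_div]; gcongr
      linarith

theorem frameV_congr {e' : ℝ} (h1 : P.leftPos ν e' x = P.leftPos ν e x)
    (h2 : P.rightPos ν e' x = P.rightPos ν e x) :
    P.frameV ν e' si sj x = P.frameV ν e si sj x := by
  rw [frameV, frameV, optPos, optPos, h1, h2]

theorem JLstar_eq {d : ℝ} (h : P.leftPos ν e x ∈ Ico d (d + P.L)) :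
    P.JLstar ν d x = P.leftVal ν e x - d := by
  obtain ⟨k, hk⟩ := P.exists_add_arc_eq e (P.sL ν x)
  have h1 : P.arc d (P.sL ν x) = P.leftPos ν e x - d :=
    P.arc_eq_of_add_eq k (by rw [add_sub_cancel, leftPos, hk]) ⟨by linarith [h.1], by linarith [h.2]⟩
  rw [JLstar, JL, h1, leftVal, ← P.γ_leftPos ν e x]
  ring

theorem arc_sR_eq {d : ℝ} (h : P.rightPos ν e x ∈ Ioc (d - P.L) d) :
    P.arc (P.sR ν x) d = d - P.rightPos ν e x := by
  obtain ⟨k, hk⟩ := P.exists_add_arc_eq e (P.sR ν x)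
  refine P.arc_eq_of_add_eq (-k) ?_ ⟨by linarith [h.2], by linarith [h.1]⟩
  rw [rightPos, hk]
  push_cast
  ring

theorem JRstar_eq {d : ℝ} (h : P.rightPos ν e x ∈ Ioc (d - P.L) d) :
    P.JRstar ν d x = d - P.rightVal ν e x := by
  rw [JRstar, JR, P.arc_sR_eq ν h, rightVal, ← P.γ_rightPos ν e x]
  ring

theorem mem_regionI_iff (hx : x ∉ interior P.body) (he : e ∉ P.visible x) (hL : sj ≤ si + P.L) :
    x ∈ P.regionI ν si sj ↔ ∃ k : ℤ, si ≤ P.affPos ν (e + k * P.L) x ∧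
      P.leftPos ν (e + k * P.L) x < sMid si sj := by
  have hL0 := P.L_pos
  obtain ⟨m, hm⟩ := P.exists_add_arc_eq si (P.sL ν x)
  obtain ⟨n, hn⟩ := P.exists_add_arc_eq e (P.sL ν x)
  constructor
  · rintro ⟨h1, h2⟩
    obtain ⟨k, hk1, hk2⟩ := (P.mem_gameSpace_iff ν hx he).1 h2
    refine ⟨k, hk1, ?_⟩
    have h3 := (P.leftPos_mem ν hx he).2.2
    have h4 := (P.rightPos_mem ν hx he).2.1
    have h5 := P.rightPos_le_affPos ν hx he
    rw [affPos_add_int_mul] at hk2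
    rw [leftPos_add_int_mul]
    rw [hm] at hk2
    have h6 : P.leftPos ν e x = P.sL ν x + n * P.L := hn
    -- Otherwise `affPos` and `leftPos` would differ by at least L, although both lie in the open
    -- frame. So the representative of the breaching point belongs to this translate or to a later
    -- one.
    have h7 : (0 : ℝ) < ((m - n - k + 1 : ℤ) : ℝ) := by
      push_cast
      by_contra! hcon
      have := mul_le_mul_of_nonneg_right hcon hL0.le
      linarith
    have h8 : (0 : ℝ) ≤ ((m - n - k : ℤ) : ℝ) := by
      have : 0 < m - n - k + 1 := by exact_mod_cast h7
      exact_mod_cast (by omega : 0 ≤ m - n - k)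
    push_cast at h8
    have := mul_nonneg h8 hL0.le
    rw [sMid]
    linarith
  · rintro ⟨k, h1, h2⟩
    have h3 := P.affPos_le_leftPos ν hx (P.add_int_mul_notMem_visible he k)
    rw [sMid] at h2
    have h4 : P.arc si (P.sL ν x) = P.leftPos ν (e + k * P.L) x - si :=
      P.arc_eq_of_add_eq (n + k) (by
        rw [add_sub_cancel, leftPos_add_int_mul, leftPos, hn]; push_cast; ring)
        ⟨by linarith, by linarith⟩
    refine ⟨by rw [h4]; linarith, ?_⟩
    rw [h4, add_sub_cancel]
    exact P.mem_gameSpace_of_frame ν hx (P.add_int_mul_notMem_visible he k) ⟨h1, h3⟩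

theorem mem_regionJ_iff (hx : x ∉ interior P.body) (he : e ∉ P.visible x) (hL : sj ≤ si + P.L) :
    x ∈ P.regionJ ν si sj ↔ ∃ k : ℤ, P.affPos ν (e + k * P.L) x ≤ sj ∧
      sMid si sj < P.rightPos ν (e + k * P.L) x := by
  have hL0 := P.L_pos
  obtain ⟨m, hm⟩ := P.exists_add_arc_eq (P.sR ν x) sj
  obtain ⟨n, hn⟩ := P.exists_add_arc_eq e (P.sR ν x)
  constructor
  · rintro ⟨h1, h2⟩
    obtain ⟨k, hk1, hk2⟩ := (P.mem_gameSpace_iff ν hx he).1 h2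
    refine ⟨k, hk2, ?_⟩
    have h3 := (P.leftPos_mem ν hx he).2.2
    have h4 := (P.rightPos_mem ν hx he).2.1
    have h5 := P.affPos_le_leftPos ν hx he
    rw [affPos_add_int_mul] at hk1
    rw [rightPos_add_int_mul]
    have h6 : P.rightPos ν e x = P.sR ν x + n * P.L := hn
    have h7 : (0 : ℝ) < ((m + n + k + 1 : ℤ) : ℝ) := by
      push_cast
      by_contra! hcon
      have := mul_le_mul_of_nonneg_right hcon hL0.le
      linarith
    have h8 : (0 : ℝ) ≤ ((m + n + k : ℤ) : ℝ) := by
      have : 0 < m + n + k + 1 := by exact_mod_cast h7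
      exact_mod_cast (by omega : 0 ≤ m + n + k)
    push_cast at h8
    have := mul_nonneg h8 hL0.le
    rw [sMid]
    linarith
  · rintro ⟨k, h1, h2⟩
    have h3 := P.rightPos_le_affPos ν hx (P.add_int_mul_notMem_visible he k)
    rw [sMid] at h2
    have h4 := P.arc_sR_eq ν (x := x) (e := e + k * P.L) (d := sj) ⟨by linarith, by linarith⟩
    refine ⟨by rw [h4]; linarith, ?_⟩
    rw [h4, sub_sub_cancel]
    exact P.mem_gameSpace_of_frame ν hx (P.add_int_mul_notMem_visible he k) ⟨h3, h1⟩

/-- Only one translate of `affPos` fits between the defenders, so the case distinction modulo L in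
`V` is the one of the frame. On a full circle this requires `affPos` to be strictly inside. -/
theorem V_eq_frameV (hx : x ∉ interior P.body) (he : e ∉ P.visible x) (hL : sj ≤ si + P.L)
    (hd : P.affPos ν e x ∈ Icc si sj) (h : sj < si + P.L ∨ P.affPos ν e x ∈ Ioo si sj) :
    P.V ν si sj x = P.frameV ν e si sj x ∧
      P.γ (P.sOpt ν si sj x) = P.γ (P.optPos ν e si sj x) := by
  have hL0 := P.L_pos
  have hij := hd.1.trans hd.2
  have hal := P.affPos_le_leftPos ν hx he
  have hra := P.rightPos_le_affPos ν hx he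
  have key : ∀ k : ℤ, P.affPos ν e x + k * P.L ∈ Icc si sj → k = 0 := by
    rintro k ⟨h1, h2⟩
    have h3 : (k : ℝ) * P.L < 1 * P.L := by
      rcases h with h | h
      · linarith [hd.1, hd.2]
      · linarith [h.1, h.2]
    have h4 : (-1 : ℝ) * P.L < k * P.L := by
      rcases h with h | h
      · linarith [hd.1, hd.2]
      · linarith [h.1, h.2]
    have h5 := lt_of_mul_lt_mul_right h3 hL0.le
    have h6 := lt_of_mul_lt_mul_right h4 hL0.le
    have : k < 1 := by exact_mod_cast h5
    have : -1 < k := by exact_mod_cast h6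
    omega
  have hI : x ∈ P.regionI ν si sj ↔ P.leftPos ν e x < sMid si sj := by
    rw [P.mem_regionI_iff ν hx he hL]
    constructor
    · rintro ⟨k, h1, h2⟩
      have h3 := P.affPos_le_leftPos ν hx (P.add_int_mul_notMem_visible he k)
      have h4 : k = 0 := key k (by
        rw [← affPos_add_int_mul]
        rw [sMid] at h2
        exact ⟨h1, by linarith⟩)
      simpa [h4] using h2
    · intro h1
      exact ⟨0, by simpa using hd.1, by simpa using h1⟩
  have hJ : x ∈ P.regionJ ν si sj ↔ sMid si sj < P.rightPos ν e x := by
    rw [P.mem_regionJ_iff ν hx he hL]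
    constructor
    · rintro ⟨k, h1, h2⟩
      have h3 := P.rightPos_le_affPos ν hx (P.add_int_mul_notMem_visible he k)
      have h4 : k = 0 := key k (by
        rw [← affPos_add_int_mul]
        rw [sMid] at h2
        exact ⟨by linarith, h1⟩)
      simpa [h4] using h2
    · intro h1
      exact ⟨0, by simpa using hd.2, by simpa using h1⟩
  rw [V, sOpt]
  by_cases h1 : P.leftPos ν e x < sMid si sj
  · rw [if_pos (hI.2 h1), if_pos (hI.2 h1), P.frameV_of_left ν h1, P.optPos_of_left ν h1,
      γ_leftPos]
    rw [sMid] at h1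
    exact ⟨P.JLstar_eq ν ⟨by linarith [hd.1], by linarith⟩, rfl⟩
  · rw [if_neg (mt hI.1 h1), if_neg (mt hI.1 h1)]
    by_cases h2 : sMid si sj < P.rightPos ν e x
    · rw [if_pos (hJ.2 h2), if_pos (hJ.2 h2), P.frameV_of_right ν hx he h2,
        P.optPos_of_right ν hx he h2, γ_rightPos]
      rw [sMid] at h2
      exact ⟨P.JRstar_eq ν ⟨by linarith, by linarith [hd.2]⟩, rfl⟩
    · rw [if_neg (mt hJ.1 h2), if_neg (mt hJ.1 h2), P.frameV_of_mid ν (not_lt.1 h1) (not_lt.1 h2),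
        P.optPos_of_mid ν (not_lt.1 h1) (not_lt.1 h2)]
      exact ⟨rfl, rfl⟩

/-- On a full circle with `affPos` at an end, two translates fit and `V` may follow either. This
inequality survives; it suffices for lower bounds on the payoff against arbitrary defenders. -/
theorem frameV_le_V (hx : x ∉ interior P.body) (he : e ∉ P.visible x) (hL : sj ≤ si + P.L)
    (hd : P.affPos ν e x ∈ Icc si sj) : P.frameV ν e si sj x ≤ P.V ν si sj x := by
  have hL0 := P.L_pos
  by_cases h : sj < si + P.L ∨ P.affPos ν e x ∈ Ioo si sj
  · exact (P.V_eq_frameV ν hx he hL hd h).1.ge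
  push Not at h
  obtain ⟨h1, h2⟩ := h
  have hal := fun k : ℤ => P.affPos_le_leftPos ν hx (P.add_int_mul_notMem_visible he k)
  have hra := fun k : ℤ => P.rightPos_le_affPos ν hx (P.add_int_mul_notMem_visible he k)
  -- At an end, `frameV` is at most minus the half-width, which does not depend on the translate.
  have hval : ∀ k : ℤ,
      P.frameV ν e si sj x ≤ P.leftVal ν (e + k * P.L) x - P.affPos ν (e + k * P.L) x := by
    intro k
    have h3 : P.leftVal ν e x - P.affPos ν e x =
        P.leftVal ν (e + k * P.L) x - P.affPos ν (e + k * P.L) x := by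
      rw [leftVal_add_int_mul, affPos_add_int_mul]; ring
    rw [← h3]
    have h4 : P.affPos ν e x = si ∨ P.affPos ν e x = sj := by
      by_contra! hcon
      exact h2 ⟨lt_of_le_of_ne hd.1 hcon.1.symm, lt_of_le_of_ne hd.2 hcon.2⟩
    rcases h4 with h4 | h4
    · rw [h4]; exact P.frameV_le_left ν hx he
    · have := P.frameV_le_right ν (si := si) (sj := sj) hx he
      rw [affPos] at h4 ⊢
      linarith
  have hend : ∀ k : ℤ, P.affPos ν (e + k * P.L) x ∈ Icc si sj →
      P.affPos ν (e + k * P.L) x = si ∨ P.affPos ν (e + k * P.L) x = sj := by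
    rintro k ⟨h3, h4⟩
    by_contra! hcon
    have h5 := lt_of_le_of_ne h3 hcon.1.symm
    have h6 := lt_of_le_of_ne h4 hcon.2
    rw [affPos_add_int_mul] at h5 h6
    have hk : k = 0 := by
      have h7 : (k : ℝ) * P.L < 1 * P.L := by linarith [hd.1, hd.2]
      have h8 : (-1 : ℝ) * P.L < k * P.L := by linarith [hd.1, hd.2]
      have h9 := lt_of_mul_lt_mul_right h7 hL0.le
      have h10 := lt_of_mul_lt_mul_right h8 hL0.le
      have : k < 1 := by exact_mod_cast h9
      have : -1 < k := by exact_mod_cast h10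
      omega
    rw [hk, Int.cast_zero, zero_mul, add_zero] at h5 h6
    exact h2 ⟨h5, h6⟩
  rw [V]
  split_ifs with hI hJ
  · obtain ⟨k, h3, h4⟩ := (P.mem_regionI_iff ν hx he hL).1 hI
    have h5 := hal k
    have h4' := h4
    rw [sMid] at h4'
    have h6 := hend k ⟨h3, by linarith⟩
    rw [P.JLstar_eq ν ⟨h3.trans h5, by linarith⟩]
    have h7 := hval k
    have : P.affPos ν (e + k * P.L) x = si := h6.resolve_right (by linarith)
    linarith
  · obtain ⟨k, h3, h4⟩ := (P.mem_regionJ_iff ν hx he hL).1 hJ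
    have h5 := hra k
    have h4' := h4
    rw [sMid] at h4'
    have h6 := hend k ⟨by linarith, h3⟩
    rw [P.JRstar_eq ν ⟨by linarith, h5.trans h3⟩]
    have h7 := hval k
    have : P.affPos ν (e + k * P.L) x = sj := h6.resolve_left (by linarith)
    rw [affPos] at this h7
    linarith
  · have h3 : ¬ P.leftPos ν e x < sMid si sj := fun h3 =>
      hI ((P.mem_regionI_iff ν hx he hL).2 ⟨0, by simpa using hd.1, by simpa using h3⟩)
    have h4 : ¬ sMid si sj < P.rightPos ν e x := fun h4 =>
      hJ ((P.mem_regionJ_iff ν hx he hL).2 ⟨0, by simpa using hd.2, by simpa using h4⟩)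
    exact (P.frameV_of_mid ν (not_lt.1 h3) (not_lt.1 h4)).le

end Target

namespace Target

variable (P : Target) (ν : ℝ)

/-! ### The distance to the winning region -/

variable {x : Plane} {e si sj : ℝ}

theorem exists_frame_mem (hx : x ∉ interior P.body) (s : ℝ) :
    ∃ e, e ∉ P.visible x ∧ s ∈ Icc e (e + P.L) := by
  obtain ⟨e, he⟩ := P.exists_notMem_visible hx
  refine ⟨e + ⌊(s - e) / P.L⌋ * P.L, P.add_int_mul_notMem_visible he _, ?_, ?_⟩
  · have := mul_le_mul_of_nonneg_right (Int.floor_le ((s - e) / P.L)) P.L_pos.le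
    rw [div_mul_cancel₀ _ P.L_pos.ne'] at this
    linarith
  · have := mul_le_mul_of_nonneg_right (Int.lt_floor_add_one ((s - e) / P.L)).le P.L_pos.le
    rw [div_mul_cancel₀ _ P.L_pos.ne'] at this
    linarith

theorem γ_mem_gameSpace (hν : 0 < ν) (hν1 : ν ≤ 1) (hL : sj ≤ si + P.L) {s : ℝ}
    (hs : s ∈ Icc si sj) :
    P.γ s ∈ P.gameSpace ν si sj ∧ min (s - si) (sj - s) ≤ P.V ν si sj (P.γ s) := by
  have hx := P.γ_notMem_interior s
  obtain ⟨e, he, hse⟩ := P.exists_frame_mem hx s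
  obtain ⟨h1, h2⟩ := P.val_γ ν hν hν1 he hse
  have h3 : P.affPos ν e (P.γ s) ∈ Icc si sj := by
    rw [affPos, h1, h2, add_self_div_two]; exact hs
  have h4 := P.le_frameV ν (si := si) (sj := sj) hν hν1 hx he (P.self_mem_visible s) hse
  rw [sub_self, norm_zero, zero_div, sub_zero] at h4
  exact ⟨P.mem_gameSpace_of_frame ν hx he h3, h4.trans (P.frameV_le_V ν hx he hL h3)⟩

theorem mem_visible_segment {b θ : ℝ} (hb : b ∈ P.visible x) (hθ : θ ∈ Icc (0 : ℝ) 1) :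
    (1 - θ) • x + θ • P.γ b ∉ interior P.body ∧ b ∈ P.visible ((1 - θ) • x + θ • P.γ b) := by
  have h := (P.mem_visible_iff_forall).1 hb
  refine ⟨h θ hθ, (P.mem_visible_iff_forall).2 fun τ hτ => ?_⟩
  have h1 : (1 - τ) • ((1 - θ) • x + θ • P.γ b) + τ • P.γ b =
      (1 - (1 - (1 - τ) * (1 - θ))) • x + (1 - (1 - τ) * (1 - θ)) • P.γ b := by
    module
  rw [h1]
  refine h _ ⟨?_, ?_⟩ <;> nlinarith [hτ.1, hτ.2, hθ.1, hθ.2]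

/-- From this close to γ b, both breaching values are within min (b - si) (sj - b) of `b`, so their
mean is between the defenders. -/
theorem mem_gameSpace_of_segment (hν : 0 < ν) (hν1 : ν ≤ 1) (he : e ∉ P.visible x)
    (hL : sj ≤ si + P.L) {b θ : ℝ} (hb : b ∈ P.visible x) (hbe : b ∈ Icc e (e + P.L))
    (hθ : θ ∈ Ico (0 : ℝ) 1)
    (hd : ‖P.γ b - ((1 - θ) • x + θ • P.γ b)‖ ≤ ν * min (b - si) (sj - b)) :
    (1 - θ) • x + θ • P.γ b ∈ P.gameSpace ν si sj ∧
      min (b - si) (sj - b) - ‖P.γ b - ((1 - θ) • x + θ • P.γ b)‖ / ν ≤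
        P.V ν si sj ((1 - θ) • x + θ • P.γ b) := by
  obtain ⟨hy, hby⟩ := P.mem_visible_segment hb (Ico_subset_Icc_self hθ)
  have hey : e ∉ P.visible ((1 - θ) • x + θ • P.γ b) := fun h =>
    he (P.visible_subset_of_mem_segment (P.γ_mem b) hθ h)
  set y := (1 - θ) • x + θ • P.γ b
  rw [← div_le_iff₀' hν] at hd
  obtain ⟨h1, h2⟩ := P.abs_val_sub_visible_le ν hν hν1 hy hey hby hbe
  rw [abs_le] at h1 h2
  have h3 := P.leftVal_le_rightVal ν hν hν1 hy hey
  have h4 := min_le_left (b - si) (sj - b)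
  have h5 := min_le_right (b - si) (sj - b)
  have h6 : P.affPos ν e y ∈ Icc si sj := by
    rw [affPos]; constructor <;> linarith
  exact ⟨P.mem_gameSpace_of_frame ν hy hey h6,
    (P.le_frameV ν hν hν1 hy hey hby hbe).trans (P.frameV_le_V ν hy hey hL h6)⟩

theorem dBar_le (hν : 0 < ν) (hν1 : ν ≤ 1) (hx : x ∉ interior P.body) (he : e ∉ P.visible x)
    (hL : sj ≤ si + P.L) (hd : P.affPos ν e x ∈ Icc si sj) (hV : P.frameV ν e si sj x ≤ 0) :
    P.dBar ν si sj x ≤ -(ν * P.frameV ν e si sj x) := by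
  obtain ⟨hb, hbe⟩ := P.optPos_mem_visible ν (si := si) (sj := sj) hx he
  have hbs := P.optPos_mem_Icc_of_affPos ν hx he hd
  rw [frameV] at hV ⊢
  set b := P.optPos ν e si sj x
  have hm0 : 0 ≤ min (b - si) (sj - b) :=
    le_min (by linarith [hbs.1]) (by linarith [hbs.2])
  rcases hm0.eq_or_lt with hm | hm
  · obtain ⟨h1, h2⟩ := P.γ_mem_gameSpace ν hν hν1 hL hbs
    refine (Metric.infDist_le_dist_of_mem (s := P.winRegionWithBarrier ν si sj)
      ⟨h1, hm.le.trans h2⟩).trans ?_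
    rw [dist_comm, dist_eq_norm, ← hm, zero_sub, mul_neg, neg_neg, mul_div_cancel₀ _ hν.ne']
  · set D := ‖P.γ b - x‖ with hD
    set m := min (b - si) (sj - b)
    have hmD : ν * m ≤ D := by
      rw [← le_div_iff₀' hν]; linarith
    have hD0 : 0 < D := (mul_pos hν hm).trans_le hmD
    -- The parameter at which the remaining distance is `ν * m`, so that the intruder and the
    -- earlier defender would tie at `b`. The distance walked is `D - ν * m`.
    have hθ : 1 - ν * m / D ∈ Ico (0 : ℝ) 1 :=
      ⟨by linarith [(div_le_one hD0).2 hmD], by linarith [div_pos (mul_pos hν hm) hD0]⟩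
    set θ := 1 - ν * m / D with hθd
    have h1 : P.γ b - ((1 - θ) • x + θ • P.γ b) = (ν * m / D) • (P.γ b - x) := by
      rw [hθd]; module
    have h2 : ‖P.γ b - ((1 - θ) • x + θ • P.γ b)‖ = ν * m := by
      rw [h1, norm_smul, Real.norm_of_nonneg (by positivity), ← hD, div_mul_cancel₀ _ hD0.ne']
    obtain ⟨h3, h4⟩ := P.mem_gameSpace_of_segment ν hν hν1 he hL hb (Ioo_subset_Icc_self hbe)
      hθ h2.le
    rw [h2, mul_div_cancel_left₀ _ hν.ne', sub_self] at h4
    refine (Metric.infDist_le_dist_of_mem (s := P.winRegionWithBarrier ν si sj)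
      ⟨h3, h4⟩).trans ?_
    have h5 : (1 - θ) • x + θ • P.γ b - x = θ • (P.γ b - x) := by module
    rw [dist_comm, dist_eq_norm, h5, norm_smul, Real.norm_of_nonneg hθ.1, ← hD, hθd]
    field_simp
    linarith

theorem mul_le_neg_dBar (hν : 0 < ν) (hν1 : ν ≤ 1) (hx : x ∉ interior P.body)
    (he : e ∉ P.visible x) (hL : sj ≤ si + P.L) (hd : P.affPos ν e x ∈ Icc si sj) {v : ℝ}
    (hv0 : v ≤ 0) (hv : v ≤ P.frameV ν e si sj x) : ν * v ≤ -P.dBar ν si sj x := by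
  rcases le_total (P.frameV ν e si sj x) 0 with h | h
  · have h1 := P.dBar_le ν hν hν1 hx he hL hd h
    have h2 := mul_le_mul_of_nonneg_left hv hν.le
    linarith
  · have h1 : P.dBar ν si sj x = 0 := Metric.infDist_zero_of_mem
      ⟨P.mem_gameSpace_of_frame ν hx he hd, h.trans (P.frameV_le_V ν hx he hL hd)⟩
    rw [h1, neg_zero]
    exact mul_nonpos_of_nonneg_of_nonpos hν.le hv0

theorem continuousOn_val (hν : 0 < ν) (hν1 : ν ≤ 1) (e : ℝ) :
    ContinuousOn (P.leftVal ν e) {z | z ∉ interior P.body ∧ e ∉ P.visible z} ∧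
      ContinuousOn (P.rightVal ν e) {z | z ∉ interior P.body ∧ e ∉ P.visible z} := by
  constructor <;> rintro z ⟨hz, he⟩ <;> refine Metric.tendsto_nhds.2 fun ε hε => ?_ <;>
    filter_upwards [nhdsWithin_le_nhds (P.eventually_abs_val_sub_lt ν hν hν1 hz he hε),
      self_mem_nhdsWithin] with z' h1 h2
  · exact (h1 h2.1).1
  · exact (h1 h2.1).2

theorem continuousOn_affPos (hν : 0 < ν) (hν1 : ν ≤ 1) (e : ℝ) :
    ContinuousOn (P.affPos ν e) {z | z ∉ interior P.body ∧ e ∉ P.visible z} := by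
  obtain ⟨h1, h2⟩ := P.continuousOn_val ν hν hν1 e
  exact (h1.add h2).div_const 2

/-- Along a segment that does not meet the target, the deficit of the time to the winning region
grows at most at unit rate in time. -/
theorem neg_frameV_le_of_segment (hν : 0 < ν) (hν1 : ν ≤ 1) {y : Plane}
    (hseg : ∀ z ∈ segment ℝ y x, z ∉ interior P.body)
    (he : e ∉ P.visible y) (hd : P.affPos ν e y ∈ Icc si sj) (hV : 0 ≤ P.frameV ν e si sj y) :
    ∃ e', e' ∉ P.visible x ∧
      ((P.rightVal ν e' x - P.leftVal ν e' x) / 2 ≤ ‖y - x‖ / ν ∨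
        P.affPos ν e' x ∈ Icc si sj ∧ -P.frameV ν e' si sj x ≤ ‖y - x‖ / ν) := by
  let z : ℝ → Plane := fun t => y + t • (x - y)
  have hz0 : z 0 = y := by simp [z]
  have hz1 : z 1 = x := by simp [z]
  have hzc : Continuous z := by fun_prop
  have hzd : ∀ r s, z r - z s = (r - s) • (x - y) := fun r s => by simp only [z]; module
  have hzd' : ∀ r s, r ≤ s → ‖z r - z s‖ = (s - r) * ‖y - x‖ := fun r s hrs => by
    rw [hzd, norm_smul, Real.norm_eq_abs, abs_of_nonpos (by linarith), norm_sub_rev, neg_sub]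
  have hzs : ∀ r ∈ Icc (0 : ℝ) 1, z r ∈ segment ℝ y x := fun r hr => by
    rw [segment_eq_image']; exact ⟨r, hr, rfl⟩
  have hzi : ∀ r ∈ Icc (0 : ℝ) 1, z r ∉ interior P.body := fun r hr => hseg _ (hzs r hr)
  have hsub : ∀ r ∈ Icc (0 : ℝ) 1, ∀ s ∈ Icc (0 : ℝ) 1, ∀ w ∈ segment ℝ (z r) (z s),
      w ∉ interior P.body := fun r hr s hs w hw =>
    hseg w ((convex_segment y x).segment_subset (hzs r hr) (hzs s hs) hw)
  -- A two-stage invariant: the deficit is bounded while the path stays in the game space,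
  -- afterwards the half-width is. Stating it with some frame allows frames to change on the way.
  let Q : ℝ → Prop := fun t => ∃ e', e' ∉ P.visible (z t) ∧
      ((P.rightVal ν e' (z t) - P.leftVal ν e' (z t)) / 2 ≤ t * ‖y - x‖ / ν ∨
        P.affPos ν e' (z t) ∈ Icc si sj ∧ -P.frameV ν e' si sj (z t) ≤ t * ‖y - x‖ / ν)
  suffices h : Q 0 → Q 1 by
    simp only [Q, hz0, hz1, one_mul, zero_mul, zero_div] at h
    exact h ⟨e, he, Or.inr ⟨hd, by linarith⟩⟩
  refine rel_of_locally_rel (R := fun r s => Q r → Q s) zero_le_one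
    (fun r s t _ _ _ _ h1 h2 => h2 ∘ h1) ?_
  intro t₀ ht₀
  obtain ⟨e₀, he₀⟩ := P.exists_notMem_visible (hzi t₀ ht₀)
  obtain ⟨ε, hε, hball⟩ := Metric.eventually_nhds_iff.1
    (hzc.continuousAt.eventually (P.eventually_notMem_visible he₀))
  refine ⟨ε, hε, ?_⟩
  rintro r hr s hs hrs hr0 hs0 ⟨e₁, he₁, hQ⟩
  have hnv : ∀ q ∈ Icc r s, ∀ k : ℤ, e₀ + k * P.L ∉ P.visible (z q) := fun q hq k =>
    P.add_int_mul_notMem_visible (hball (by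
      rw [abs_lt] at hr0 hs0
      rw [Real.dist_eq, abs_lt]
      constructor <;> linarith [hq.1, hq.2])) k
  have hqI : ∀ q ∈ Icc r s, q ∈ Icc (0 : ℝ) 1 := fun q hq => ⟨hr.1.trans hq.1, hq.2.trans hs.2⟩
  obtain ⟨k, hk1, hk2, hk3, hk4, hk5⟩ := P.exists_frame_translate ν (hzi r hr)
    (by simpa using hnv r ⟨le_rfl, hrs⟩ 0) he₁
  set e₂ := e₀ + k * P.L with he₂
  rw [hk3, hk4, hk5, P.frameV_congr ν hk1 hk2] at hQ
  have hlip : ∀ p ∈ Icc r s, ∀ q ∈ Icc r s, p ≤ q →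
      |P.leftVal ν e₂ (z p) - P.leftVal ν e₂ (z q)| ≤ (q - p) * ‖y - x‖ / ν ∧
      |P.rightVal ν e₂ (z p) - P.rightVal ν e₂ (z q)| ≤ (q - p) * ‖y - x‖ / ν := by
    intro p hp q hq hpq
    rw [← hzd' p q hpq]
    exact P.abs_val_sub_le ν hν hν1 (hnv p hp k) (hnv q hq k) (hsub p (hqI p hp) q (hqI q hq))
  have hw : ∀ p ∈ Icc r s,
      (P.rightVal ν e₂ (z p) - P.leftVal ν e₂ (z p)) / 2 ≤ p * ‖y - x‖ / ν → Q s := by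
    intro p hp h1
    obtain ⟨h2, h3⟩ := hlip p hp s ⟨hrs, le_rfl⟩ hp.2
    refine ⟨e₂, hnv s ⟨hrs, le_rfl⟩ k, Or.inl ?_⟩
    rw [abs_le] at h2 h3
    have : s * ‖y - x‖ / ν = p * ‖y - x‖ / ν + (s - p) * ‖y - x‖ / ν := by ring
    linarith
  rcases hQ with hQ | ⟨hQ1, hQ2⟩
  · exact hw r ⟨le_rfl, hrs⟩ hQ
  · have hV : ∀ p ∈ Icc r s, -P.frameV ν e₂ si sj (z p) ≤ p * ‖y - x‖ / ν := by
      intro p hp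
      obtain ⟨h2, h3⟩ := hlip r ⟨le_rfl, hrs⟩ p hp hp.1
      rw [abs_le] at h2 h3
      have h4 := P.frameV_le_add ν hν hν1 (η := 0) (si := si) (sj := sj) (si' := si) (sj' := sj)
        (hzi p (hqI p hp)) (hnv p hp k) (hzi r hr)
        (hnv r ⟨le_rfl, hrs⟩ k) (r := (p - r) * ‖y - x‖ / ν) (by linarith) (by linarith)
        (by rw [norm_sub_rev, hzd' r p hp.1]) (by linarith) (by linarith)
      have : p * ‖y - x‖ / ν = r * ‖y - x‖ / ν + (p - r) * ‖y - x‖ / ν := by ring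
      linarith
    have hcont : ContinuousOn (fun t => P.affPos ν e₂ (z t)) (Icc r s) :=
      (P.continuousOn_affPos ν hν hν1 e₂).comp hzc.continuousOn
        fun q hq => ⟨hzi q (hqI q hq), hnv q hq k⟩
    -- At the exit, `affPos` is a defender's position and the half-width is at most the deficit, so
    -- the second stage takes over.
    have hexit : ∀ p ∈ Icc r s, P.affPos ν e₂ (z p) = si ∨ P.affPos ν e₂ (z p) = sj → Q s := by
      intro p hp h1
      refine hw p hp (le_trans ?_ (hV p hp))
      have h2 := P.frameV_le_left ν (si := si) (sj := sj) (hzi p (hqI p hp)) (hnv p hp k)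
      have h3 := P.frameV_le_right ν (si := si) (sj := sj) (hzi p (hqI p hp)) (hnv p hp k)
      rw [affPos] at h1
      rcases h1 with h1 | h1 <;> linarith
    by_cases h1 : P.affPos ν e₂ (z s) ∈ Icc si sj
    · exact ⟨e₂, hnv s ⟨hrs, le_rfl⟩ k, Or.inr ⟨h1, hV s ⟨hrs, le_rfl⟩⟩⟩
    · rw [mem_Icc, not_and_or, not_le, not_le] at h1
      rcases h1 with h1 | h1
      · obtain ⟨p, hp, hpe⟩ := intermediate_value_Icc' hrs hcont ⟨h1.le, hQ1.1⟩
        exact hexit p hp (Or.inl hpe)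
      · obtain ⟨p, hp, hpe⟩ := intermediate_value_Icc hrs hcont ⟨hQ1.2, h1.le⟩
        exact hexit p hp (Or.inr hpe)

theorem neg_V_le (hν : 0 < ν) (hν1 : ν ≤ 1) (hL : sj < si + P.L) (hx : x ∈ P.gameSpace ν si sj)
    {y : Plane} (hy : y ∈ P.gameSpace ν si sj) (hV : 0 ≤ P.V ν si sj y) :
    -(ν * P.V ν si sj x) ≤ ‖y - x‖ := by
  have hxi := P.notMem_interior_of_mem_gameSpace ν hx
  have hyi := P.notMem_interior_of_mem_gameSpace ν hy
  obtain ⟨e, he, hd⟩ := P.exists_frame_of_mem_gameSpace ν hx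
  obtain ⟨e₁, he₁, hd₁⟩ := P.exists_frame_of_mem_gameSpace ν hy
  rw [(P.V_eq_frameV ν hyi he₁ hL.le hd₁ (Or.inl hL)).1] at hV
  have hVx := (P.V_eq_frameV ν hxi he hL.le hd (Or.inl hL)).1
  suffices h : -P.frameV ν e si sj x ≤ ‖y - x‖ / ν by
    rw [hVx, ← mul_neg, ← le_div_iff₀' hν]; exact h
  by_cases hmid : sMid si sj ≤ P.leftPos ν e x ∧ P.rightPos ν e x ≤ sMid si sj
  · obtain ⟨h, h'⟩ := hmid
    rw [P.frameV_of_mid ν h h']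
    rw [frameV] at hV
    set b := P.optPos ν e₁ si sj y
    have h1 := P.le_Jmid_of_mid ν hν hν1 hxi he h h' b
    have h2 : ‖P.γ b - x‖ / ν ≤ ‖P.γ b - y‖ / ν + ‖y - x‖ / ν := by
      rw [← add_div]
      gcongr
      exact norm_sub_le_norm_sub_add_norm_sub _ _ _
    linarith
  -- If the optimal point is a breaching point, the deficit is at most the half-width, so a bound on
  -- either suffices.
  · have hw : -P.frameV ν e si sj x ≤ (P.rightVal ν e x - P.leftVal ν e x) / 2 := by
      obtain ⟨h1, h2⟩ := hd
      rw [affPos] at h1 h2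
      rcases lt_or_ge (P.leftPos ν e x) (sMid si sj) with h | h
      · rw [P.frameV_of_left ν h]; linarith
      · rw [P.frameV_of_right ν hxi he (not_le.1 fun h' => hmid ⟨h, h'⟩)]; linarith
    by_cases hseg : ∀ z ∈ segment ℝ y x, z ∉ interior P.body
    · obtain ⟨e', he', h1 | ⟨h1, h2⟩⟩ :=
        P.neg_frameV_le_of_segment ν hν hν1 hseg he₁ hd₁ hV
      · obtain ⟨k, -, -, h3, h4, -⟩ := P.exists_frame_translate ν hxi he he'
        rw [h3, h4, leftVal_add_int_mul, rightVal_add_int_mul] at h1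
        linarith
      · rwa [← (P.V_eq_frameV ν hxi he' hL.le h1 (Or.inl hL)).1, hVx] at h2
    -- If the segment enters the target, x sees a perimeter point at distance at most ‖y - x‖; both
    -- values are within that travel time of it, which bounds the half-width.
    · push Not at hseg
      obtain ⟨q, hq, hqK⟩ := hseg
      obtain ⟨c, hce, hcv, θ, hθ, hcθ⟩ := P.exists_visible_mem_segment hxi (interior_subset hqK) e
      obtain ⟨h1, h2⟩ := P.abs_val_sub_visible_le ν hν hν1 hxi he hcv (Ico_subset_Icc_self hce)
      rw [abs_le] at h1 h2
      have h3 : P.γ c - x = θ • (q - x) := by rw [hcθ]; module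
      have h4 : ‖P.γ c - x‖ ≤ ‖y - x‖ := by
        rw [segment_symm, segment_eq_image'] at hq
        obtain ⟨τ, hτ, rfl⟩ := hq
        rw [h3, add_sub_cancel_left, smul_smul, norm_smul, Real.norm_of_nonneg
          (mul_nonneg hθ.1 hτ.1)]
        exact mul_le_of_le_one_left (norm_nonneg _) (mul_le_one₀ hθ.2 hτ.1 hτ.2)
      have h5 : ‖P.γ c - x‖ / ν ≤ ‖y - x‖ / ν := by gcongr
      linarith

theorem dBar_eq (hν : 0 < ν) (hν1 : ν ≤ 1) (hL : sj < si + P.L) (hij : si ≤ sj)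
    (hx : x ∈ P.gameSpace ν si sj) (hV : P.V ν si sj x ≤ 0) :
    P.dBar ν si sj x = -(ν * P.V ν si sj x) := by
  have hxi := P.notMem_interior_of_mem_gameSpace ν hx
  obtain ⟨e, he, hd⟩ := P.exists_frame_of_mem_gameSpace ν hx
  have hVx := (P.V_eq_frameV ν hxi he hL.le hd (Or.inl hL)).1
  refine le_antisymm ?_ ?_
  · rw [hVx] at hV ⊢
    exact P.dBar_le ν hν hν1 hxi he hL.le hd hV
  · have hne : (P.winRegionWithBarrier ν si sj).Nonempty := by
      obtain ⟨h1, h2⟩ := P.γ_mem_gameSpace ν hν hν1 hL.le ⟨le_rfl, hij⟩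
      exact ⟨_, h1, le_trans (by rw [sub_self]; exact le_min le_rfl (by linarith)) h2⟩
    refine (Metric.le_infDist hne).2 fun y hy => ?_
    rw [dist_comm, dist_eq_norm]
    exact P.neg_V_le ν hν hν1 hL hx hy.1 hy.2

theorem winRegion_nonempty (hν : 0 < ν) (hν1 : ν ≤ 1) (hL : sj ≤ si + P.L) (hij : si < sj) :
    (P.winRegion ν si sj).Nonempty := by
  obtain ⟨h1, h2⟩ := P.γ_mem_gameSpace ν hν hν1 hL (s := sMid si sj)
    ⟨by rw [sMid]; linarith, by rw [sMid]; linarith⟩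
  refine ⟨_, h1, lt_of_lt_of_le ?_ h2⟩
  rw [min_sub_sub, sub_self, abs_zero]
  linarith

/-- A small step towards the optimal point makes the score of that point positive; a point already
on the perimeter is a limit of perimeter points strictly between the defenders. -/
theorem winRegionWithBarrier_subset_closure (hν : 0 < ν) (hν1 : ν ≤ 1) (hL : sj < si + P.L)
    (hij : si < sj) : P.winRegionWithBarrier ν si sj ⊆ closure (P.winRegion ν si sj) := by
  rintro y ⟨hy, hV⟩
  have hyi := P.notMem_interior_of_mem_gameSpace ν hy
  obtain ⟨e, he, hd⟩ := P.exists_frame_of_mem_gameSpace ν hy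
  rw [(P.V_eq_frameV ν hyi he hL.le hd (Or.inl hL)).1, frameV] at hV
  obtain ⟨hb, hbe⟩ := P.optPos_mem_visible ν (si := si) (sj := sj) hyi he
  have hbs := P.optPos_mem_Icc_of_affPos ν hyi he hd
  set b := P.optPos ν e si sj y
  have hm0 : 0 ≤ min (b - si) (sj - b) := le_min (by linarith [hbs.1]) (by linarith [hbs.2])
  by_cases hyb : P.γ b = y
  · rw [← hyb]
    have h1 : b ∈ closure (Ioo si sj) := by rwa [closure_Ioo hij.ne]
    have h2 : P.γ b ∈ closure (P.γ '' Ioo si sj) :=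
      image_closure_subset_closure_image P.continuous_γ (mem_image_of_mem _ h1)
    refine closure_mono ?_ h2
    rintro _ ⟨s, hs, rfl⟩
    obtain ⟨h2, h3⟩ := P.γ_mem_gameSpace ν hν hν1 hL.le (Ioo_subset_Icc_self hs)
    exact ⟨h2, lt_of_lt_of_le (lt_min (by linarith [hs.1]) (by linarith [hs.2])) h3⟩
  · have hD : 0 < ‖P.γ b - y‖ := norm_pos_iff.2 (sub_ne_zero.2 hyb)
    have hcont : Continuous fun θ : ℝ => (1 - θ) • y + θ • P.γ b := by fun_prop
    have htend : Tendsto (fun θ : ℝ => (1 - θ) • y + θ • P.γ b) (𝓝[>] 0) (𝓝 y) := by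
      simpa using (hcont.tendsto 0).mono_left nhdsWithin_le_nhds
    refine mem_closure_of_tendsto htend ?_
    filter_upwards [Ioo_mem_nhdsGT (zero_lt_one' ℝ)] with θ hθ
    have h1 : ‖P.γ b - ((1 - θ) • y + θ • P.γ b)‖ = (1 - θ) * ‖P.γ b - y‖ := by
      rw [show P.γ b - ((1 - θ) • y + θ • P.γ b) = (1 - θ) • (P.γ b - y) by module, norm_smul,
        Real.norm_of_nonneg (by linarith [hθ.2])]
    have h2 : (1 - θ) * ‖P.γ b - y‖ < ν * min (b - si) (sj - b) := by
      have h3 : ‖P.γ b - y‖ / ν ≤ min (b - si) (sj - b) := by linarith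
      rw [div_le_iff₀' hν] at h3
      nlinarith [hθ.1]
    obtain ⟨h3, h4⟩ := P.mem_gameSpace_of_segment ν hν hν1 he hL.le hb (Ioo_subset_Icc_self hbe)
      (Ioo_subset_Ico_self hθ) (h1 ▸ h2.le)
    refine ⟨h3, lt_of_lt_of_le ?_ h4⟩
    rw [h1, sub_pos, div_lt_iff₀' hν]
    exact h2

theorem infDist_winRegion (hν : 0 < ν) (hν1 : ν ≤ 1) (hL : sj < si + P.L) (hij : si < sj) :
    Metric.infDist x (P.winRegion ν si sj) = P.dBar ν si sj x := by
  rw [dBar, ← Metric.infDist_closure (s := P.winRegion ν si sj),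
    ← Metric.infDist_closure (s := P.winRegionWithBarrier ν si sj)]
  have hsub : P.winRegion ν si sj ⊆ P.winRegionWithBarrier ν si sj := fun y hy => ⟨hy.1, hy.2.le⟩
  congr 1
  exact (closure_mono hsub).antisymm
    (closure_minimal (P.winRegionWithBarrier_subset_closure ν hν hν1 hL hij) isClosed_closure)

end Target

/-! ### Integrals of bounded controls. -/

theorem intervalIntegrable_of_norm_le {E : Type*} [NormedAddCommGroup E] [MeasurableSpace E]
    [BorelSpace E] [SecondCountableTopology E] {f : ℝ → E} {C : ℝ} (hf : Measurable f)
    (hC : ∀ t, ‖f t‖ ≤ C) (a b : ℝ) : IntervalIntegrable f volume a b :=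
  (intervalIntegrable_const (c := C)).mono_fun hf.aestronglyMeasurable
    (ae_of_all _ fun t => (hC t).trans (le_abs_self C))

theorem norm_integral_sub_integral_le {E : Type*} [NormedAddCommGroup E] [NormedSpace ℝ E]
    [MeasurableSpace E] [BorelSpace E] [SecondCountableTopology E]
    {f : ℝ → E} {C : ℝ} (hf : Measurable f) (hC : ∀ t, ‖f t‖ ≤ C) {a b : ℝ} (hab : a ≤ b) :
    ‖(∫ t in (0 : ℝ)..a, f t) - ∫ t in (0 : ℝ)..b, f t‖ ≤ C * (b - a) := by
  rw [norm_sub_rev, intervalIntegral.integral_interval_sub_left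
    (intervalIntegrable_of_norm_le hf hC _ _) (intervalIntegrable_of_norm_le hf hC _ _)]
  refine (intervalIntegral.norm_integral_le_of_norm_le_const fun t _ => hC t).trans_eq ?_
  rw [abs_of_nonneg (by linarith)]

namespace Target

variable (P : Target) (ν : ℝ)

/-! ### The value along a path of the intruder -/

variable {x : Plane} {e : ℝ}

/-- Off the target, short pieces of the path lie in balls that avoid it, so the segment estimate
applies and adds up. Only the final point may touch the target; it is reached by continuity. -/
theorem abs_val_sub_le_of_path (hν : 0 < ν) (hν1 : ν ≤ 1) {z : ℝ → Plane} {r s : ℝ} (hrs : r ≤ s)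
    (hlip : ∀ p ∈ Icc r s, ∀ q ∈ Icc r s, p ≤ q → ‖z p - z q‖ ≤ ν * (q - p))
    (hK : ∀ q ∈ Ico r s, z q ∉ P.body) (hs : z s ∉ interior P.body)
    (he : ∀ q ∈ Icc r s, e ∉ P.visible (z q)) :
    |P.leftVal ν e (z r) - P.leftVal ν e (z s)| ≤ s - r ∧
      |P.rightVal ν e (z r) - P.rightVal ν e (z s)| ≤ s - r := by
  have hcont : ContinuousOn z (Icc r s) := by
    refine (LipschitzOnWith.of_dist_le_mul (K := 1) fun p hp q hq => ?_).continuousOn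
    rw [NNReal.coe_one, one_mul, dist_eq_norm, Real.dist_eq]
    rcases le_total p q with h | h
    · rw [abs_sub_comm, abs_of_nonneg (by linarith)]
      nlinarith [hlip p hp q hq h]
    · rw [norm_sub_rev, abs_of_nonneg (by linarith)]
      nlinarith [hlip q hq p hp h]
  have main : ∀ q ∈ Ico r s, |P.leftVal ν e (z r) - P.leftVal ν e (z q)| ≤ q - r ∧
      |P.rightVal ν e (z r) - P.rightVal ν e (z q)| ≤ q - r := by
    intro q hq
    refine rel_of_locally_rel (R := fun a b => |P.leftVal ν e (z a) - P.leftVal ν e (z b)| ≤ b - a ∧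
      |P.rightVal ν e (z a) - P.rightVal ν e (z b)| ≤ b - a) hq.1 ?_ ?_
    · rintro a b c - - - - ⟨h1, h2⟩ ⟨h3, h4⟩
      rw [abs_le] at h1 h2 h3 h4
      constructor <;> rw [abs_le] <;> constructor <;> linarith
    · intro t₀ ht₀
      have ht₀s : t₀ ∈ Ico r s := ⟨ht₀.1, ht₀.2.trans_lt hq.2⟩
      obtain ⟨ε, hε, hball⟩ := Metric.isOpen_iff.1 P.isClosed_body.isOpen_compl (z t₀) (hK t₀ ht₀s)
      have hz : ∀ a ∈ Icc r q, |a - t₀| < ε → z a ∈ Metric.ball (z t₀) ε := by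
        intro a ha had
        have ha' : a ∈ Icc r s := ⟨ha.1, ha.2.trans hq.2.le⟩
        rw [Metric.mem_ball, dist_eq_norm]
        rcases le_total a t₀ with h | h
        · rw [abs_of_nonpos (by linarith)] at had
          nlinarith [hlip a ha' t₀ (Ico_subset_Icc_self ht₀s) h]
        · rw [abs_of_nonneg (by linarith)] at had
          rw [norm_sub_rev]
          nlinarith [hlip t₀ (Ico_subset_Icc_self ht₀s) a ha' h]
      refine ⟨ε, hε, fun a ha b hb hab had hbd => ?_⟩
      have ha' : a ∈ Icc r s := ⟨ha.1, ha.2.trans hq.2.le⟩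
      have hb' : b ∈ Icc r s := ⟨hb.1, hb.2.trans hq.2.le⟩
      obtain ⟨h1, h2⟩ := P.abs_val_sub_le ν hν hν1 (he a ha') (he b hb') fun w hw hwi =>
        hball ((convex_ball _ _).segment_subset (hz a ha had) (hz b hb hbd) hw)
          (interior_subset hwi)
      have h3 : ‖z a - z b‖ / ν ≤ b - a := by
        rw [div_le_iff₀' hν]; exact hlip a ha' b hb' hab
      exact ⟨h1.trans h3, h2.trans h3⟩
  rcases hrs.eq_or_lt with rfl | hlt
  · simp
  have hmaps : MapsTo z (Icc r s) {z | z ∉ interior P.body ∧ e ∉ P.visible z} := by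
    intro q hq
    refine ⟨?_, he q hq⟩
    rcases hq.2.eq_or_lt with rfl | h
    · exact hs
    · exact fun h' => hK q ⟨hq.1, h⟩ (interior_subset h')
  obtain ⟨hc1, hc2⟩ := P.continuousOn_val ν hν hν1 e
  have hs' : s ∈ Icc r s := ⟨hrs, le_rfl⟩
  have hcl : s ∈ closure (Ico r s) := by rw [closure_Ico hlt.ne]; exact hs'
  have d1 := ((hc1.comp hcont hmaps) s hs').mono Ico_subset_Icc_self
  have d2 := ((hc2.comp hcont hmaps) s hs').mono Ico_subset_Icc_self
  have d3 : ContinuousWithinAt (fun q => q - r) (Ico r s) s := by fun_prop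
  exact ⟨ContinuousWithinAt.closure_le hcl (continuousWithinAt_const.sub d1).abs d3
      fun q hq => (main q hq).1,
    ContinuousWithinAt.closure_le hcl (continuousWithinAt_const.sub d2).abs d3
      fun q hq => (main q hq).2⟩

/-- If the intruder heads for the optimal breaching point, then the value does not decrease. -/
theorem nonneg_of_hasDerivAt_frameV (hν : 0 < ν) (hν1 : ν ≤ 1) {σi σj : ℝ → ℝ} {z : ℝ → Plane}
    {t m : ℝ} (hz : z t ∉ P.body) (he : e ∉ P.visible (z t))
    (hzd : HasDerivAt z ((ν / ‖P.γ (P.optPos ν e (σi t) (σj t) (z t)) - z t‖) •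
      (P.γ (P.optPos ν e (σi t) (σj t) (z t)) - z t)) t)
    (hσi : ∀ᶠ τ in 𝓝[>] t, σi τ ≤ σi t + (τ - t)) (hσj : ∀ᶠ τ in 𝓝[>] t, σj t - (τ - t) ≤ σj τ)
    (hm : HasDerivAt (fun τ => P.frameV ν e (σi τ) (σj τ) (z τ)) m t) : 0 ≤ m := by
  have hzi : z t ∉ interior P.body := fun h => hz (interior_subset h)
  obtain ⟨hb, hbe⟩ := P.optPos_mem_visible ν (si := σi t) (sj := σj t) hzi he
  have hbt : P.frameV ν e (σi t) (σj t) (z t) =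
      min (P.optPos ν e (σi t) (σj t) (z t) - σi t) (σj t - P.optPos ν e (σi t) (σj t) (z t)) -
        ‖P.γ (P.optPos ν e (σi t) (σj t) (z t)) - z t‖ / ν := rfl
  set b := P.optPos ν e (σi t) (σj t) (z t)
  set D := ‖P.γ b - z t‖ with hD
  have hD0 : 0 < D := by
    rw [hD, norm_pos_iff, sub_ne_zero]; rintro h; exact hz (h ▸ P.γ_mem b)
  -- The tangent path runs straight to γ b, so the score of `b` along it does not drop. It differs
  -- from `z` by o(τ - t), and adding ‖z - y‖ / ν to the value does not change the derivative at
  -- `t`.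
  set y : ℝ → Plane := fun τ => z t + (τ - t) • (ν / D) • (P.γ b - z t) with hy
  have hyt : y t = z t := by simp [hy]
  have hyc : Continuous y := by fun_prop
  have hφ : HasDerivAt (fun τ => ‖z τ - y τ‖ / ν) 0 t := by
    have h1 := (hasDerivAt_iff_isLittleO.1 hzd).norm_left.const_mul_left ν⁻¹
    refine hasDerivAt_iff_isLittleO.2 (h1.congr_left fun τ => ?_)
    rw [hyt, sub_self, norm_zero, zero_div, sub_zero, smul_zero, sub_zero, div_eq_inv_mul _ ν, hy,
      sub_add_eq_sub_sub]
  obtain ⟨ε, hε, hball⟩ := Metric.isOpen_iff.1 P.isClosed_body.isOpen_compl (z t) hz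
  have hnz : ∀ᶠ τ in 𝓝 t, z τ ∈ Metric.ball (z t) ε :=
    hzd.continuousAt.eventually (Metric.ball_mem_nhds _ hε)
  have hny : ∀ᶠ τ in 𝓝 t, y τ ∈ Metric.ball (z t) ε := by
    have h1 := hyc.tendsto t
    rw [hyt] at h1
    exact h1.eventually (Metric.ball_mem_nhds _ hε)
  have hez : ∀ᶠ τ in 𝓝 t, e ∉ P.visible (z τ) :=
    hzd.continuousAt.eventually (P.eventually_notMem_visible he)
  have hk := hm.add hφ
  rw [add_zero] at hk
  have hslope := (hasDerivWithinAt_iff_tendsto_slope' (s := Ioi t) (by simp)).1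
    hk.hasDerivWithinAt
  refine ge_of_tendsto hslope ?_
  filter_upwards [nhdsWithin_le_nhds hnz, nhdsWithin_le_nhds hny, nhdsWithin_le_nhds hez, hσi, hσj,
    Ioo_mem_nhdsGT (show t < t + D / ν by linarith [div_pos hD0 hν])] with τ h1 h2 h3 h4 h5 h6
  have hτ : 0 < τ - t := by linarith [h6.1]
  rw [slope_def_field]
  refine div_nonneg ?_ hτ.le
  set θ := (τ - t) * (ν / D) with hθd
  have hθ : θ ∈ Ico (0 : ℝ) 1 := by
    refine ⟨by positivity, ?_⟩
    have : (τ - t) * (ν / D) < D / ν * (ν / D) := by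
      apply mul_lt_mul_of_pos_right _ (by positivity)
      linarith [h6.2]
    rwa [div_mul_div_cancel₀ hν.ne', div_self hD0.ne'] at this
  have hyθ : y τ = (1 - θ) • z t + θ • P.γ b := by
    simp only [hy, hθd]; module
  obtain ⟨h7, h8⟩ := P.mem_visible_segment hb (Ico_subset_Icc_self hθ)
  have h9 : e ∉ P.visible (y τ) := by
    rw [hyθ]; exact fun h => he (P.visible_subset_of_mem_segment (P.γ_mem b) hθ h)
  rw [← hyθ] at h7 h8
  have h10 := P.le_frameV ν (si := σi τ) (sj := σj τ) hν hν1 h7 h9 h8 (Ioo_subset_Icc_self hbe)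
  have h11 : ‖P.γ b - y τ‖ / ν = D / ν - (τ - t) := by
    rw [hyθ, show P.γ b - ((1 - θ) • z t + θ • P.γ b) = (1 - θ) • (P.γ b - z t) by module,
      norm_smul, Real.norm_of_nonneg (by linarith [hθ.2]), ← hD, hθd]
    field_simp
  have h12 : min (b - σi t) (σj t - b) - (τ - t) ≤ min (b - σi τ) (σj τ - b) := by
    rw [← min_sub_sub_right]
    exact min_le_min (by linarith) (by linarith)
  have hzτ : z τ ∉ interior P.body := fun h => hball h1 (interior_subset h)
  obtain ⟨h13, h14⟩ := P.abs_val_sub_le ν hν hν1 h3 h9 fun w hw hwi =>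
    hball ((convex_ball _ _).segment_subset h1 h2 hw) (interior_subset hwi)
  rw [abs_le] at h13 h14
  have h15 := P.frameV_le_add ν hν hν1 (si := σi τ) (sj := σj τ) (si' := σi τ) (sj' := σj τ)
    (η := 0) hzτ h3 h7 h9 (r := ‖z τ - y τ‖ / ν) (by linarith) (by linarith) le_rfl
    (by linarith) (by linarith)
  simp only [Pi.add_apply]
  rw [hyt, sub_self, norm_zero, zero_div, add_zero]
  linarith

/-! ### Invariants along a play. -/

namespace Play

variable {P ν} {si₀ sj₀ : ℝ} {x₀ : Plane} (p : Play P ν si₀ sj₀ x₀)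

theorem zero_mem : (0 : ℝ) ∈ Icc 0 p.tF := ⟨le_rfl, p.tF_nonneg⟩

theorem tF_mem : p.tF ∈ Icc 0 p.tF := ⟨p.tF_nonneg, le_rfl⟩

theorem si_zero : p.si 0 = si₀ := by simp [p.si_eq 0 p.zero_mem]

theorem sj_zero : p.sj 0 = sj₀ := by simp [p.sj_eq 0 p.zero_mem]

theorem x_zero : p.x 0 = x₀ := by simp [p.x_eq 0 p.zero_mem]

theorem norm_x_sub_le {r s : ℝ} (hr : r ∈ Icc 0 p.tF) (hs : s ∈ Icc 0 p.tF) (hrs : r ≤ s) :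
    ‖p.x r - p.x s‖ ≤ ν * (s - r) := by
  rw [p.x_eq r hr, p.x_eq s hs, add_sub_add_left_eq_sub]
  exact norm_integral_sub_integral_le p.measurable_u p.u_le hrs

theorem abs_si_sub_le {r s : ℝ} (hr : r ∈ Icc 0 p.tF) (hs : s ∈ Icc 0 p.tF) (hrs : r ≤ s) :
    |p.si r - p.si s| ≤ s - r := by
  rw [p.si_eq r hr, p.si_eq s hs, add_sub_add_left_eq_sub, ← one_mul (s - r)]
  exact norm_integral_sub_integral_le p.measurable_ωi p.ωi_le hrs

theorem abs_sj_sub_le {r s : ℝ} (hr : r ∈ Icc 0 p.tF) (hs : s ∈ Icc 0 p.tF) (hrs : r ≤ s) :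
    |p.sj r - p.sj s| ≤ s - r := by
  rw [p.sj_eq r hr, p.sj_eq s hs, add_sub_add_left_eq_sub, ← one_mul (s - r)]
  exact norm_integral_sub_integral_le p.measurable_ωj p.ωj_le hrs

theorem continuousOn_x : ContinuousOn p.x (Icc 0 p.tF) := by
  refine ContinuousOn.congr (f := fun t => x₀ + ∫ r in (0 : ℝ)..t, p.u r) ?_ p.x_eq
  exact (continuous_const.add (intervalIntegral.continuous_primitive
    (fun a b => intervalIntegrable_of_norm_le p.measurable_u p.u_le a b) 0)).continuousOn

theorem continuousOn_si : ContinuousOn p.si (Icc 0 p.tF) := by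
  refine ContinuousOn.congr (f := fun t => si₀ + ∫ r in (0 : ℝ)..t, p.ωi r) ?_ p.si_eq
  exact (continuous_const.add (intervalIntegral.continuous_primitive
    (fun a b => intervalIntegrable_of_norm_le p.measurable_ωi p.ωi_le a b) 0)).continuousOn

theorem continuousOn_sj : ContinuousOn p.sj (Icc 0 p.tF) := by
  refine ContinuousOn.congr (f := fun t => sj₀ + ∫ r in (0 : ℝ)..t, p.ωj r) ?_ p.sj_eq
  exact (continuous_const.add (intervalIntegral.continuous_primitive
    (fun a b => intervalIntegrable_of_norm_le p.measurable_ωj p.ωj_le a b) 0)).continuousOn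

theorem x_notMem_body {t : ℝ} (ht : t ∈ Ico 0 p.tF) : p.x t ∉ P.body := fun h =>
  p.not_over t ht (Or.inr h)

theorem x_notMem_interior (hx : x₀ ∉ interior P.body) {t : ℝ} (ht : t ∈ Icc 0 p.tF) :
    p.x t ∉ interior P.body := by
  rcases ht.2.lt_or_eq with h | rfl
  · exact fun h' => p.x_notMem_body ⟨ht.1, h⟩ (interior_subset h')
  · rcases p.tF_nonneg.eq_or_lt with h0 | h0
    · rw [← h0, p.x_zero]; exact hx
    · have hcl : p.tF ∈ closure (Ico 0 p.tF) := by
        rw [closure_Ico h0.ne]; exact p.tF_mem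
      have h1 := ((p.continuousOn_x p.tF p.tF_mem).mono Ico_subset_Icc_self).mem_closure hcl
        (t := (interior P.body)ᶜ) fun t ht' h' => p.x_notMem_body ht' (interior_subset h')
      rwa [isOpen_interior.isClosed_compl.closure_eq] at h1

/-- `affPos` moves continuously, and meeting a defender's position is capture; so before the end it
cannot leave the interval between the defenders. -/
theorem affPos_mem_of_frame (hν : 0 < ν) (hν1 : ν ≤ 1) (hx : x₀ ∉ interior P.body) {r s : ℝ}
    (hr : r ∈ Icc 0 p.tF) (hs : s ∈ Icc 0 p.tF) (he : ∀ q ∈ Icc r s, e ∉ P.visible (p.x q))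
    (h : P.affPos ν e (p.x r) ∈ Icc (p.si r) (p.sj r)) {q : ℝ} (hq : q ∈ Icc r s) :
    P.affPos ν e (p.x q) ∈ Icc (p.si q) (p.sj q) := by
  have hsub : Icc r q ⊆ Icc 0 p.tF := Icc_subset_Icc hr.1 (hq.2.trans hs.2)
  have hcont : ContinuousOn (fun t => P.affPos ν e (p.x t)) (Icc r q) :=
    (P.continuousOn_affPos ν hν hν1 e).comp (p.continuousOn_x.mono hsub) fun t ht =>
      ⟨p.x_notMem_interior hx (hsub ht), he t ⟨ht.1, ht.2.trans hq.2⟩⟩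
  have hcap : ∀ t ∈ Ico r q, P.affPos ν e (p.x t) ≠ p.si t ∧ P.affPos ν e (p.x t) ≠ p.sj t := by
    intro t ht
    have ht' := hsub (Ico_subset_Icc_self ht)
    have h1 := fun d => P.mem_afferent_iff ν (d := d) (p.x_notMem_interior hx ht')
      (he t ⟨ht.1, ht.2.le.trans hq.2⟩)
    have h2 := p.not_over t ⟨ht'.1, ht.2.trans_le (hq.2.trans hs.2)⟩
    constructor <;> intro h3 <;> refine h2 (Or.inl ?_)
    · exact Or.inl ((h1 _).2 ⟨0, by rw [h3]; simp⟩)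
    · exact Or.inr ((h1 _).2 ⟨0, by rw [h3]; simp⟩)
  constructor <;> by_contra! hcon
  · obtain ⟨t, ht, h0⟩ := intermediate_value_Icc' hq.1 (hcont.sub (p.continuousOn_si.mono hsub))
      (show (0 : ℝ) ∈ Icc _ _ from ⟨by simp only [Pi.sub_apply]; linarith,
        by simp only [Pi.sub_apply]; linarith [h.1]⟩)
    simp only [Pi.sub_apply] at h0
    rcases ht.2.lt_or_eq with h1 | rfl
    · exact (hcap t ⟨ht.1, h1⟩).1 (by linarith)
    · linarith
  · obtain ⟨t, ht, h0⟩ := intermediate_value_Icc hq.1 (hcont.sub (p.continuousOn_sj.mono hsub))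
      (show (0 : ℝ) ∈ Icc _ _ from ⟨by simp only [Pi.sub_apply]; linarith [h.2],
        by simp only [Pi.sub_apply]; linarith⟩)
    simp only [Pi.sub_apply] at h0
    rcases ht.2.lt_or_eq with h1 | rfl
    · exact (hcap t ⟨ht.1, h1⟩).2 (by linarith)
    · linarith

theorem affPos_mem_Ioo (hx : x₀ ∉ interior P.body) {t : ℝ} (ht : t ∈ Ico 0 p.tF)
    (he : e ∉ P.visible (p.x t)) (h : P.affPos ν e (p.x t) ∈ Icc (p.si t) (p.sj t)) :
    P.affPos ν e (p.x t) ∈ Ioo (p.si t) (p.sj t) := by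
  have h1 := fun d => P.mem_afferent_iff ν (d := d)
    (p.x_notMem_interior hx (Ico_subset_Icc_self ht)) he
  have h2 := p.not_over t ht
  refine ⟨lt_of_le_of_ne h.1 fun h3 => h2 (Or.inl (Or.inl ((h1 _).2 ⟨0, by rw [h3]; simp⟩))),
    lt_of_le_of_ne h.2 fun h3 => h2 (Or.inl (Or.inr ((h1 _).2 ⟨0, by rw [h3]; simp⟩)))⟩

/-- A property of the value that is preserved as long as the frame is fixed holds at all times. -/
theorem exists_frame_of_step (hν : 0 < ν) (hν1 : ν ≤ 1) (hx : x₀ ∉ interior P.body)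
    (Φ : ℝ → Prop)
    (hstep : ∀ e, ∀ r ∈ Icc 0 p.tF, ∀ s ∈ Icc 0 p.tF, r ≤ s →
      (∀ q ∈ Icc r s, e ∉ P.visible (p.x q) ∧ P.affPos ν e (p.x q) ∈ Icc (p.si q) (p.sj q)) →
      Φ (P.frameV ν e (p.si r) (p.sj r) (p.x r)) → Φ (P.frameV ν e (p.si s) (p.sj s) (p.x s)))
    (h0 : ∃ e, e ∉ P.visible x₀ ∧ P.affPos ν e x₀ ∈ Icc si₀ sj₀ ∧ Φ (P.frameV ν e si₀ sj₀ x₀)) :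
    ∃ e, e ∉ P.visible (p.x p.tF) ∧ P.affPos ν e (p.x p.tF) ∈ Icc (p.si p.tF) (p.sj p.tF) ∧
      Φ (P.frameV ν e (p.si p.tF) (p.sj p.tF) (p.x p.tF)) := by
  let Q : ℝ → Prop := fun t => ∃ e, e ∉ P.visible (p.x t) ∧
    P.affPos ν e (p.x t) ∈ Icc (p.si t) (p.sj t) ∧ Φ (P.frameV ν e (p.si t) (p.sj t) (p.x t))
  suffices h : Q 0 → Q p.tF by
    refine h ?_
    simpa only [Q, p.x_zero, p.si_zero, p.sj_zero] using h0
  refine rel_of_locally_rel (R := fun r s => Q r → Q s) p.tF_nonneg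
    (fun r s t _ _ _ _ h1 h2 => h2 ∘ h1) ?_
  intro t₀ ht₀
  obtain ⟨e₀, he₀⟩ := P.exists_notMem_visible (p.x_notMem_interior hx ht₀)
  obtain ⟨ε, hε, hball⟩ := Metric.eventually_nhds_iff.1 (eventually_nhdsWithin_iff.1
    ((p.continuousOn_x t₀ ht₀).eventually (P.eventually_notMem_visible he₀)))
  refine ⟨ε, hε, ?_⟩
  rintro r hr s hs hrs hr0 hs0 ⟨e₁, he₁, hd, hΦ⟩
  have hnv : ∀ q ∈ Icc r s, ∀ k : ℤ, e₀ + k * P.L ∉ P.visible (p.x q) := fun q hq k =>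
    P.add_int_mul_notMem_visible (hball (by
      rw [abs_lt] at hr0 hs0
      rw [Real.dist_eq, abs_lt]
      constructor <;> linarith [hq.1, hq.2]) ⟨hr.1.trans hq.1, hq.2.trans hs.2⟩) k
  -- The given frame is exchanged for a translate of the locally valid one with the same
  -- coordinates, so nothing in the property changes.
  obtain ⟨k, hk1, hk2, -, -, hk5⟩ := P.exists_frame_translate ν (p.x_notMem_interior hx hr)
    (by simpa using hnv r ⟨le_rfl, hrs⟩ 0) he₁
  rw [hk5] at hd
  rw [P.frameV_congr ν hk1 hk2] at hΦ
  have hq : ∀ q ∈ Icc r s, e₀ + k * P.L ∉ P.visible (p.x q) ∧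
      P.affPos ν (e₀ + k * P.L) (p.x q) ∈ Icc (p.si q) (p.sj q) := fun q hq =>
    ⟨hnv q hq k, p.affPos_mem_of_frame hν hν1 hx hr hs (fun q hq => hnv q hq k) hd hq⟩
  exact ⟨_, (hq s ⟨hrs, le_rfl⟩).1, (hq s ⟨hrs, le_rfl⟩).2, hstep _ r hr s hs hrs hq hΦ⟩

theorem abs_val_sub_le (hν : 0 < ν) (hν1 : ν ≤ 1) (hx : x₀ ∉ interior P.body) {r s : ℝ}
    (hr : r ∈ Icc 0 p.tF) (hs : s ∈ Icc 0 p.tF) (hrs : r ≤ s)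
    (he : ∀ q ∈ Icc r s, e ∉ P.visible (p.x q)) :
    |P.leftVal ν e (p.x r) - P.leftVal ν e (p.x s)| ≤ s - r ∧
      |P.rightVal ν e (p.x r) - P.rightVal ν e (p.x s)| ≤ s - r := by
  have hsub : Icc r s ⊆ Icc 0 p.tF := Icc_subset_Icc hr.1 hs.2
  exact P.abs_val_sub_le_of_path ν hν hν1 hrs
    (fun a ha b hb hab => p.norm_x_sub_le (hsub ha) (hsub hb) hab)
    (fun q hq => p.x_notMem_body ⟨hr.1.trans hq.1, hq.2.trans_le hs.2⟩)
    (p.x_notMem_interior hx hs) he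

theorem si_eq_of_pincer (hp : p.DefendersUse pincer) {t : ℝ} (ht : t ∈ Icc 0 p.tF) :
    p.si t = si₀ + t := by
  rw [p.si_eq t ht, intervalIntegral.integral_congr_ae (g := fun _ => (1 : ℝ))]
  · simp
  · filter_upwards [hp] with r hr hrt
    rw [uIoc_of_le ht.1] at hrt
    exact congrArg Prod.fst (hr ⟨hrt.1.le, hrt.2.trans ht.2⟩)

theorem sj_eq_of_pincer (hp : p.DefendersUse pincer) {t : ℝ} (ht : t ∈ Icc 0 p.tF) :
    p.sj t = sj₀ - t := by
  rw [p.sj_eq t ht, intervalIntegral.integral_congr_ae (g := fun _ => (-1 : ℝ))]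
  · simp; ring
  · filter_upwards [hp] with r hr hrt
    rw [uIoc_of_le ht.1] at hrt
    exact congrArg Prod.snd (hr ⟨hrt.1.le, hrt.2.trans ht.2⟩)

/-- In time s - r the intruder raises the value by at most s - r, and the closing defenders lower it
by the same amount (`η := -(s - r)`). -/
theorem frameV_antitone_of_pincer (hν : 0 < ν) (hν1 : ν ≤ 1) (hx : x₀ ∉ interior P.body)
    (hp : p.DefendersUse pincer) {r s : ℝ}
    (hr : r ∈ Icc 0 p.tF) (hs : s ∈ Icc 0 p.tF) (hrs : r ≤ s)
    (he : ∀ q ∈ Icc r s, e ∉ P.visible (p.x q)) :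
    P.frameV ν e (p.si s) (p.sj s) (p.x s) ≤ P.frameV ν e (p.si r) (p.sj r) (p.x r) := by
  obtain ⟨h1, h2⟩ := p.abs_val_sub_le hν hν1 hx hr hs hrs he
  rw [abs_le] at h1 h2
  rw [p.si_eq_of_pincer hp hr, p.si_eq_of_pincer hp hs, p.sj_eq_of_pincer hp hr,
    p.sj_eq_of_pincer hp hs]
  have := P.frameV_le_add ν hν hν1 (si := si₀ + r) (sj := sj₀ - r) (si' := si₀ + s)
    (sj' := sj₀ - s) (r := s - r) (η := -(s - r)) (p.x_notMem_interior hx hr)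
    (he r ⟨le_rfl, hrs⟩) (p.x_notMem_interior hx hs) (he s ⟨hrs, le_rfl⟩) (by linarith)
    (by linarith) (by rw [div_le_iff₀' hν]; exact p.norm_x_sub_le hr hs hrs)
    (by linarith) (by linarith)
  linarith

/-- The constant 2 is one unit for the intruder and one for the defenders. -/
theorem frameV_lipschitz (hν : 0 < ν) (hν1 : ν ≤ 1) (hx : x₀ ∉ interior P.body) {r s : ℝ}
    (hr : r ∈ Icc 0 p.tF) (hs : s ∈ Icc 0 p.tF) (he : ∀ q ∈ Icc r s, e ∉ P.visible (p.x q)) :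
    LipschitzOnWith 2 (fun t => P.frameV ν e (p.si t) (p.sj t) (p.x t)) (Icc r s) := by
  have hsub : Icc r s ⊆ Icc 0 p.tF := Icc_subset_Icc hr.1 hs.2
  have main : ∀ a ∈ Icc r s, ∀ b ∈ Icc r s, a ≤ b →
      |P.frameV ν e (p.si a) (p.sj a) (p.x a) - P.frameV ν e (p.si b) (p.sj b) (p.x b)| ≤
        2 * (b - a) := by
    intro a ha b hb hab
    obtain ⟨h1, h2⟩ := p.abs_val_sub_le hν hν1 hx (hsub ha) (hsub hb) hab fun q hq =>
      he q ⟨ha.1.trans hq.1, hq.2.trans hb.2⟩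
    have h3 := p.abs_si_sub_le (hsub ha) (hsub hb) hab
    have h4 := p.abs_sj_sub_le (hsub ha) (hsub hb) hab
    have h5 := p.norm_x_sub_le (hsub ha) (hsub hb) hab
    rw [← div_le_iff₀' hν] at h5
    have h6 := h5
    rw [norm_sub_rev] at h6
    rw [abs_le] at h1 h2 h3 h4
    have hia := p.x_notMem_interior hx (hsub ha)
    have hib := p.x_notMem_interior hx (hsub hb)
    have k1 := P.frameV_le_add ν hν hν1 (si := p.si a) (sj := p.sj a) (si' := p.si b)
      (sj' := p.sj b) (r := b - a) (η := b - a) hia (he a ha) hib (he b hb) (by linarith)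
      (by linarith) h5 (by linarith) (by linarith)
    have k2 := P.frameV_le_add ν hν hν1 (si := p.si b) (sj := p.sj b) (si' := p.si a)
      (sj' := p.sj a) (r := b - a) (η := b - a) hib (he b hb) hia (he a ha) (by linarith)
      (by linarith) h6 (by linarith) (by linarith)
    rw [abs_le]
    constructor <;> linarith
  refine LipschitzOnWith.of_dist_le_mul fun a ha b hb => ?_
  rw [Real.dist_eq, Real.dist_eq, NNReal.coe_ofNat]
  rcases le_total a b with h | h
  · rw [abs_sub_comm a b, abs_of_nonneg (sub_nonneg.2 h)]; exact main a ha b hb h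
  · rw [abs_sub_comm, abs_of_nonneg (sub_nonneg.2 h)]; exact main b hb a ha h

theorem ae_hasDerivAt_x : ∀ᵐ t, t ∈ Ioo 0 p.tF → HasDerivAt p.x (p.u t) t := by
  have h := (intervalIntegrable_of_norm_le p.measurable_u p.u_le 0 p.tF).ae_hasDerivAt_integral
  filter_upwards [h] with t ht htF
  have h1 := ht (by rw [uIcc_of_le p.tF_nonneg]; exact Ioo_subset_Icc_self htF) 0 (by simp)
  refine (h1.const_add x₀).congr_of_eventuallyEq ?_
  filter_upwards [Icc_mem_nhds htF.1 htF.2] with s hs using p.x_eq s hs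

theorem frameV_monotone_of_intruderStar (hν : 0 < ν) (hν1 : ν ≤ 1) (hx : x₀ ∉ interior P.body)
    (hp : p.IntruderUses (P.intruderStar ν)) {r s : ℝ}
    (hr : r ∈ Icc 0 p.tF) (hs : s ∈ Icc 0 p.tF) (hrs : r ≤ s)
    (he : ∀ q ∈ Icc r s, e ∉ P.visible (p.x q) ∧
      P.affPos ν e (p.x q) ∈ Icc (p.si q) (p.sj q)) :
    P.frameV ν e (p.si r) (p.sj r) (p.x r) ≤ P.frameV ν e (p.si s) (p.sj s) (p.x s) := by
  refine (p.frameV_lipschitz hν hν1 hx hr hs fun q hq => (he q hq).1).le_of_ae_deriv_nonneg hrs ?_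
  filter_upwards [p.ae_hasDerivAt_x, hp] with t h1 h2 ht m hm
  have ht' : t ∈ Ioo 0 p.tF := ⟨hr.1.trans_lt ht.1, ht.2.trans_le hs.2⟩
  have htI := Ioo_subset_Icc_self ht'
  -- Strictness, from the absence of capture, makes the feedback point the frame's optimal point
  -- even if the defenders are a full turn apart.
  have h3 := p.affPos_mem_Ioo hx (Ioo_subset_Ico_self ht') (he t (Ioo_subset_Icc_self ht)).1
    (he t (Ioo_subset_Icc_self ht)).2
  have hxt := p.x_notMem_interior hx htI
  obtain ⟨-, h4⟩ := P.V_eq_frameV ν hxt (he t (Ioo_subset_Icc_self ht)).1 (p.sides t htI).2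
    (he t (Ioo_subset_Icc_self ht)).2 (Or.inr h3)
  have h5 := h1 ht'
  rw [h2 htI, intruderStar, h4] at h5
  refine P.nonneg_of_hasDerivAt_frameV ν hν hν1 (σi := p.si) (σj := p.sj) (z := p.x)
    (p.x_notMem_body (Ioo_subset_Ico_self ht')) (he t (Ioo_subset_Icc_self ht)).1 h5 ?_ ?_ hm
  · filter_upwards [Ioo_mem_nhdsGT ht'.2] with τ hτ
    have := abs_le.1 (p.abs_si_sub_le htI ⟨ht'.1.le.trans hτ.1.le, hτ.2.le⟩ hτ.1.le)
    linarith
  · filter_upwards [Ioo_mem_nhdsGT ht'.2] with τ hτ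
    have := abs_le.1 (p.abs_sj_sub_le htI ⟨ht'.1.le.trans hτ.1.le, hτ.2.le⟩ hτ.1.le)
    linarith

end Play

end Target

/-! ### Termination and payoff bounds. -/

namespace Target

variable (P : Target) (ν : ℝ)

variable {x : Plane} {e : ℝ}

/-- Equality modulo L becomes a continuous equation, so that not being captured is an open
condition. -/
theorem mem_afferent_iff_cos (hx : x ∉ interior P.body) (he : e ∉ P.visible x) {d : ℝ} :
    x ∈ P.afferent ν d ↔ Real.cos (2 * Real.pi * (d - P.affPos ν e x) / P.L) = 1 := by
  have hL := P.L_pos.ne'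
  have hpi := Real.pi_ne_zero
  rw [P.mem_afferent_iff ν hx he, Real.cos_eq_one_iff]
  refine exists_congr fun k => ?_
  rw [eq_div_iff hL]
  constructor
  · rintro rfl; ring
  · intro h
    have h1 : 2 * Real.pi * (d - (P.affPos ν e x + k * P.L)) = 0 := by linarith
    rcases mul_eq_zero.1 h1 with h2 | h2
    · exact absurd h2 (by positivity)
    · linarith

theorem isClosed_terminal (hν : 0 < ν) (hν1 : ν ≤ 1) {σi σj : ℝ → ℝ} {z : ℝ → Plane}
    (hi : Continuous σi) (hj : Continuous σj) (hz : Continuous z) :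
    IsClosed {t | P.Terminal ν (σi t) (σj t) (z t)} := by
  rw [← isOpen_compl_iff, isOpen_iff_mem_nhds]
  intro t ht
  have hzt : z t ∉ P.body := fun h => ht (Or.inr h)
  have hzi : z t ∉ interior P.body := fun h => hzt (interior_subset h)
  obtain ⟨e, he⟩ := P.exists_notMem_visible hzi
  have h1 : ∀ᶠ w in 𝓝 (z t), w ∉ P.body := P.isClosed_body.isOpen_compl.mem_nhds hzt
  have h2 := P.eventually_notMem_visible he
  have haff : ContinuousAt (P.affPos ν e) (z t) :=
    (P.continuousOn_affPos ν hν hν1 e).continuousAt (by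
      filter_upwards [h1, h2] with w hw hw' using ⟨fun h => hw (interior_subset h), hw'⟩)
  have haff' : ContinuousAt (fun τ => P.affPos ν e (z τ)) t :=
    ContinuousAt.comp (f := z) haff hz.continuousAt
  have key : ∀ σ : ℝ → ℝ, Continuous σ → z t ∉ P.afferent ν (σ t) →
      ∀ᶠ τ in 𝓝 t, Real.cos (2 * Real.pi * (σ τ - P.affPos ν e (z τ)) / P.L) ≠ 1 := by
    intro σ hσ h
    rw [P.mem_afferent_iff_cos ν hzi he] at h
    have hc : ContinuousAt
        (fun τ => Real.cos (2 * Real.pi * (σ τ - P.affPos ν e (z τ)) / P.L)) t := by fun_prop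
    exact hc.eventually_ne h
  filter_upwards [hz.continuousAt.eventually h1, hz.continuousAt.eventually h2,
    key σi hi fun h => ht (Or.inl (Or.inl h)), key σj hj fun h => ht (Or.inl (Or.inr h))]
    with τ k1 k2 k3 k4
  have k5 : z τ ∉ interior P.body := fun h => k1 (interior_subset h)
  rintro ((h | h) | h)
  · exact k3 ((P.mem_afferent_iff_cos ν k5 k2).1 h)
  · exact k4 ((P.mem_afferent_iff_cos ν k5 k2).1 h)
  · exact k1 h

namespace Play

variable {P ν} {si sj : ℝ} {x₀ : Plane} (p : Play P ν si sj x₀)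

theorem exists_frame_le_of_pincer (hν : 0 < ν) (hν1 : ν ≤ 1) (hL : sj < si + P.L)
    (hx : x₀ ∈ P.gameSpace ν si sj) (hp : p.DefendersUse pincer) :
    ∃ e, e ∉ P.visible (p.x p.tF) ∧ P.affPos ν e (p.x p.tF) ∈ Icc (p.si p.tF) (p.sj p.tF) ∧
      P.frameV ν e (p.si p.tF) (p.sj p.tF) (p.x p.tF) ≤ P.V ν si sj x₀ := by
  have hxi := P.notMem_interior_of_mem_gameSpace ν hx
  obtain ⟨e, he, hd⟩ := P.exists_frame_of_mem_gameSpace ν hx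
  exact p.exists_frame_of_step hν hν1 hxi (fun w => w ≤ P.V ν si sj x₀)
    (fun e r hr s hs hrs h hV => (p.frameV_antitone_of_pincer hν hν1 hxi hp hr hs hrs
      fun q hq => (h q hq).1).trans hV)
    ⟨e, he, hd, (P.V_eq_frameV ν hxi he hL.le hd (Or.inl hL)).1.ge⟩

theorem exists_frame_ge_of_intruderStar (hν : 0 < ν) (hν1 : ν ≤ 1) (hL : sj < si + P.L)
    (hx : x₀ ∈ P.gameSpace ν si sj) (hp : p.IntruderUses (P.intruderStar ν)) :
    ∃ e, e ∉ P.visible (p.x p.tF) ∧ P.affPos ν e (p.x p.tF) ∈ Icc (p.si p.tF) (p.sj p.tF) ∧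
      P.V ν si sj x₀ ≤ P.frameV ν e (p.si p.tF) (p.sj p.tF) (p.x p.tF) := by
  have hxi := P.notMem_interior_of_mem_gameSpace ν hx
  obtain ⟨e, he, hd⟩ := P.exists_frame_of_mem_gameSpace ν hx
  exact p.exists_frame_of_step hν hν1 hxi (fun w => P.V ν si sj x₀ ≤ w)
    (fun e r hr s hs hrs h hV =>
      hV.trans (p.frameV_monotone_of_intruderStar hν hν1 hxi hp hr hs hrs h))
    ⟨e, he, hd, (P.V_eq_frameV ν hxi he hL.le hd (Or.inl hL)).1.le⟩

/-- At a breach at s, min (s - si) (sj - s) is at most the current value, hence at most 0. So a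
defender is exactly at s, and s lies on the afferent surface of this defender. -/
theorem endsInCapture_of_pincer (hν : 0 < ν) (hν1 : ν ≤ 1) (hL : sj < si + P.L)
    (hx : x₀ ∈ P.gameSpace ν si sj) (hV : P.V ν si sj x₀ ≤ 0) (hp : p.DefendersUse pincer)
    (h : p.Ends) : p.EndsInCapture := by
  rcases h with h | h
  · exact h
  have hxt := p.x_notMem_interior (P.notMem_interior_of_mem_gameSpace ν hx) p.tF_mem
  obtain ⟨e, he, hd, hle⟩ := p.exists_frame_le_of_pincer hν hν1 hL hx hp
  have haff := fun d => P.mem_afferent_iff ν (d := d) hxt he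
  obtain ⟨s, hs, hsx⟩ := P.exists_Ioo_γ_eq hxt h he
  have hs' := Ioo_subset_Icc_self hs
  have h1 : s ∈ P.visible (p.x p.tF) := hsx ▸ P.self_mem_visible s
  have h2 : P.affPos ν e (p.x p.tF) = s := by
    rw [← hsx] at he ⊢
    obtain ⟨h2, h3⟩ := P.val_γ ν hν hν1 he hs'
    rw [affPos, h2, h3, add_self_div_two]
  have h3 := (P.le_frameV ν (si := p.si p.tF) (sj := p.sj p.tF) hν hν1 hxt he h1 hs').trans hle
  rw [hsx, sub_self, norm_zero, zero_div, sub_zero] at h3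
  rw [h2] at hd
  rcases min_le_iff.1 (h3.trans hV) with h4 | h4
  · exact Or.inl ((haff _).2 ⟨0, by rw [h2]; push_cast; linarith [hd.1]⟩)
  · exact Or.inr ((haff _).2 ⟨0, by rw [h2]; push_cast; linarith [hd.2]⟩)

theorem payoff_le_of_pincer (hν : 0 < ν) (hν1 : ν ≤ 1) (hL : sj < si + P.L)
    (hx : x₀ ∈ P.gameSpace ν si sj) (hV : P.V ν si sj x₀ ≤ 0) (hp : p.DefendersUse pincer) :
    p.payoff ≤ ν * P.V ν si sj x₀ := by
  have hxt := p.x_notMem_interior (P.notMem_interior_of_mem_gameSpace ν hx) p.tF_mem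
  obtain ⟨e, he, hd, hle⟩ := p.exists_frame_le_of_pincer hν hν1 hL hx hp
  have hLt : p.sj p.tF < p.si p.tF + P.L := by
    rw [p.si_eq_of_pincer hp p.tF_mem, p.sj_eq_of_pincer hp p.tF_mem]
    linarith [p.tF_nonneg]
  rw [← (P.V_eq_frameV ν hxt he hLt.le hd (Or.inl hLt)).1] at hle
  rw [payoff, P.dBar_eq ν hν hν1 hLt (p.sides _ p.tF_mem).1
    (P.mem_gameSpace_of_frame ν hxt he hd) (hle.trans hV), neg_neg]
  exact mul_le_mul_of_nonneg_left hle hν.le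

theorem le_payoff_of_intruderStar (hν : 0 < ν) (hν1 : ν ≤ 1) (hL : sj < si + P.L)
    (hx : x₀ ∈ P.gameSpace ν si sj) (hV : P.V ν si sj x₀ ≤ 0)
    (hp : p.IntruderUses (P.intruderStar ν)) : ν * P.V ν si sj x₀ ≤ p.payoff := by
  have hxt := p.x_notMem_interior (P.notMem_interior_of_mem_gameSpace ν hx) p.tF_mem
  obtain ⟨e, he, hd, hle⟩ := p.exists_frame_ge_of_intruderStar hν hν1 hL hx hp
  exact P.mul_le_neg_dBar ν hν hν1 hxt he (p.sides _ p.tF_mem).2 hd hV hle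

variable (P) in
/-- The play of the pincer maneuver against a given control of the intruder. -/
def ofControl {u : ℝ → Plane} (hu : Measurable u) (hu' : ∀ t, ‖u t‖ ≤ ν)
    (hL : sj ≤ si + P.L) (x₀ : Plane) {T : ℝ} (hT : 0 ≤ T) (hT' : T ≤ (sj - si) / 2)
    (h : ∀ t ∈ Ico 0 T, ¬ P.Terminal ν (si + t) (sj - t) (x₀ + ∫ r in (0 : ℝ)..t, u r)) :
    Play P ν si sj x₀ where
  tF := T
  tF_nonneg := hT
  ωi _ := 1
  ωj _ := -1
  u := u
  measurable_ωi := measurable_const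
  measurable_ωj := measurable_const
  measurable_u := hu
  ωi_le _ := by simp
  ωj_le _ := by simp
  u_le := hu'
  si t := si + t
  sj t := sj - t
  x t := x₀ + ∫ r in (0 : ℝ)..t, u r
  si_eq t _ := by simp
  sj_eq t _ := by simp; ring
  x_eq _ _ := rfl
  sides t ht := ⟨by linarith [ht.2], by linarith [ht.1]⟩
  not_over := h

theorem exists_pincer_play (hν : 0 < ν) (hν1 : ν ≤ 1) (hij : si ≤ sj) (hL : sj < si + P.L)
    (hx : x₀ ∈ P.gameSpace ν si sj) {u : ℝ → Plane} (hu : Measurable u) (hu' : ∀ t, ‖u t‖ ≤ ν) :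
    ∃ p : Play P ν si sj x₀, p.u = u ∧ p.DefendersUse pincer ∧ p.Ends := by
  have hxi := P.notMem_interior_of_mem_gameSpace ν hx
  have hT : 0 ≤ (sj - si) / 2 := by linarith
  set A := {t | P.Terminal ν (si + t) (sj - t) (x₀ + ∫ r in (0 : ℝ)..t, u r)} with hA
  have hAc : IsClosed A := P.isClosed_terminal ν hν hν1 (by fun_prop) (by fun_prop)
    (continuous_const.add (intervalIntegral.continuous_primitive
      (fun a b => intervalIntegrable_of_norm_le hu hu' a b) 0))
  -- A game not over before the defenders meet has `affPos` between two equal positions then, which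
  -- is capture. The play is stopped at the first terminal time.
  have hne : (Icc 0 ((sj - si) / 2) ∩ A).Nonempty := by
    by_contra hcon
    let p := ofControl P hu hu' hL.le x₀ hT le_rfl fun t ht h =>
      hcon ⟨t, Ico_subset_Icc_self ht, h⟩
    obtain ⟨e₀, he₀, hd₀⟩ := P.exists_frame_of_mem_gameSpace ν hx
    obtain ⟨e, he, hd, -⟩ := p.exists_frame_of_step hν hν1 hxi (fun _ => True)
      (fun _ _ _ _ _ _ _ _ => trivial) ⟨e₀, he₀, hd₀, trivial⟩
    have hxt := p.x_notMem_interior hxi p.tF_mem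
    refine hcon ⟨p.tF, p.tF_mem, Or.inl (Or.inl ((P.mem_afferent_iff ν hxt he).2 ⟨0, ?_⟩))⟩
    have h1 : p.si p.tF ≤ _ := hd.1
    have h2 : _ ≤ p.sj p.tF := hd.2
    have h3 : p.si p.tF = si + (sj - si) / 2 := rfl
    have h4 : p.sj p.tF = sj - (sj - si) / 2 := rfl
    have h5 : si + p.tF = si + (sj - si) / 2 := rfl
    rw [h5]
    push_cast
    linarith
  obtain ⟨T, ⟨hT0, hTA⟩, hleast⟩ := (isCompact_Icc.inter_right hAc).exists_isLeast hne
  exact ⟨ofControl P hu hu' hL.le x₀ hT0.1 hT0.2 fun t ht h =>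
    (hleast ⟨⟨ht.1, ht.2.le.trans hT0.2⟩, h⟩).not_gt ht.2, rfl, ae_of_all _ fun _ _ => rfl, hTA⟩

/-- Against the pincer maneuver, the initial direction of the strategy `intruderStar` stays
optimal. -/
theorem intruderStar_eq_of_pincer (hν : 0 < ν) (hν1 : ν ≤ 1) (hL : sj < si + P.L)
    (hx : x₀ ∈ P.gameSpace ν si sj) (hp : p.DefendersUse pincer)
    (hu : p.u = fun _ => P.intruderStar ν 0 si sj x₀) {t : ℝ} (ht : t ∈ Ioo 0 p.tF) :
    P.intruderStar ν t (p.si t) (p.sj t) (p.x t) = P.intruderStar ν 0 si sj x₀ := by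
  have hxi := P.notMem_interior_of_mem_gameSpace ν hx
  obtain ⟨e, he, hd⟩ := P.exists_frame_of_mem_gameSpace ν hx
  obtain ⟨-, hopt⟩ := P.V_eq_frameV ν hxi he hL.le hd (Or.inl hL)
  obtain ⟨hb, hbe⟩ := P.optPos_mem_visible ν (si := si) (sj := sj) hxi he
  have htI := Ioo_subset_Icc_self ht
  have hx0 : x₀ ∉ P.body := by
    have := p.x_notMem_body ⟨le_rfl, ht.1.trans ht.2⟩
    rwa [p.x_zero] at this
  have hV0 : P.frameV ν e si sj x₀ =
      min (P.optPos ν e si sj x₀ - si) (sj - P.optPos ν e si sj x₀) -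
        ‖P.γ (P.optPos ν e si sj x₀) - x₀‖ / ν := rfl
  set u₀ := P.intruderStar ν 0 si sj x₀ with hu₀
  rw [intruderStar, hopt] at hu₀
  set b := P.optPos ν e si sj x₀
  set D := ‖P.γ b - x₀‖ with hD
  have hD0 : 0 < D := by
    rw [hD, norm_pos_iff, sub_ne_zero]; rintro h; exact hx0 (h ▸ P.γ_mem b)
  have hun : ‖u₀‖ = ν := by
    rw [hu₀, norm_smul, Real.norm_of_nonneg (by positivity), ← hD, div_mul_cancel₀ _ hD0.ne']
  have hxs : ∀ s ∈ Icc 0 p.tF, p.x s = x₀ + s • u₀ := fun s hs => by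
    rw [p.x_eq s hs, hu]; simp
  have hseg : ∀ s ∈ Icc 0 p.tF, p.x s = (1 - s * (ν / D)) • x₀ + (s * (ν / D)) • P.γ b :=
    fun s hs => by rw [hxs s hs, hu₀]; module
  -- the intruder has not yet arrived
  have htD : t * ν < D := by
    by_contra! hcon
    have h1 : D / ν ≤ t := by rwa [div_le_iff₀ hν]
    have h2 := div_pos hD0 hν
    have h3 := p.x_notMem_body ⟨h2.le, h1.trans_lt ht.2⟩
    rw [hseg _ ⟨h2.le, h1.trans ht.2.le⟩, div_mul_div_cancel₀ hν.ne', div_self hD0.ne'] at h3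
    exact h3 (by simpa using P.γ_mem b)
  have hθ : ∀ s ∈ Icc 0 t, s * (ν / D) ∈ Ico (0 : ℝ) 1 := fun s hs => by
    refine ⟨mul_nonneg hs.1 (by positivity), ?_⟩
    rw [← mul_div_assoc, div_lt_one hD0]
    nlinarith [hs.2]
  have hsub : Icc 0 t ⊆ Icc 0 p.tF := Icc_subset_Icc_right ht.2.le
  have hvis : ∀ s ∈ Icc 0 t, P.visible (p.x s) ⊆ P.visible x₀ := fun s hs => by
    rw [hseg s (hsub hs)]
    exact P.visible_subset_of_mem_segment (P.γ_mem b) (hθ s hs)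
  have hes : ∀ s ∈ Icc 0 t, e ∉ P.visible (p.x s) := fun s hs h => he (hvis s hs h)
  have htt : t ∈ Icc 0 t := ⟨ht.1.le, le_rfl⟩
  have hxt := p.x_notMem_interior hxi htI
  have hdt := p.affPos_mem_of_frame hν hν1 hxi p.zero_mem htI hes
    (by rwa [p.x_zero, p.si_zero, p.sj_zero]) htt
  have hsi := p.si_eq_of_pincer hp htI
  have hsj := p.sj_eq_of_pincer hp htI
  have hLt : p.sj t < p.si t + P.L := by rw [hsi, hsj]; linarith [ht.1]
  obtain ⟨-, hopt'⟩ := P.V_eq_frameV ν hxt (hes t htt) hLt.le hdt (Or.inl hLt)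
  obtain ⟨hc, hce⟩ := P.optPos_mem_visible ν (si := p.si t) (sj := p.sj t) hxt (hes t htt)
  have hle := p.frameV_antitone_of_pincer hν hν1 hxi hp p.zero_mem htI ht.1.le hes
  rw [p.x_zero, p.si_zero, p.sj_zero] at hle
  have hVt : P.frameV ν e (p.si t) (p.sj t) (p.x t) =
      min (P.optPos ν e (p.si t) (p.sj t) (p.x t) - p.si t)
        (p.sj t - P.optPos ν e (p.si t) (p.sj t) (p.x t)) -
        ‖P.γ (P.optPos ν e (p.si t) (p.sj t) (p.x t)) - p.x t‖ / ν := rfl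
  rw [intruderStar, hopt']
  set c := P.optPos ν e (p.si t) (p.sj t) (p.x t)
  have hbt : b ∈ P.visible (p.x t) := by
    rw [hseg t htI]; exact (P.mem_visible_segment hb (Ico_subset_Icc_self (hθ t htt))).2
  -- Under the pincer maneuver the score of `b` is unchanged, so the value at time `t` is at least
  -- the initial one. The initial score of `c` is at most the initial value; together these give
  -- `h4`.
  have h1 := P.le_frameV ν (si := p.si t) (sj := p.sj t) hν hν1 hxt (hes t htt) hbt
    (Ioo_subset_Icc_self hbe)
  have h2 : ‖P.γ b - p.x t‖ / ν = D / ν - t := by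
    rw [hseg t htI, show P.γ b - ((1 - t * (ν / D)) • x₀ + (t * (ν / D)) • P.γ b) =
      (1 - t * (ν / D)) • (P.γ b - x₀) by module, norm_smul,
      Real.norm_of_nonneg (by linarith [(hθ t htt).2]), ← hD]
    field_simp
  have hmin : ∀ a : ℝ, min (a - p.si t) (p.sj t - a) = min (a - si) (sj - a) - t := fun a => by
    rw [hsi, hsj, ← min_sub_sub_right]
    congr 1 <;> ring
  rw [hmin, h2] at h1
  rw [hmin] at hVt
  have h3 := P.le_frameV ν (si := si) (sj := sj) hν hν1 hxi he (hvis t htt hc)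
    (Ioo_subset_Icc_self hce)
  -- the way to the current optimal point is along the initial direction
  have h4 : t + ‖P.γ c - p.x t‖ / ν ≤ ‖P.γ c - x₀‖ / ν := by linarith
  have h5 : ν * t + ‖P.γ c - p.x t‖ ≤ ‖P.γ c - x₀‖ := by
    have := mul_le_mul_of_nonneg_left h4 hν.le
    rwa [mul_add, mul_div_cancel₀ _ hν.ne', mul_div_cancel₀ _ hν.ne'] at this
  have hw : P.γ c - x₀ = t • u₀ + (P.γ c - p.x t) := by rw [hxs t htI]; abel
  have htu : ‖t • u₀‖ = ν * t := by
    rw [norm_smul, hun, Real.norm_of_nonneg ht.1.le, mul_comm]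
  -- Equality in the triangle inequality: `c` may differ from `b`, but it lies straight ahead.
  have hray : SameRay ℝ (t • u₀) (P.γ c - p.x t) := by
    rw [sameRay_iff_norm_add]
    refine le_antisymm (norm_add_le _ _) ?_
    rw [htu, ← hw]
    exact h5
  rw [sameRay_iff_norm_smul_eq, htu] at hray
  have hn : 0 < ‖P.γ c - p.x t‖ := by
    rw [norm_pos_iff, sub_ne_zero]
    rintro h
    exact p.x_notMem_body (Ioo_subset_Ico_self ht) (h ▸ P.γ_mem c)
  have h6 : ν • (P.γ c - p.x t) = ‖P.γ c - p.x t‖ • u₀ := by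
    have h7 : t • (ν • (P.γ c - p.x t)) = t • (‖P.γ c - p.x t‖ • u₀) := by
      rw [smul_smul, mul_comm, hray, smul_comm]
    exact smul_right_injective _ ht.1.ne' h7
  rw [div_eq_inv_mul, mul_smul, h6, smul_smul, inv_mul_cancel₀ hn.ne', one_smul]

end Play

/-! ### Equilibrium and value. -/

theorem norm_intruderStar_le (hν : 0 < ν) (t si sj : ℝ) (x : Plane) :
    ‖P.intruderStar ν t si sj x‖ ≤ ν := by
  rw [intruderStar, norm_smul, Real.norm_of_nonneg (by positivity)]
  rcases (norm_nonneg (P.γ (P.sOpt ν si sj x) - x)).eq_or_lt with h | h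
  · rw [← h, mul_zero]; exact hν.le
  · rw [div_mul_cancel₀ _ h.ne']

/-- No differential equation with discontinuous feedback has to be solved: the constant initial
velocity agrees with the feedback except perhaps at the two end times. -/
theorem exists_mem_plays_pincer_intruderStar (hν : 0 < ν) (hν1 : ν ≤ 1) {si sj : ℝ}
    (hij : si ≤ sj) (hL : sj < si + P.L) (hx : x ∈ P.gameSpace ν si sj) :
    (P.plays ν si sj x pincer (P.intruderStar ν)).Nonempty := by
  obtain ⟨p, hu, hp, hends⟩ := Play.exists_pincer_play hν hν1 hij hL hx
    (u := fun _ => P.intruderStar ν 0 si sj x) measurable_const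
    fun _ => P.norm_intruderStar_le ν hν _ _ _ _
  refine ⟨p, hends, hp, ?_⟩
  filter_upwards [compl_mem_ae_iff.2 (measure_singleton (0 : ℝ)),
    compl_mem_ae_iff.2 (measure_singleton p.tF)] with t h0 hF ht
  rw [p.intruderStar_eq_of_pincer hν hν1 hL hx hp hu
    ⟨lt_of_le_of_ne ht.1 (Ne.symm h0), lt_of_le_of_ne ht.2 hF⟩, hu]

/-- A saddle point gives the value. Finished plays must exist for every pair, as a supremum over no
plays would be the bottom element (and, for the lower value, an infimum the top one). -/
theorem upperValue_eq {si sj : ℝ} {v : ℝ} {σ : DefenderStrategy} {τ : IntruderStrategy}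
    (hσ : ∀ p : Play P ν si sj x, p.Ends → p.DefendersUse σ → p.payoff ≤ v)
    (hτ : ∀ p : Play P ν si sj x, p.Ends → p.IntruderUses τ → v ≤ p.payoff)
    {𝒟 : Set DefenderStrategy} {𝒜 : Set IntruderStrategy} (hσ𝒟 : σ ∈ 𝒟) (hτ𝒜 : τ ∈ 𝒜)
    (h : ∀ σ ∈ 𝒟, ∀ τ ∈ 𝒜, (P.plays ν si sj x σ τ).Nonempty) :
    P.upperValue ν si sj x 𝒟 𝒜 = (v : EReal) := by
  refine le_antisymm ?_ ?_
  · refine (iInf₂_le σ hσ𝒟).trans (iSup₂_le fun τ' _ => iSup₂_le fun p hp => ?_)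
    exact EReal.coe_le_coe_iff.2 (hσ p hp.1 hp.2.1)
  · refine le_iInf₂ fun σ' hσ' => ?_
    obtain ⟨p, hp⟩ := h σ' hσ' τ hτ𝒜
    exact (EReal.coe_le_coe_iff.2 (hτ p hp.1 hp.2.2)).trans
      ((le_iSup₂ (f := fun p (_ : p ∈ P.plays ν si sj x σ' τ) => (p.payoff : EReal)) p hp).trans
        (le_iSup₂ (f := fun τ (_ : τ ∈ 𝒜) =>
          ⨆ p ∈ plays P ν si sj x σ' τ, (p.payoff : EReal)) τ hτ𝒜))

theorem lowerValue_eq {si sj : ℝ} {v : ℝ} {σ : DefenderStrategy} {τ : IntruderStrategy}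
    (hσ : ∀ p : Play P ν si sj x, p.Ends → p.DefendersUse σ → p.payoff ≤ v)
    (hτ : ∀ p : Play P ν si sj x, p.Ends → p.IntruderUses τ → v ≤ p.payoff)
    {𝒟 : Set DefenderStrategy} {𝒜 : Set IntruderStrategy} (hσ𝒟 : σ ∈ 𝒟) (hτ𝒜 : τ ∈ 𝒜)
    (h : ∀ σ ∈ 𝒟, ∀ τ ∈ 𝒜, (P.plays ν si sj x σ τ).Nonempty) :
    P.lowerValue ν si sj x 𝒟 𝒜 = (v : EReal) := by
  refine le_antisymm ?_ ?_
  · refine iSup₂_le fun τ' hτ' => ?_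
    obtain ⟨p, hp⟩ := h σ hσ𝒟 τ' hτ'
    exact ((iInf₂_le (f := fun σ (_ : σ ∈ 𝒟) =>
        ⨅ p ∈ plays P ν si sj x σ τ', (p.payoff : EReal)) σ hσ𝒟).trans
      (iInf₂_le (f := fun p (_ : p ∈ P.plays ν si sj x σ τ') => (p.payoff : EReal)) p hp)).trans
        (EReal.coe_le_coe_iff.2 (hσ p hp.1 hp.2.1))
  · refine le_trans (le_iInf₂ fun σ' _ => le_iInf₂ fun p hp => ?_)
      (le_iSup₂ (f := fun τ (_ : τ ∈ 𝒜) =>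
        ⨅ σ ∈ 𝒟, ⨅ p ∈ plays P ν si sj x σ τ, (p.payoff : EReal)) τ hτ𝒜)
    exact EReal.coe_le_coe_iff.2 (hτ p hp.1 hp.2.2)

end Target

end

theorem mainTheorem6 (P : Target) (ν : ℝ) (hν : 0 < ν) (hν1 : ν ≤ 1)
    (si sj : ℝ) (hij : si ≤ sj) (hijL : sj < si + P.L)
    (x : Plane) (hx : x ∈ P.gameSpace ν si sj) (hxC : x ∉ P.winRegion ν si sj) :
    -- the identity `-d_bar = ν V_ij`
    (-P.dBar ν si sj x = ν * P.V ν si sj x ∧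
      (si < sj → (P.winRegion ν si sj).Nonempty ∧
        -Metric.infDist x (P.winRegion ν si sj) = ν * P.V ν si sj x)) ∧
    -- the pincer maneuver enforces capture against every intruder control
    (∀ u : ℝ → Plane, Measurable u → (∀ t, ‖u t‖ ≤ ν) →
      ∃ p : Target.Play P ν si sj x, p.u = u ∧ p.DefendersUse Target.pincer ∧ p.EndsInCapture) ∧
    (∀ p : Target.Play P ν si sj x, p.DefendersUse Target.pincer → p.Ends → p.EndsInCapture) ∧
    -- the two strategies are an equilibrium
    P.IsEquilibrium ν si sj x Target.pincer (P.intruderStar ν) (ν * P.V ν si sj x) ∧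
    -- the defenders do not gain by keeping the game from ending either
    (∀ p : Target.Play P ν si sj x, p.IntruderUses (P.intruderStar ν) →
      ν * P.V ν si sj x ≤ p.payoff) ∧
    -- the value of the game: min max = max min
    (∀ (𝒟 : Set Target.DefenderStrategy) (𝒜 : Set Target.IntruderStrategy),
      Target.pincer ∈ 𝒟 → P.intruderStar ν ∈ 𝒜 →
      (∀ σ ∈ 𝒟, ∀ τ ∈ 𝒜, (P.plays ν si sj x σ τ).Nonempty) →
      P.upperValue ν si sj x 𝒟 𝒜 = ((ν * P.V ν si sj x : ℝ) : EReal) ∧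
      P.lowerValue ν si sj x 𝒟 𝒜 = ((ν * P.V ν si sj x : ℝ) : EReal)) := by
  have hV : P.V ν si sj x ≤ 0 := not_lt.1 fun h => hxC ⟨hx, h⟩
  have hd : -P.dBar ν si sj x = ν * P.V ν si sj x := by
    rw [P.dBar_eq ν hν hν1 hijL hij hx hV, neg_neg]
  have hσ : ∀ p : Target.Play P ν si sj x, p.Ends → p.DefendersUse Target.pincer →
      p.payoff ≤ ν * P.V ν si sj x := fun p _ hp => p.payoff_le_of_pincer hν hν1 hijL hx hV hp
  have hτ : ∀ p : Target.Play P ν si sj x, p.IntruderUses (P.intruderStar ν) →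
      ν * P.V ν si sj x ≤ p.payoff := fun p hp => p.le_payoff_of_intruderStar hν hν1 hijL hx hV hp
  have hcap : ∀ p : Target.Play P ν si sj x, p.DefendersUse Target.pincer → p.Ends →
      p.EndsInCapture := fun p hp h => p.endsInCapture_of_pincer hν hν1 hijL hx hV hp h
  refine ⟨⟨hd, fun h => ⟨P.winRegion_nonempty ν hν hν1 hijL.le h, ?_⟩⟩, ?_, hcap, ⟨?_, ?_, hσ, ?_⟩,
    hτ, ?_⟩
  · rw [P.infDist_winRegion ν hν hν1 hijL h, hd]
  · intro u hu hu'
    obtain ⟨p, hpu, hp, hends⟩ := Target.Play.exists_pincer_play hν hν1 hij hijL hx hu hu'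
    exact ⟨p, hpu, hp, hcap p hp hends⟩
  · obtain ⟨p, hp⟩ := P.exists_mem_plays_pincer_intruderStar ν hν hν1 hij hijL hx
    exact ⟨p, hp, hcap p hp.2.1 hp.1⟩
  · exact fun p hp => le_antisymm (hσ p hp.1 hp.2.1) (hτ p hp.2.2)
  · exact fun p _ hp => hτ p hp
  · intro 𝒟 𝒜 h𝒟 h𝒜 h
    exact ⟨P.upperValue_eq ν hσ (fun p _ hp => hτ p hp) h𝒟 h𝒜 h,
      P.lowerValue_eq ν hσ (fun p _ hp => hτ p hp) h𝒟 h𝒜 h⟩
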